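/- Fix $n\ge 1$. Interactive proofs. A $(2n+1)$-round public coin interactive proof system (PCIP) $\Pi$ for a language $\mathcal L$, with finite sets of instances, messages and challenges, is a protocol in which, on instance $x$, the prover sends $a_1$, receives a uniformly random $c_1\in\mathcal C$, …, sends $a_n$, receives a uniformly random $c_n\in\mathcal C$ and finally sends $z$; the verifier accepts iff $V(x,a_1,c_1,\dots,a_n,c_n,z)=1$. Its soundness error $\varepsilon_\Pi$ is the supremum, over $x\notin\mathcal L$ and all (unbounded, quantum) dishonest provers, of the acceptance probability. Fiat–Shamir. In the transformation $\mathsf{FS}(\Pi)$ a proof for $x$ is $(a_1,\dots,a_n,z)$, and it is accepted iff $V(x,a_1,c_1,\dots,a_n,c_n,z)=1$ for $c_1=H(0,x,a_1)$ and $c_i=H(i-1,c_{i-1},a_i)$, $2\le i\le n$. Let $\varepsilon_{\mathsf{FS}(\Pi)}(q)$ be the supremum, over all quantum algorithms making $q$ (controlled) superposition queries $|b\rangle|u\rangle|y\rangle\mapsto|b\rangle|u\rangle|y+b\cdot H(u)\rangle$ to a uniformly random function $H$ with values in $\mathcal C$ (where $+$ is a fixed abelian group operation on $\mathcal C$, such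 as $\oplus$ on bit strings), of the probability that the algorithm outputs some $x\notin\mathcal L$ together with an accepted proof for $x$. Statement. The security loss $O(q^{2n})$ of the multi-round Fiat–Shamir transformation is optimal up to a factor depending only on $n$. Precisely: put $c_1=n^{-2n}$. There is a constant $c_2>0$ depending only on $n$ such that 1. for every $(2n+1)$-round PCIP $\Pi$ with $|\mathcal C|\cdot\varepsilon_\Pi\ge 1$ and every $q\ge 1$, $$\varepsilon_{\mathsf{FS}(\Pi)}(q)\le c_2\,q^{2n}\,\varepsilon_\Pi ;$$ 2. for every $Q\in\mathbb N$ and every $\delta>0$ there is a perfectly complete $(2n+1)$-round PCIP $\Pi$ for a non-empty language, with challenges that are bit strings, with $0<\varepsilon_\Pi\le\delta$ and $|\mathcal C|\ge 1/\varepsilon_\Pi$, such that for all $1\le q\le Q$ $$c_1\,q^{2n}\,\varepsilon_\Pi\;\le\;\varepsilon_{\mathsf{FS}(\Pi)}(q)\;\le\;c_2\,q^{2n}\,\varepsilon_\Pi .$$ -/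

import Mathlib

noncomputable section

open scoped Matrix

/-- An (unbounded, quantum) prover strategy in a public coin interactive protocol with message
space `A`, challenge space `C` and final-message space `Z`. A history lists the pairs
(message, challenge) exchanged so far, the most recent one first. Given the history `h`, the next
message is the outcome of the measurement with Kraus operators `step h a`, and after the last
challenge the final message is the outcome of the measurement with Kraus operators `last h z`. -/
structure ProverStrategy (A C Z : Type) [Fintype A] [Fintype Z] where
  W : Type
  [fintypeW : Fintype W]
  [decEqW : DecidableEq W]
  init : W → ℂ
  init_norm : ∑ w, ‖init w‖ ^ 2 = 1
  step : List (A × C) → A → Matrix W W ℂ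
  step_complete : ∀ h, ∑ a, (step h a)ᴴ * step h a = 1
  last : List (A × C) → Z → Matrix W W ℂ
  last_complete : ∀ h, ∑ z, (last h z)ᴴ * last h z = 1

attribute [instance] ProverStrategy.fintypeW ProverStrategy.decEqW

/-- The unnormalised state of the prover after the history `h`: its squared norm is the
probability that the prover sends the messages in `h`, given the challenges in `h`. -/
def ProverStrategy.state {A C Z : Type} [Fintype A] [Fintype Z] (B : ProverStrategy A C Z) :
    List (A × C) → B.W → ℂ
  | [] => B.init
  | (a, _) :: h => B.step h a *ᵥ B.state h

open scoped Classical in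
/-- The probability that the verifier, who draws the `n` challenges uniformly and independently,
accepts an interaction with the prover strategy `B`, where `V` is the acceptance predicate on
transcripts `((a₁, c₁), …, (aₙ, cₙ))` and final messages `z`. -/
def ProverStrategy.acceptProb {A C Z : Type} [Fintype A] [Fintype C] [Fintype Z] {n : ℕ}
    (B : ProverStrategy A C Z) (V : (Fin n → A × C) → Z → Prop) : ℝ :=
  ∑ t : Fin n → A × C, ∑ z : Z,
    if V t z then
      (1 / (Fintype.card C : ℝ)) ^ n *
        ∑ w, ‖(B.last (List.ofFn t).reverse z *ᵥ B.state (List.ofFn t).reverse) w‖ ^ 2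
    else 0

/-- A `(2n+1)`-round public coin interactive proof system for the language `lang`, with instances
in `X`, messages `aᵢ` in `A`, challenges `cᵢ` uniform in `C` and final message in `Z`; the verifier
accepts the transcript `t = ((a₁, c₁), …, (aₙ, cₙ))` and `z` iff `V x t z`. -/
structure PCIP (n : ℕ) (X A C Z : Type) [Fintype A] [Fintype Z] where
  lang : Set X
  prover : X → ProverStrategy A C Z
  V : X → (Fin n → A × C) → Z → Prop

/-- Perfect completeness. -/
def PCIP.Complete {n : ℕ} {X A C Z : Type} [Fintype A] [Fintype C] [Fintype Z]
    (P : PCIP n X A C Z) : Prop :=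
  ∀ x ∈ P.lang, (P.prover x).acceptProb (P.V x) = 1

/-- The soundness error: the supremum, over the instances outside the language and over all
dishonest provers, of the probability that the verifier accepts. -/
def PCIP.soundnessError {n : ℕ} {X A C Z : Type} [Fintype A] [Fintype C] [Fintype Z]
    (P : PCIP n X A C Z) : ℝ :=
  ⨆ p : {x : X // x ∉ P.lang} × ProverStrategy A C Z, p.2.acceptProb (P.V p.1)

/-- Controlled oracle query `|c⟩|x⟩|y⟩ ↦ |c⟩|x⟩|y + c·H(x)⟩`, with an additional work register. -/
def oracleQuery {W D Y : Type} [AddCommGroup Y] (H : D → Y) (ψ : W × Bool × D × Y → ℂ) :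
    W × Bool × D × Y → ℂ :=
  fun b => ψ (b.1, b.2.1, b.2.2.1, b.2.2.2 - if b.2.1 then H b.2.2.1 else 0)

/-- A quantum algorithm making `q` controlled queries to an oracle `D → Y`. Every step after a
query is a unitary, possibly combined with a projection (aborting otherwise); at the end all
registers are measured in the computational basis and the output is read off the outcome. -/
structure OracleAlgorithm (q : ℕ) (D Y Out : Type) [Fintype D] [DecidableEq D]
    [Fintype Y] [DecidableEq Y] where
  W : Type
  [fintypeW : Fintype W]
  [decEqW : DecidableEq W]
  init : W × Bool × D × Y → ℂ
  init_norm : ∑ b, ‖init b‖ ^ 2 = 1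
  step : Fin q → Matrix (W × Bool × D × Y) (W × Bool × D × Y) ℂ
  step_spec : ∀ i, ∃ U ∈ Matrix.unitaryGroup (W × Bool × D × Y) ℂ,
    ∃ R : Matrix (W × Bool × D × Y) (W × Bool × D × Y) ℂ, IsStarProjection R ∧ step i = U * R
  out : W × Bool × D × Y → Out

attribute [instance] OracleAlgorithm.fintypeW OracleAlgorithm.decEqW

/-- The final state `A_q O^H ⋯ A_1 O^H |φ₀⟩`. -/
def OracleAlgorithm.finalState {q : ℕ} {D Y Out : Type} [Fintype D] [DecidableEq D]
    [Fintype Y] [DecidableEq Y] [AddCommGroup Y] (B : OracleAlgorithm q D Y Out) (H : D → Y) :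
    B.W × Bool × D × Y → ℂ :=
  (List.ofFn B.step).foldl (fun ψ M => M *ᵥ oracleQuery H ψ) B.init

open scoped Classical in
/-- The probability, over a uniformly random oracle `H` and the final measurement, that the
output `o` satisfies `G H o`. -/
def OracleAlgorithm.successProb {q : ℕ} {D Y Out : Type} [Fintype D] [DecidableEq D]
    [Fintype Y] [DecidableEq Y] [AddCommGroup Y] (B : OracleAlgorithm q D Y Out)
    (G : (D → Y) → Out → Prop) : ℝ :=
  (∑ H : D → Y, ∑ b, if G H (B.out b) then ‖B.finalState H b‖ ^ 2 else 0) /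
    (Fintype.card (D → Y) : ℝ)

/-- The inputs of the Fiat–Shamir hash function: `(0, x, a₁)` and `(i, cᵢ, aᵢ₊₁)`. -/
abbrev FSDomain (n : ℕ) (X A C : Type) : Type := Fin n × (X ⊕ C) × A

/-- The Fiat–Shamir challenges `c₁ = H(0, x, a₁)` and `cᵢ₊₁ = H(i, cᵢ, aᵢ₊₁)`, indexed from `0`. -/
def fsChallenge {n : ℕ} {X A C : Type} (H : FSDomain n X A C → C) (x : X) (a : Fin n → A) :
    (i : ℕ) → i < n → C
  | 0, hi => H (⟨0, hi⟩, Sum.inl x, a ⟨0, hi⟩)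
  | i + 1, hi =>
      H (⟨i + 1, hi⟩, Sum.inr (fsChallenge H x a i (Nat.lt_of_succ_lt hi)), a ⟨i + 1, hi⟩)

/-- The verifier of the Fiat–Shamir transformation of `P`. -/
def PCIP.fsAccepts {n : ℕ} {X A C Z : Type} [Fintype A] [Fintype Z] (P : PCIP n X A C Z)
    (H : FSDomain n X A C → C) (x : X) (a : Fin n → A) (z : Z) : Prop :=
  P.V x (fun i => (a i, fsChallenge H x a i i.2)) z

open scoped Classical in
/-- The soundness error of the Fiat–Shamir transformation of `P` in the quantum random oracle
model, against adaptive adversaries making `q` queries: the supremum of the probability of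
producing an instance outside the language with an accepting proof. -/
def PCIP.fsSoundnessError {n : ℕ} {X A C Z : Type} [Fintype X] [Fintype A] [Fintype C] [Fintype Z]
    [AddCommGroup C] (P : PCIP n X A C Z) (q : ℕ) : ℝ :=
  ⨆ B : OracleAlgorithm q (FSDomain n X A C) C (X × (Fin n → A) × Z),
    B.successProb fun H o => o.1 ∉ P.lang ∧ P.fsAccepts H o.1 o.2.1 o.2.2

end

set_option linter.unusedSectionVars false

noncomputable section

open scoped Matrix

/-! Upper bound, by measuring and reprogramming. A uniform oracle together with the Fiat–Shamir
challenges of a fixed output is distributed like a uniform oracle reprogrammed to independent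
uniform challenges at the hash inputs of that output (`sum_fsChallenge`). Hence, for each fixed `H`,
it suffices to bound the total weight of the winning outcomes, where the amplitude of every outcome
is computed with the oracle reprogrammed for that outcome. `oracleQuery_reprog` splits a query into
a part that ignores all points not yet extracted and, for each such point, a difference of two parts
in which the query input is projected onto it. By Minkowski's inequality (`sum_sq_run_cons_le`),
expanding all `q` queries costs a factor `(2q+1)^(2n)`. Branches that extract the messages in order
play the interactive game, whose value is at most the soundness error `ε`. A branch that extracts a
point too early has to guess the previous challenge, which is part of that hash input; this costs
`1/|C|` (`sum_sq_run_reprog_le_value`). Since `1/|C| ≤ ε`, this error is harmless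
(`fsSoundnessError_le`).

Lower bound. In `subsetProtocol` a wrong instance is accepted iff all challenges lie in a set `S` of
density `p = 2^(-m)`, so `ε = p^n`. The attack chooses the messages round by round. A search
consists of `j` Grover iterations and a checking query, takes `2j+1` queries and succeeds with
probability about `(2j+1)^2 p`. If it fails, the next search tries fresh messages in the same round.
A final search is left unchecked, and all further challenges are left to chance. As `p → 0`, a lower
bound for the success probability, divided by `p^n`, tends to `attackLimit` (`tendsto_attackBound`).
A search contributes at least the factor `(2j+1)^2 + 1` there as long as enough rounds are left
(`prod_mul_le_attackLimit`); the summand 1 comes from the branch in which it fails.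

That summand makes the constant `n^(-2n)` reachable. Checked searches take odd numbers of queries,
but two searches with `e-1` and `e+1` queries, `e` even, give `((e-1)^2+1)((e+1)^2+1) = e^4+4`, more
than the `e^4` that is needed. `exists_schedule` distributes any `q` queries so that the limit
strictly exceeds `(q/n)^(2n)`; strictness allows a single small `p` to serve all `q ≤ Q`
(`exists_pcip_of_attackLimit`).

The attack is described as a random process on a classical memory. `Implementable` defers its
measurements, and `Reach` turns the resulting isometries into unitaries on one work register. -/

/-- The squared `ℓ²` norm. -/
def nsq {ι : Type*} [Fintype ι] (ψ : ι → ℂ) : ℝ := ∑ i, ‖ψ i‖ ^ 2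

/-! ### Norms, contractions and Minkowski's inequality -/

section Norm

variable {ι κ : Type*} [Fintype ι] [Fintype κ]

lemma nsq_nonneg (ψ : ι → ℂ) : 0 ≤ nsq ψ := Finset.sum_nonneg fun _ _ => by positivity

lemma ofReal_nsq (ψ : ι → ℂ) : (nsq ψ : ℂ) = star ψ ⬝ᵥ ψ := by
  simp only [nsq, dotProduct, Complex.ofReal_sum, Pi.star_apply]
  refine Finset.sum_congr rfl fun i _ => ?_
  rw [Complex.ofReal_pow, ← Complex.conj_mul']
  rfl

lemma ofReal_nsq_mulVec (M : Matrix κ ι ℂ) (ψ : ι → ℂ) :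
    (nsq (M *ᵥ ψ) : ℂ) = star ψ ⬝ᵥ ((Mᴴ * M) *ᵥ ψ) := by
  rw [ofReal_nsq, Matrix.star_mulVec, ← Matrix.dotProduct_mulVec, Matrix.mulVec_mulVec]

lemma nsq_mulVec_of_isometry [DecidableEq ι] {M : Matrix κ ι ℂ} (h : Mᴴ * M = 1) (ψ : ι → ℂ) :
    nsq (M *ᵥ ψ) = nsq ψ := by
  have := ofReal_nsq_mulVec M ψ
  rw [h, Matrix.one_mulVec, ← ofReal_nsq] at this
  exact_mod_cast this

lemma sum_nsq_mulVec [DecidableEq ι] {σ : Type*} [Fintype σ] {M : σ → Matrix κ ι ℂ}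
    (h : ∑ s, (M s)ᴴ * M s = 1) (ψ : ι → ℂ) : ∑ s, nsq (M s *ᵥ ψ) = nsq ψ := by
  have : ((∑ s, nsq (M s *ᵥ ψ) : ℝ) : ℂ) = nsq ψ := by
    rw [Complex.ofReal_sum, ofReal_nsq]
    simp only [ofReal_nsq_mulVec]
    rw [← dotProduct_sum, ← Matrix.sum_mulVec, h, Matrix.one_mulVec]
  exact_mod_cast this

/-- A matrix that does not increase the norm. -/
def Contraction (M : Matrix κ ι ℂ) : Prop := ∀ ψ, nsq (M *ᵥ ψ) ≤ nsq ψ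

/-- Pythagoras for `R` and `1 - R`. -/
lemma contraction_of_isStarProjection {R : Matrix ι ι ℂ}
    (h : IsStarProjection R) : Contraction R := by
  classical
  intro ψ
  have hs : Rᴴ = R := h.isSelfAdjoint
  have hi : R * R = R := h.isIdempotentElem
  have : nsq (R *ᵥ ψ) + nsq ((1 - R) *ᵥ ψ) = nsq ψ := by
    have : ((nsq (R *ᵥ ψ) + nsq ((1 - R) *ᵥ ψ) : ℝ) : ℂ) = nsq ψ := by
      rw [Complex.ofReal_add, ofReal_nsq_mulVec, ofReal_nsq_mulVec, ofReal_nsq,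
        ← dotProduct_add, ← Matrix.add_mulVec]
      have : Rᴴ * R + (1 - R)ᴴ * (1 - R) = 1 := by
        rw [Matrix.conjTranspose_sub, Matrix.conjTranspose_one, hs, sub_mul, mul_sub, mul_sub, hi]
        simp
      rw [this, Matrix.one_mulVec]
    exact_mod_cast this
  linarith [nsq_nonneg ((1 - R) *ᵥ ψ)]

/-- Minkowski's inequality, in terms of bounds for the squared norms. -/
lemma sum_sq_sum_le {ι σ : Type*} (S : Finset ι) (T : Finset σ) (F : σ → ι → ℂ) (B : σ → ℝ)
    (hB : ∀ s ∈ T, 0 ≤ B s) (h : ∀ s ∈ T, ∑ i ∈ S, ‖F s i‖ ^ 2 ≤ B s ^ 2) :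
    ∑ i ∈ S, ‖∑ s ∈ T, F s i‖ ^ 2 ≤ (∑ s ∈ T, B s) ^ 2 := by
  let v : σ → EuclideanSpace ℂ S := fun s => WithLp.toLp 2 fun i => F s i
  have hv : ∀ s, ‖v s‖ ^ 2 = ∑ i ∈ S, ‖F s i‖ ^ 2 := fun s => by
    rw [EuclideanSpace.norm_sq_eq, ← Finset.sum_coe_sort S]
  have hsum : ‖∑ s ∈ T, v s‖ ^ 2 = ∑ i ∈ S, ‖∑ s ∈ T, F s i‖ ^ 2 := by
    rw [EuclideanSpace.norm_sq_eq, ← Finset.sum_coe_sort S]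
    refine Finset.sum_congr rfl fun i _ => ?_
    simp [v]
  rw [← hsum]
  refine pow_le_pow_left₀ (norm_nonneg _) ((norm_sum_le _ _).trans (Finset.sum_le_sum ?_)) 2
  intro s hs
  exact le_of_sq_le_sq ((hv s).trans_le (h s hs)) (hB s hs)

lemma sum_sq_add_le {ι : Type*} (S : Finset ι) (f g : ι → ℂ) {a b : ℝ} (ha : 0 ≤ a) (hb : 0 ≤ b)
    (hf : ∑ i ∈ S, ‖f i‖ ^ 2 ≤ a ^ 2) (hg : ∑ i ∈ S, ‖g i‖ ^ 2 ≤ b ^ 2) :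
    ∑ i ∈ S, ‖f i + g i‖ ^ 2 ≤ (a + b) ^ 2 := by
  have := sum_sq_sum_le S Finset.univ (fun s : Bool => if s then f else g)
    (fun s => if s then a else b) (by simp [ha, hb]) (by simp [hf, hg])
  simpa using this

lemma sum_sq_sub_le {ι : Type*} (S : Finset ι) (f g : ι → ℂ) {a b : ℝ} (ha : 0 ≤ a) (hb : 0 ≤ b)
    (hf : ∑ i ∈ S, ‖f i‖ ^ 2 ≤ a ^ 2) (hg : ∑ i ∈ S, ‖g i‖ ^ 2 ≤ b ^ 2) :
    ∑ i ∈ S, ‖f i - g i‖ ^ 2 ≤ (a + b) ^ 2 := by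
  simpa [sub_eq_add_neg] using sum_sq_add_le S f (fun i => - g i) ha hb hf (by simpa using hg)

end Norm

/-! ### Query algorithms as norm-nonincreasing maps -/

section Run

variable {W D Y : Type} [AddCommGroup Y]

/-- Queries to `H` alternating with the operators of the list `Ms`. -/
def run [Fintype W] [Fintype D] [Fintype Y] (H : D → Y)
    (Ms : List (Matrix (W × Bool × D × Y) (W × Bool × D × Y) ℂ)) (ψ : W × Bool × D × Y → ℂ) :
    W × Bool × D × Y → ℂ :=
  Ms.foldl (fun ψ M => M *ᵥ oracleQuery H ψ) ψ

lemma oracleQuery_add (H : D → Y) (φ ψ : W × Bool × D × Y → ℂ) :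
    oracleQuery H (φ + ψ) = oracleQuery H φ + oracleQuery H ψ := rfl

variable [Fintype W] [Fintype D] [Fintype Y]

lemma nsq_oracleQuery (H : D → Y) (ψ : W × Bool × D × Y → ℂ) :
    nsq (oracleQuery H ψ) = nsq ψ := by
  simp only [nsq, oracleQuery, Fintype.sum_prod_type]
  refine Finset.sum_congr rfl fun w _ => Finset.sum_congr rfl fun b _ =>
    Finset.sum_congr rfl fun d _ => ?_
  exact Fintype.sum_equiv (Equiv.subRight (if b = true then H d else 0)) _ _ fun y => rfl

lemma run_cons (H : D → Y) (M : Matrix (W × Bool × D × Y) (W × Bool × D × Y) ℂ)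
    (Ms : List (Matrix (W × Bool × D × Y) (W × Bool × D × Y) ℂ)) (ψ : W × Bool × D × Y → ℂ) :
    run H (M :: Ms) ψ = run H Ms (M *ᵥ oracleQuery H ψ) := rfl

lemma run_add (H : D → Y) (Ms : List (Matrix (W × Bool × D × Y) (W × Bool × D × Y) ℂ))
    (φ ψ : W × Bool × D × Y → ℂ) : run H Ms (φ + ψ) = run H Ms φ + run H Ms ψ := by
  induction Ms generalizing φ ψ with
  | nil => rfl
  | cons M Ms ih => simp only [run_cons, oracleQuery_add, Matrix.mulVec_add, ih]

/-- `run` as a linear map. -/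
def runLin (H : D → Y) (Ms : List (Matrix (W × Bool × D × Y) (W × Bool × D × Y) ℂ)) :
    (W × Bool × D × Y → ℂ) →+ (W × Bool × D × Y → ℂ) where
  toFun := run H Ms
  map_zero' := by simpa using run_add H Ms 0 0
  map_add' := run_add H Ms

lemma runLin_apply (H : D → Y) (Ms : List (Matrix (W × Bool × D × Y) (W × Bool × D × Y) ℂ))
    (ψ : W × Bool × D × Y → ℂ) : runLin H Ms ψ = run H Ms ψ := rfl

lemma nsq_run_le (H : D → Y) {Ms : List (Matrix (W × Bool × D × Y) (W × Bool × D × Y) ℂ)}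
    (hMs : ∀ M ∈ Ms, Contraction M) (ψ : W × Bool × D × Y → ℂ) : nsq (run H Ms ψ) ≤ nsq ψ := by
  induction Ms generalizing ψ with
  | nil => exact le_rfl
  | cons M Ms ih =>
    rw [run_cons]
    refine (ih (fun M hM => hMs M (List.mem_cons_of_mem _ hM)) _).trans ?_
    exact (hMs M List.mem_cons_self _).trans (nsq_oracleQuery H ψ).le

end Run

section Algorithm

variable {q : ℕ} {D Y Out : Type} [Fintype D] [DecidableEq D] [Fintype Y] [DecidableEq Y]

/-- Contractivity is all that the upper bound uses about the steps, so aborting projections need no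
separate treatment there. -/
lemma OracleAlgorithm.contraction_step (B : OracleAlgorithm q D Y Out) :
    ∀ M ∈ List.ofFn B.step, Contraction M := by
  intro M hM
  obtain ⟨i, rfl⟩ := (List.mem_ofFn' _ _).1 hM
  obtain ⟨U, hU, R, hR, h⟩ := B.step_spec i
  intro ψ
  rw [h, ← Matrix.mulVec_mulVec, nsq_mulVec_of_isometry (Matrix.mem_unitaryGroup_iff'.1 hU)]
  exact contraction_of_isStarProjection hR ψ

lemma OracleAlgorithm.nsq_finalState_le [AddCommGroup Y] (B : OracleAlgorithm q D Y Out)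
    (H : D → Y) : nsq (B.finalState H) ≤ 1 :=
  (nsq_run_le H B.contraction_step B.init).trans_eq B.init_norm

open scoped Classical in
lemma OracleAlgorithm.successProb_le_one [AddCommGroup Y] (B : OracleAlgorithm q D Y Out)
    (G : (D → Y) → Out → Prop) : B.successProb G ≤ 1 := by
  unfold OracleAlgorithm.successProb
  refine div_le_one_of_le₀ ?_ (Nat.cast_nonneg _)
  calc _ ≤ ∑ _H : D → Y, (1 : ℝ) := Finset.sum_le_sum fun H _ => ?_
    _ = _ := by simp
  refine le_trans (Finset.sum_le_sum fun b _ => ?_) (B.nsq_finalState_le H)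
  split_ifs
  · exact le_rfl
  · positivity

end Algorithm

/-! ### Reprogramming the oracle at the points that the outcome refers to -/

section Reprogramming

variable {n : ℕ} {W D C : Type} [DecidableEq D]

/-- The function `H`, reprogrammed to `c i` at the point `γ i` for all `i ∈ J`; the points with
index `i` are the `d` with `idx d = i`. -/
def reprog (idx : D → Fin n) (H : D → C) (J : Finset (Fin n)) (γ : Fin n → D) (c : Fin n → C) :
    D → C := fun d => if idx d ∈ J ∧ γ (idx d) = d then c (idx d) else H d

/-- The projection onto the query input `d`. -/
def atPoint (d : D) (ψ : W × Bool × D × C → ℂ) : W × Bool × D × C → ℂ :=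
  fun b => if b.2.2.1 = d then ψ b else 0

lemma reprog_congr (idx : D → Fin n) (H : D → C) {J : Finset (Fin n)} {γ γ' : Fin n → D}
    {c c' : Fin n → C} (h : ∀ i ∈ J, γ i = γ' i ∧ c i = c' i) :
    reprog idx H J γ c = reprog idx H J γ' c' := by
  funext d
  unfold reprog
  by_cases hd : idx d ∈ J
  · rw [(h _ hd).1, (h _ hd).2]
  · simp [hd]

/-- The two oracles differ at most at the points `β i` with `i ∉ J`. These have distinct indices, so
on a query input `d` at most the summand `i = idx d` is nonzero; there it exchanges the old value
for the reprogrammed one. -/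
lemma oracleQuery_reprog [AddCommGroup C] (idx : D → Fin n) (H : D → C) (J : Finset (Fin n))
    {β γ : Fin n → D}
    {c κ : Fin n → C} (hβ : ∀ i, idx (β i) = i) (h : ∀ i ∈ J, β i = γ i ∧ c i = κ i)
    (ψ : W × Bool × D × C → ℂ) :
    oracleQuery (reprog idx H Finset.univ β c) ψ = oracleQuery (reprog idx H J γ κ) ψ +
      ∑ i ∈ Jᶜ, (oracleQuery (reprog idx H (insert i J) (Function.update γ i (β i))
          (Function.update κ i (c i))) (atPoint (β i) ψ) -
        oracleQuery (reprog idx H J γ κ) (atPoint (β i) ψ)) := by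
  rw [← reprog_congr idx H h]
  have : ∀ i, reprog idx H (insert i J) (Function.update γ i (β i)) (Function.update κ i (c i)) =
      reprog idx H (insert i J) β c := fun i => by
    refine reprog_congr idx H fun i' hi' => ?_
    by_cases hii : i' = i
    · subst hii; simp
    · rw [Function.update_of_ne hii, Function.update_of_ne hii]
      have := h i' (by simpa [hii] using hi')
      exact ⟨this.1.symm, this.2.symm⟩
  simp only [this]
  funext ⟨w, b, d, y⟩
  simp only [Pi.add_apply, Finset.sum_apply, Pi.sub_apply, oracleQuery, atPoint]
  by_cases hd : β (idx d) = d
  · by_cases hJ : idx d ∈ J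
    · rw [Finset.sum_eq_zero]
      · simp [reprog, hJ]
      · intro i hi
        rw [if_neg, if_neg, sub_zero] <;>
        · rintro rfl
          rw [hβ] at hJ
          exact (Finset.mem_compl.1 hi) hJ
    · rw [Finset.sum_eq_single (idx d)]
      · simp [reprog, hd]
      · intro i _ hne
        rw [if_neg, if_neg, sub_zero] <;>
        · rintro rfl
          exact hne (hβ i).symm
      · intro h'
        exact absurd (Finset.mem_compl.2 hJ) h'
  · rw [Finset.sum_eq_zero]
    · simp [reprog, hd]
    · intro i _
      rw [if_neg, if_neg, sub_zero] <;>
      · rintro rfl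
        exact hd (by rw [hβ])

/-- Counts branches: with `k` points missing, one query leads to one branch that extracts nothing
and to `2k` branches with `k - 1` points missing. -/
lemma pow_add_le_add_two_pow {x : ℝ} (hx : 0 ≤ x) (k : ℕ) :
    x ^ k + 2 * (k * x ^ (k - 1)) ≤ (x + 2) ^ k := by
  induction k with
  | zero => simp
  | succ k ih =>
    have h1 : x ^ (k + 1) = x * x ^ k := pow_succ' x k
    have h2 : (k : ℝ) * x ^ k = x * (k * x ^ (k - 1)) := by
      cases k with
      | zero => simp
      | succ k => simp [pow_succ]; ring
    have h3 : 0 ≤ (k : ℝ) * x ^ (k - 1) := by positivity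
    have := mul_le_mul_of_nonneg_left ih (by linarith : (0 : ℝ) ≤ x + 2)
    rw [pow_succ' (x + 2)]
    push_cast
    nlinarith

variable [Fintype W] [Fintype D] [Fintype C]

lemma sum_nsq_atPoint (ψ : W × Bool × D × C → ℂ) : ∑ d, nsq (atPoint d ψ) = nsq ψ := by
  simp only [nsq, atPoint]
  rw [Finset.sum_comm]
  refine Finset.sum_congr rfl fun b _ => ?_
  rw [Finset.sum_eq_single b.2.2.1] <;> simp +contextual [eq_comm]

variable [AddCommGroup C]

/-- The induction step on the number of queries, shared by the two extraction bounds below. The set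
`J` holds the indices extracted so far, and the exponent counts the others. In `hterm`, `φ` stands
for either state of the difference in `oracleQuery_reprog`, with the extracted point reprogrammed or
not; both have at most the norm of the projected state. -/
lemma sum_sq_run_cons_le {ι : Type*} (S : Finset ι) (idx : D → Fin n) (H : D → C)
    (J : Finset (Fin n)) (β : ι → Fin n → D) (c : ι → Fin n → C) (bs : ι → W × Bool × D × C)
    (γ : Fin n → D) (κ : Fin n → C) (hβ : ∀ p i, idx (β p i) = i)
    (h : ∀ p ∈ S, ∀ i ∈ J, β p i = γ i ∧ c p i = κ i)
    {M : Matrix (W × Bool × D × C) (W × Bool × D × C) ℂ} (hM : Contraction M)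
    (Ms : List (Matrix (W × Bool × D × C) (W × Bool × D × C) ℂ)) (ψ : W × Bool × D × C → ℂ)
    {x A : ℝ} (hx : 0 ≤ x) (hA : 0 ≤ A)
    (hmain : ∑ p ∈ S, ‖run (reprog idx H Finset.univ (β p) (c p)) Ms
      (M *ᵥ oracleQuery (reprog idx H J γ κ) ψ) (bs p)‖ ^ 2 ≤ (x ^ Jᶜ.card * A) ^ 2)
    (hterm : ∀ i ∉ J, ∀ φ : D → C → (W × Bool × D × C → ℂ),
      (∀ d c, nsq (φ d c) ≤ nsq (atPoint d ψ)) →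
      ∑ p ∈ S, ‖run (reprog idx H Finset.univ (β p) (c p)) Ms (φ (β p i) (c p i)) (bs p)‖ ^ 2 ≤
        (x ^ (Jᶜ.card - 1) * A) ^ 2) :
    ∑ p ∈ S, ‖run (reprog idx H Finset.univ (β p) (c p)) (M :: Ms) ψ (bs p)‖ ^ 2 ≤
      ((x + 2) ^ Jᶜ.card * A) ^ 2 := by
  have key : ∀ p ∈ S, run (reprog idx H Finset.univ (β p) (c p)) (M :: Ms) ψ (bs p) =
      run (reprog idx H Finset.univ (β p) (c p)) Ms
        (M *ᵥ oracleQuery (reprog idx H J γ κ) ψ) (bs p) +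
      ∑ i ∈ Jᶜ, (run (reprog idx H Finset.univ (β p) (c p)) Ms
        (M *ᵥ oracleQuery (reprog idx H (insert i J) (Function.update γ i (β p i))
          (Function.update κ i (c p i))) (atPoint (β p i) ψ)) (bs p) -
        run (reprog idx H Finset.univ (β p) (c p)) Ms
        (M *ᵥ oracleQuery (reprog idx H J γ κ) (atPoint (β p i) ψ)) (bs p)) := by
    intro p hp
    rw [run_cons, oracleQuery_reprog idx H J (hβ p) (h p hp), Matrix.mulVec_add,
      Matrix.mulVec_sum]
    simp only [Matrix.mulVec_sub, ← runLin_apply, map_add, map_sum, map_sub, Pi.add_apply,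
      Finset.sum_apply, Pi.sub_apply]
  rw [Finset.sum_congr rfl fun p hp => by rw [key p hp]]
  have hnsq : ∀ (H' : D → C) (d : D), nsq (M *ᵥ oracleQuery H' (atPoint d ψ)) ≤
      nsq (atPoint d ψ) := fun H' d => (hM _).trans (nsq_oracleQuery H' _).le
  have hxA : 0 ≤ x ^ (Jᶜ.card - 1) * A := by positivity
  refine (sum_sq_add_le S _ _ (b := ∑ i ∈ Jᶜ, (x ^ (Jᶜ.card - 1) * A + x ^ (Jᶜ.card - 1) * A))
    (by positivity) (Finset.sum_nonneg fun _ _ => by positivity) hmain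
    (sum_sq_sum_le S Jᶜ (fun i p => _) _ (fun _ _ => by positivity) fun i hi => ?_)).trans ?_
  · exact sum_sq_sub_le S _ _ hxA hxA
      (hterm i (Finset.mem_compl.1 hi) (fun d c' => M *ᵥ oracleQuery (reprog idx H (insert i J)
        (Function.update γ i d) (Function.update κ i c')) (atPoint d ψ)) fun d c' => hnsq _ d)
      (hterm i (Finset.mem_compl.1 hi) (fun d _ => M *ᵥ oracleQuery (reprog idx H J γ κ)
        (atPoint d ψ)) fun d _ => hnsq _ d)
  · refine pow_le_pow_left₀ (add_nonneg (by positivity)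
      (Finset.sum_nonneg fun _ _ => by positivity)) ?_ 2
    rw [Finset.sum_const, nsmul_eq_mul]
    have := mul_le_mul_of_nonneg_right (pow_add_le_add_two_pow hx Jᶜ.card) hA
    linarith

/-- For fixed challenges, reprogramming the oracle at the points that the outcome refers to
increases the total probability by a polynomial factor at most. -/
lemma sum_sq_run_reprog_le (idx : D → Fin n) (H : D → C)
    (β : W × Bool × D × C → Fin n → D) (hβ : ∀ b i, idx (β b i) = i) (c : Fin n → C)
    (Ms : List (Matrix (W × Bool × D × C) (W × Bool × D × C) ℂ)) (hMs : ∀ M ∈ Ms, Contraction M)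
    (J : Finset (Fin n)) (γ : Fin n → D) (ψ : W × Bool × D × C → ℂ) :
    ∑ b with ∀ i ∈ J, β b i = γ i, ‖run (reprog idx H Finset.univ (β b) c) Ms ψ b‖ ^ 2 ≤
      ((2 * Ms.length + 1 : ℝ) ^ Jᶜ.card) ^ 2 * nsq ψ := by
  induction Ms generalizing J γ ψ with
  | nil =>
    simp only [List.length_nil, Nat.cast_zero, mul_zero, zero_add, one_pow, one_mul]
    exact Finset.sum_le_univ_sum_of_nonneg fun _ => by positivity
  | cons M Ms ih =>
    have hM := hMs M List.mem_cons_self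
    have ih' := ih fun M hM => hMs M (List.mem_cons_of_mem _ hM)
    have hs : Real.sqrt (nsq ψ) ^ 2 = nsq ψ := Real.sq_sqrt (nsq_nonneg ψ)
    have := sum_sq_run_cons_le {b | ∀ i ∈ J, β b i = γ i} idx H J β (fun _ => c) id γ c hβ
      (fun p hp i hi => ⟨(Finset.mem_filter.1 hp).2 i hi, rfl⟩) hM Ms ψ
      (x := 2 * Ms.length + 1) (A := Real.sqrt (nsq ψ)) (by positivity) (Real.sqrt_nonneg _) ?_ ?_
    · rw [mul_pow, hs] at this
      refine this.trans_eq ?_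
      push_cast [List.length_cons]
      ring
    · rw [mul_pow, hs]
      exact (ih' J γ _).trans (mul_le_mul_of_nonneg_left
        ((hM _).trans (nsq_oracleQuery _ ψ).le) (by positivity))
    · intro i hi φ hφ
      rw [mul_pow, hs]
      have hcard : (insert i J)ᶜ.card = Jᶜ.card - 1 := by
        rw [Finset.card_compl, Finset.card_compl, Finset.card_insert_of_notMem hi, Nat.sub_sub]
      -- Outcomes are sorted by the extracted point `d`, which then joins the constraints; the
      -- projections of `ψ` onto the various `d` are orthogonal, so no factor is lost.
      rw [← Finset.sum_fiberwise _ (fun b => β b i)]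
      calc _ = ∑ d, ∑ b with ∀ i' ∈ insert i J, β b i' = Function.update γ i d i',
            ‖run (reprog idx H Finset.univ (β b) c) Ms (φ d (c i)) b‖ ^ 2 := by
            refine Finset.sum_congr rfl fun d _ => ?_
            rw [Finset.filter_filter]
            refine Finset.sum_congr ?_ ?_
            · ext b
              simp only [Finset.mem_filter, Finset.mem_univ, true_and, Finset.mem_insert,
                forall_eq_or_imp, Function.update_self]
              rw [and_comm]
              refine and_congr_right fun _ => forall₂_congr fun i' hi' => ?_
              rw [Function.update_of_ne (by rintro rfl; exact hi hi')]
            · intro b hb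
              have : β b i = d := by
                simpa using (Finset.mem_filter.1 hb).2 i (Finset.mem_insert_self _ _)
              rw [this]; rfl
        _ ≤ ∑ d, ((2 * Ms.length + 1 : ℝ) ^ (Jᶜ.card - 1)) ^ 2 * nsq (atPoint d ψ) := by
            refine Finset.sum_le_sum fun d _ => ?_
            have := ih' (insert i J) (Function.update γ i d) (φ d (c i))
            rw [hcard] at this
            exact this.trans (mul_le_mul_of_nonneg_left (hφ d _) (by positivity))
        _ = _ := by rw [← Finset.mul_sum, sum_nsq_atPoint]

end Reprogramming

/-! ### Counting challenges, and extracting the messages in order -/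

/-- The indices below `j`. -/
def below (n j : ℕ) : Finset (Fin n) := {i | i.val < j}

lemma mem_below {n j : ℕ} {i : Fin n} : i ∈ below n j ↔ i.val < j := by simp [below]

lemma below_succ {n : ℕ} (j : Fin n) : below n (j + 1) = insert j (below n j) := by
  ext i
  simp only [mem_below, Finset.mem_insert, Fin.ext_iff]
  omega

lemma card_compl_below {n j k : ℕ} (h : j + k = n) : (below n j)ᶜ.card = k := by
  have : (below n j).card = j := by
    have : below n j = Finset.univ.map (Fin.castLEEmb (show j ≤ n by omega)) := by
      ext i
      simp only [mem_below, Finset.mem_map, Finset.mem_univ, true_and]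
      constructor
      · intro hi
        exact ⟨⟨i, hi⟩, rfl⟩
      · rintro ⟨a, rfl⟩
        exact a.2
    rw [this, Finset.card_map, Finset.card_univ, Fintype.card_fin]
  rw [Finset.card_compl, this, Fintype.card_fin]
  omega

lemma card_filter_eq_on {n : ℕ} {C : Type} [Fintype C] [DecidableEq C] (J : Finset (Fin n))
    (κ : Fin n → C) :
    (Finset.univ.filter fun c : Fin n → C => ∀ i ∈ J, c i = κ i).card =
      Fintype.card C ^ Jᶜ.card := by
  have : (Finset.univ.filter fun c : Fin n → C => ∀ i ∈ J, c i = κ i) =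
      Fintype.piFinset fun i => if i ∈ J then {κ i} else Finset.univ := by
    ext c
    simp only [Finset.mem_filter, Finset.mem_univ, true_and, Fintype.mem_piFinset]
    refine forall_congr' fun i => ?_
    by_cases hi : i ∈ J <;> simp [hi]
  rw [this, Fintype.card_piFinset, ← Finset.prod_compl_mul_prod J]
  rw [Finset.prod_congr rfl (g := fun _ => Fintype.card C), Finset.prod_const,
    Finset.prod_eq_one (s := J), mul_one]
  · intro i hi; simp [hi]
  · intro i hi; simp [Finset.mem_compl.1 hi]

/-- The case without remaining queries. By `hpt`, each point named by a fixed outcome `b` depends on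
earlier challenges only, so `b` is a strategy in the interactive game; averaging over one challenge
after the other with `hstep` bounds the number of winning challenges. -/
lemma card_mul_le_of_value {n : ℕ} {D C : Type} [Fintype C] [DecidableEq D] [DecidableEq C]
    {B : Type} (pt : B → (Fin n → C) → Fin n → D)
    (ok : B → (Fin n → C) → Prop) [∀ b c, Decidable (ok b c)]
    (v : ℕ → (Fin n → D) → (Fin n → C) → ℝ) (hv : ∀ j γ κ, 0 ≤ v j γ κ)
    (hpt : ∀ b c c' i, (∀ i', i' < i → c i' = c' i') → pt b c i = pt b c' i)
    (hstep : ∀ (j : Fin n) γ κ d, ∑ c', v (j + 1) (Function.update γ j d)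
      (Function.update κ j c') ≤ Fintype.card C * v j γ κ)
    (hend : ∀ b κ, ok b κ → 1 ≤ v n (pt b κ) κ) (b : B) (k j : ℕ) (hk : j + k = n)
    (γ : Fin n → D) (κ : Fin n → C) :
    ((Finset.univ.filter fun c : Fin n → C =>
      (∀ i ∈ below n j, c i = κ i ∧ pt b c i = γ i) ∧ ok b c).card : ℝ) ≤
      Fintype.card C ^ k * v j γ κ := by
  induction k generalizing j γ κ with
  | zero =>
    obtain rfl : j = n := by omega
    have huniv : ∀ i, i ∈ below j j := fun i => mem_below.2 i.2
    by_cases h : (∀ i, pt b κ i = γ i) ∧ ok b κ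
    · have h1 := hend b κ h.2
      rw [funext h.1] at h1
      rw [pow_zero, one_mul]
      refine le_trans ?_ h1
      rw [← Nat.cast_one, Nat.cast_le, ← Finset.card_singleton κ]
      refine Finset.card_le_card fun c hc => ?_
      rw [Finset.mem_singleton]
      funext i
      exact ((Finset.mem_filter.1 hc).2.1 i (huniv i)).1
    · rw [Finset.filter_false_of_mem]
      · simpa using hv j γ κ
      · rintro c - ⟨h1, h2⟩
        obtain rfl : c = κ := funext fun i => (h1 i (huniv i)).1
        exact h ⟨fun i => (h1 i (huniv i)).2, h2⟩
  | succ k ih =>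
    let j' : Fin n := ⟨j, by omega⟩
    rw [Finset.card_eq_sum_card_fiberwise (f := fun c => c j') (t := Finset.univ)
      (fun _ _ => Finset.mem_coe.2 (Finset.mem_univ _)), Nat.cast_sum]
    calc _ ≤ ∑ c', (Fintype.card C : ℝ) ^ k * v (j + 1) (Function.update γ j' (pt b κ j'))
          (Function.update κ j' c') := by
          refine Finset.sum_le_sum fun c' _ => le_trans ?_ (ih (j + 1) (by omega) _ _)
          rw [Nat.cast_le]
          refine Finset.card_le_card fun c hc => ?_
          simp only [Finset.mem_filter, Finset.mem_univ, true_and] at hc ⊢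
          obtain ⟨⟨h1, h2⟩, rfl⟩ := hc
          refine ⟨fun i hi => ?_, h2⟩
          rw [show j + 1 = j'.val + 1 from rfl, below_succ, Finset.mem_insert] at hi
          by_cases hij : i = j'
          · subst hij
            rw [Function.update_self, Function.update_self]
            exact ⟨rfl, hpt b c κ _ fun i' hi' => (h1 i' (mem_below.2 hi')).1⟩
          · rw [Function.update_of_ne hij, Function.update_of_ne hij]
            exact h1 i (hi.resolve_left hij)
      _ ≤ _ := by
          rw [← Finset.mul_sum, pow_succ, mul_assoc]
          exact mul_le_mul_of_nonneg_left (hstep j' γ κ _) (by positivity)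

section Extraction

variable {n : ℕ} {W D C : Type} [Fintype W] [Fintype D] [DecidableEq D] [Fintype C]
  [DecidableEq C] [AddCommGroup C]

/-- Extraction of the messages one by one: the probability of an accepted outcome, with the oracle
reprogrammed to uniform challenges at the points that the outcome refers to, is at most the value
`v` of the interactive game, up to a polynomial factor and an error `1 / |C|`. -/
lemma sum_sq_run_reprog_le_value (idx : D → Fin n) (prev : D → C) (H : D → C)
    (pt : W × Bool × D × C → (Fin n → C) → Fin n → D) (hidx : ∀ b c i, idx (pt b c i) = i)
    (hprev : ∀ b c (i i' : Fin n), i'.val + 1 = i.val → prev (pt b c i) = c i')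
    (hpt : ∀ b c c' i, (∀ i', i' < i → c i' = c' i') → pt b c i = pt b c' i)
    (ok : W × Bool × D × C → (Fin n → C) → Prop) [∀ b c, Decidable (ok b c)]
    (v : ℕ → (Fin n → D) → (Fin n → C) → ℝ) (hv : ∀ j γ κ, 0 ≤ v j γ κ)
    (hstep : ∀ (j : Fin n) γ κ d, ∑ c', v (j + 1) (Function.update γ j d)
      (Function.update κ j c') ≤ Fintype.card C * v j γ κ)
    (hend : ∀ b κ, ok b κ → 1 ≤ v n (pt b κ) κ)
    (Ms : List (Matrix (W × Bool × D × C) (W × Bool × D × C) ℂ)) (hMs : ∀ M ∈ Ms, Contraction M)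
    (k j : ℕ) (hk : j + k = n) (γ : Fin n → D) (κ : Fin n → C) (ψ : W × Bool × D × C → ℂ) :
    ∑ p : (Fin n → C) × (W × Bool × D × C) with
      (∀ i ∈ below n j, p.1 i = κ i ∧ pt p.2 p.1 i = γ i) ∧ ok p.2 p.1,
      ‖run (reprog idx H Finset.univ (pt p.2 p.1) p.1) Ms ψ p.2‖ ^ 2 ≤
      ((2 * Ms.length + 1 : ℝ) ^ k) ^ 2 *
        (Fintype.card C ^ k * (v j γ κ + 1 / Fintype.card C) * nsq ψ) := by
  have hC : (0 : ℝ) < Fintype.card C := by exact_mod_cast Fintype.card_pos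
  have hA : ∀ k j γ κ (ψ : W × Bool × D × C → ℂ),
      0 ≤ (Fintype.card C ^ k * (v j γ κ + 1 / Fintype.card C) * nsq ψ : ℝ) :=
    fun k j γ κ ψ => mul_nonneg (mul_nonneg (by positivity)
      (add_nonneg (hv _ _ _) (by positivity))) (nsq_nonneg _)
  induction Ms generalizing k j γ κ ψ with
  | nil =>
    simp only [run, List.foldl_nil, List.length_nil, Nat.cast_zero, mul_zero, zero_add, one_pow,
      one_mul]
    rw [Finset.sum_filter, Fintype.sum_prod_type, Finset.sum_comm, nsq, Finset.mul_sum]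
    refine Finset.sum_le_sum fun b _ => ?_
    rw [← Finset.sum_filter]
    dsimp only
    rw [Finset.sum_const, nsmul_eq_mul]
    refine mul_le_mul_of_nonneg_right ((card_mul_le_of_value pt ok v hv hpt hstep hend b k j hk
      γ κ).trans (mul_le_mul_of_nonneg_left ?_ (by positivity))) (by positivity)
    linarith [show (0 : ℝ) ≤ 1 / Fintype.card C by positivity]
  | cons M Ms ih =>
    have hM := hMs M List.mem_cons_self
    have hMs' : ∀ M ∈ Ms, Contraction M := fun M hM => hMs M (List.mem_cons_of_mem _ hM)
    have ih' := ih hMs'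
    have hs := Real.sq_sqrt (hA k j γ κ ψ)
    have hcard := card_compl_below hk
    have := sum_sq_run_cons_le
      {p : (Fin n → C) × (W × Bool × D × C) |
        (∀ i ∈ below n j, p.1 i = κ i ∧ pt p.2 p.1 i = γ i) ∧ ok p.2 p.1}
      idx H (below n j) (fun p => pt p.2 p.1) Prod.fst Prod.snd γ κ (fun p => hidx p.2 p.1)
      (fun p hp i hi => ((Finset.mem_filter.1 hp).2.1 i hi).symm) hM Ms ψ
      (x := 2 * Ms.length + 1) (A := Real.sqrt _) (by positivity) (Real.sqrt_nonneg
        (Fintype.card C ^ k * (v j γ κ + 1 / Fintype.card C) * nsq ψ)) ?_ ?_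
    · rw [mul_pow, hs, hcard] at this
      refine this.trans_eq ?_
      push_cast [List.length_cons]
      ring
    · rw [mul_pow, hs, hcard]
      refine (ih' k j hk γ κ _).trans (mul_le_mul_of_nonneg_left (mul_le_mul_of_nonneg_left
        ((hM _).trans (nsq_oracleQuery _ ψ).le) ?_) (by positivity))
      exact mul_nonneg (by positivity) (add_nonneg (hv _ _ _) (by positivity))
    · intro i hi φ hφ
      rw [mul_pow, hs, hcard]
      have hji : j ≤ i := not_lt.1 fun h => hi (mem_below.2 h)
      obtain ⟨k, rfl⟩ : ∃ k', k = k' + 1 := ⟨k - 1, by have := i.2; omega⟩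
      rw [Nat.add_sub_cancel]
      -- Either the extracted point is the next one in the game, and `hstep` averages the value over
      -- its challenge, or it comes too early.
      obtain hji | hji := hji.eq_or_lt
      · subst hji
        rw [← Finset.sum_fiberwise _ (fun p => (pt p.2 p.1 i, p.1 i)), Fintype.sum_prod_type]
        calc _ ≤ ∑ d, ∑ c', ((2 * Ms.length + 1 : ℝ) ^ k) ^ 2 * (Fintype.card C ^ k *
              (v (i + 1) (Function.update γ i d) (Function.update κ i c') +
                1 / Fintype.card C) * nsq (φ d c')) := by
              refine Finset.sum_le_sum fun d _ => Finset.sum_le_sum fun c' _ => ?_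
              refine le_of_eq_of_le ?_ (ih' k (i + 1) (by omega) (Function.update γ i d)
                (Function.update κ i c') (φ d c'))
              rw [Finset.filter_filter]
              refine Finset.sum_congr ?_ ?_
              · ext p
                simp only [Finset.mem_filter, Finset.mem_univ, true_and, below_succ,
                  Finset.mem_insert, forall_eq_or_imp, Function.update_self, Prod.mk.injEq]
                have : (∀ a ∈ below n i, p.1 a = Function.update κ i c' a ∧
                    pt p.2 p.1 a = Function.update γ i d a) ↔
                    ∀ a ∈ below n i, p.1 a = κ a ∧ pt p.2 p.1 a = γ a := by
                  refine forall₂_congr fun a ha => ?_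
                  have hne : a ≠ i := by rintro rfl; exact hi ha
                  rw [Function.update_of_ne hne, Function.update_of_ne hne]
                rw [this]
                tauto
              · intro p hp
                have := (Finset.mem_filter.1 hp).2.1 i (by simp [below_succ])
                rw [Function.update_self, Function.update_self] at this
                rw [this.1, this.2]
          _ ≤ ∑ d, ∑ c', ((2 * Ms.length + 1 : ℝ) ^ k) ^ 2 * (Fintype.card C ^ k *
              (v (i + 1) (Function.update γ i d) (Function.update κ i c') +
                1 / Fintype.card C) * nsq (atPoint d ψ)) := by
              refine Finset.sum_le_sum fun d _ => Finset.sum_le_sum fun c' _ => ?_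
              exact mul_le_mul_of_nonneg_left (mul_le_mul_of_nonneg_left (hφ d c')
                (mul_nonneg (by positivity) (add_nonneg (hv _ _ _) (by positivity))))
                (by positivity)
          _ ≤ ∑ d, ((2 * Ms.length + 1 : ℝ) ^ k) ^ 2 * (Fintype.card C ^ (k + 1) *
              (v i γ κ + 1 / Fintype.card C) * nsq (atPoint d ψ)) := by
              refine Finset.sum_le_sum fun d _ => ?_
              rw [← Finset.mul_sum, ← Finset.sum_mul, ← Finset.mul_sum,
                pow_succ (Fintype.card C : ℝ) k, mul_assoc _ (Fintype.card C : ℝ)]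
              refine mul_le_mul_of_nonneg_left (mul_le_mul_of_nonneg_right
                (mul_le_mul_of_nonneg_left ?_ (by positivity)) (nsq_nonneg _)) (by positivity)
              rw [Finset.sum_add_distrib, mul_add]
              refine add_le_add (hstep i γ κ d) (le_of_eq ?_)
              simp
          _ = _ := by rw [← Finset.mul_sum, ← Finset.mul_sum, sum_nsq_atPoint]
      -- Extraction out of order: the point with index `i` contains the challenge with index `i - 1
      -- ≥ j`, which is still uniform and independent of the extracted point.
      · let i' : Fin n := ⟨i - 1, by omega⟩
        have hi' : i'.val + 1 = i := by simp only [i']; omega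
        have hne : i' ∉ below n j := fun h => by have := mem_below.1 h; omega
        have hcount : ∀ e : C, (Finset.univ.filter fun c : Fin n → C =>
            (∀ a ∈ below n j, c a = κ a) ∧ c i' = e).card = Fintype.card C ^ k := by
          intro e
          have h1 := card_filter_eq_on (insert i' (below n j)) (Function.update κ i' e)
          rw [Finset.card_compl, Finset.card_insert_of_notMem hne, ← Nat.sub_sub,
            ← Finset.card_compl, hcard, Nat.add_sub_cancel] at h1
          rw [← h1]
          congr 1
          ext c
          simp only [Finset.mem_filter, Finset.mem_univ, true_and, Finset.mem_insert,
            forall_eq_or_imp, Function.update_self]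
          rw [and_comm]
          refine and_congr_right fun _ => forall₂_congr fun a ha => ?_
          rw [Function.update_of_ne (by rintro rfl; exact hne ha)]
        have hfix : ∀ c : Fin n → C, ∑ b with
            (∀ a ∈ below n j, c a = κ a ∧ pt b c a = γ a) ∧ ok b c,
            ‖run (reprog idx H Finset.univ (pt b c) c) Ms (φ (pt b c i) (c i)) b‖ ^ 2 ≤
            if ∀ a ∈ below n j, c a = κ a then
              ∑ d with c i' = prev d, ((2 * Ms.length + 1 : ℝ) ^ k) ^ 2 * nsq (atPoint d ψ)
            else 0 := by
          intro c
          split_ifs with hc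
          · rw [← Finset.sum_fiberwise _ (fun b => pt b c i), Finset.sum_filter]
            refine Finset.sum_le_sum fun d _ => ?_
            split_ifs with hd
            · have h2 := sum_sq_run_reprog_le idx H (fun b => pt b c) (fun b => hidx b c) c Ms hMs'
                (insert i (below n j)) (Function.update γ i d) (φ d (c i))
              rw [Finset.card_compl, Finset.card_insert_of_notMem hi, ← Nat.sub_sub,
                ← Finset.card_compl, hcard, Nat.add_sub_cancel] at h2
              refine le_trans ?_ (h2.trans (mul_le_mul_of_nonneg_left (hφ d (c i))
                (by positivity)))
              rw [Finset.filter_filter]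
              refine le_of_eq_of_le (Finset.sum_congr rfl
                (g := fun b => ‖run (reprog idx H Finset.univ (pt b c) c) Ms (φ d (c i)) b‖ ^ 2)
                fun b hb => ?_) (Finset.sum_le_sum_of_subset_of_nonneg ?_
                fun _ _ _ => by positivity)
              · rw [(Finset.mem_filter.1 hb).2.2]
              · intro b hb
                simp only [Finset.mem_filter, Finset.mem_univ, true_and, Finset.mem_insert,
                  forall_eq_or_imp, Function.update_self] at hb ⊢
                refine ⟨hb.2, fun a ha => ?_⟩
                rw [Function.update_of_ne (by rintro rfl; exact hi ha)]
                exact (hb.1.1 a ha).2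
            · rw [Finset.filter_filter, Finset.filter_false_of_mem, Finset.sum_empty]
              rintro b - ⟨-, rfl⟩
              exact hd (hprev b c i i' hi').symm
          · rw [Finset.filter_false_of_mem, Finset.sum_empty]
            rintro b - ⟨h1, -⟩
            exact hc fun a ha => (h1 a ha).1
        rw [Finset.sum_filter, Fintype.sum_prod_type]
        simp only [← Finset.sum_filter]
        refine (Finset.sum_le_sum fun c _ => hfix c).trans ?_
        rw [← Finset.sum_filter]
        -- For each point `d`, only `|C|^k` of the `|C|^(k+1)` admissible challenge tuples agree
        -- with the challenge contained in `d`. This is the source of the error `1 / |C|`.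
        rw [Finset.sum_congr rfl fun c _ => Finset.sum_filter _ _, Finset.sum_comm]
        simp only [← Finset.sum_filter, Finset.filter_filter, Finset.sum_const, hcount,
          nsmul_eq_mul]
        rw [← Finset.mul_sum, ← Finset.mul_sum, sum_nsq_atPoint, mul_left_comm]
        refine mul_le_mul_of_nonneg_left ?_ (by positivity)
        refine mul_le_mul_of_nonneg_right ?_ (nsq_nonneg ψ)
        rw [pow_succ, mul_assoc, mul_add, mul_one_div_cancel hC.ne']
        push_cast
        refine le_mul_of_one_le_right (by positivity) ?_
        linarith [mul_nonneg hC.le (hv j γ κ)]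

end Extraction

/-! ### The value of the interactive game and the soundness error -/

section Game

variable {A C Z : Type} [Fintype A] [Fintype C] [Fintype Z]

open scoped Classical in
/-- The value of the interactive game with uniform challenges, with `k` rounds to go after the
history `h`, when the player wins at the end if the whole history satisfies `acc`. -/
def gameValue (acc : List (A × C) → Prop) : ℕ → List (A × C) → ℝ
  | 0, h => if acc h then 1 else 0
  | k + 1, h => ⨆ a, (∑ c, gameValue acc k ((a, c) :: h)) / Fintype.card C

lemma gameValue_nonneg (acc : List (A × C) → Prop) (k : ℕ) (h : List (A × C)) :
    0 ≤ gameValue acc k h := by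
  induction k generalizing h with
  | zero => unfold gameValue; split_ifs <;> simp
  | succ k ih =>
    exact Real.iSup_nonneg fun a => div_nonneg (Finset.sum_nonneg fun c _ => ih _) (by positivity)

lemma gameValue_le_one (acc : List (A × C) → Prop) (k : ℕ) (h : List (A × C)) :
    gameValue acc k h ≤ 1 := by
  induction k generalizing h with
  | zero => unfold gameValue; split_ifs <;> simp
  | succ k ih =>
    refine Real.iSup_le (fun a => div_le_one_of_le₀ ?_ (by positivity)) zero_le_one
    refine (Finset.sum_le_sum fun c _ => ih _).trans ?_
    simp

lemma sum_gameValue_le [Nonempty C] (acc : List (A × C) → Prop) (k : ℕ) (h : List (A × C))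
    (a : A) : ∑ c, gameValue acc k ((a, c) :: h) ≤ Fintype.card C * gameValue acc (k + 1) h := by
  have hC : (0 : ℝ) < Fintype.card C := by exact_mod_cast Fintype.card_pos
  rw [mul_comm, ← div_le_iff₀ hC]
  exact le_ciSup (f := fun a => (∑ c, gameValue acc k ((a, c) :: h)) / Fintype.card C)
    (Set.finite_range _).bddAbove a

/-- The transcripts with last message `z` that satisfy `V`, as histories. -/
def histAccepts {n : ℕ} (V : (Fin n → A × C) → Z → Prop) (h : List (A × C)) (z : Z) : Prop :=
  ∃ t, (List.ofFn t).reverse = h ∧ V t z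

lemma histAccepts_ofFn {n : ℕ} (V : (Fin n → A × C) → Z → Prop) (t : Fin n → A × C) (z : Z) :
    histAccepts V (List.ofFn t).reverse z ↔ V t z := by
  constructor
  · rintro ⟨t', h, hV⟩
    rwa [← List.ofFn_injective (List.reverse_injective h)]
  · exact fun h => ⟨t, rfl, h⟩

/-- The winning histories. -/
def winning {n : ℕ} (V : (Fin n → A × C) → Z → Prop) (h : List (A × C)) : Prop :=
  ∃ z, histAccepts V h z

namespace ProverStrategy

variable (B : ProverStrategy A C Z) {n : ℕ} (V : (Fin n → A × C) → Z → Prop)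

open scoped Classical in
/-- The acceptance probability after the history `h`, up to normalisation. -/
def weight (k : ℕ) (h : List (A × C)) : ℝ :=
  ∑ t : Fin k → A × C, ∑ z : Z,
    if histAccepts V ((List.ofFn t).reverse ++ h) z then
      nsq (B.last ((List.ofFn t).reverse ++ h) z *ᵥ B.state ((List.ofFn t).reverse ++ h)) else 0

lemma acceptProb_eq_weight :
    B.acceptProb V = (1 / (Fintype.card C : ℝ)) ^ n * B.weight V n [] := by
  unfold acceptProb weight
  rw [Finset.mul_sum]
  refine Finset.sum_congr rfl fun t _ => ?_
  rw [Finset.mul_sum]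
  refine Finset.sum_congr rfl fun z _ => ?_
  have : histAccepts V ((List.ofFn t).reverse ++ []) z ↔ V t z := by
    rw [List.append_nil, histAccepts_ofFn]
  by_cases hV : V t z
  · rw [if_pos hV, if_pos (this.2 hV), List.append_nil]
    rfl
  · rw [if_neg hV, if_neg (mt this.1 hV), mul_zero]

lemma weight_succ (k : ℕ) (h : List (A × C)) :
    B.weight V (k + 1) h = ∑ a, ∑ c, B.weight V k ((a, c) :: h) := by
  classical
  rw [← Fintype.sum_prod_type (f := fun p => B.weight V k (p :: h))]
  unfold weight
  rw [← Fintype.sum_prod_type (f := fun p : (A × C) × (Fin k → A × C) => ∑ z : Z,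
    if histAccepts V ((List.ofFn p.2).reverse ++ p.1 :: h) z then
      nsq (B.last ((List.ofFn p.2).reverse ++ p.1 :: h) z *ᵥ
        B.state ((List.ofFn p.2).reverse ++ p.1 :: h)) else 0)]
  refine (Fintype.sum_equiv (Fin.consEquiv fun _ => A × C) _ _ fun p => ?_).symm
  simp only [Fin.consEquiv, Equiv.coe_fn_mk, List.ofFn_cons, List.reverse_cons,
    List.append_assoc, List.singleton_append]

lemma weight_zero (h : List (A × C)) [∀ z, Decidable (histAccepts V h z)] :
    B.weight V 0 h = ∑ z, if histAccepts V h z then nsq (B.last h z *ᵥ B.state h) else 0 := by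
  unfold weight
  simp

/-- Quantum provers gain nothing: the squared norms of the branches of a measurement add up to that
of the state, so it acts as a random choice of the message, and no choice beats the supremum. -/
lemma weight_le [Nonempty C] (k : ℕ) (h : List (A × C)) :
    B.weight V k h ≤ Fintype.card C ^ k * gameValue (winning V) k h * nsq (B.state h) := by
  classical
  induction k generalizing h with
  | zero =>
    rw [weight_zero, pow_zero, one_mul]
    unfold gameValue
    split_ifs with hw
    · rw [one_mul, ← sum_nsq_mulVec (B.last_complete h) (B.state h)]
      refine Finset.sum_le_sum fun z _ => ?_
      split_ifs
      · exact le_rfl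
      · exact nsq_nonneg _
    · rw [zero_mul, Finset.sum_eq_zero]
      intro z _
      rw [if_neg fun hz => hw ⟨z, hz⟩]
  | succ k ih =>
    rw [weight_succ]
    calc _ ≤ ∑ a, ∑ c, Fintype.card C ^ k * gameValue (winning V) k ((a, c) :: h) *
          nsq (B.step h a *ᵥ B.state h) :=
          Finset.sum_le_sum fun a _ => Finset.sum_le_sum fun c _ => ih _
      _ ≤ ∑ a, Fintype.card C ^ (k + 1) * gameValue (winning V) (k + 1) h *
          nsq (B.step h a *ᵥ B.state h) := by
          refine Finset.sum_le_sum fun a _ => ?_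
          rw [← Finset.sum_mul, ← Finset.mul_sum, pow_succ (Fintype.card C : ℝ) k,
            mul_assoc ((Fintype.card C : ℝ) ^ k) (Fintype.card C : ℝ)]
          exact mul_le_mul_of_nonneg_right (mul_le_mul_of_nonneg_left
            (sum_gameValue_le _ k h a) (by positivity)) (nsq_nonneg _)
      _ = _ := by rw [← Finset.mul_sum, sum_nsq_mulVec (B.step_complete h)]

lemma acceptProb_le [Nonempty C] : B.acceptProb V ≤ gameValue (winning V) n [] := by
  have hC : (0 : ℝ) < Fintype.card C := by exact_mod_cast Fintype.card_pos
  have := B.weight_le V n []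
  rw [show nsq (B.state []) = 1 from B.init_norm, mul_one] at this
  rw [acceptProb_eq_weight, one_div, inv_pow, inv_mul_le_iff₀ (by positivity)]
  exact this

end ProverStrategy

open scoped Classical in
/-- The prover who sends the messages that `f` and `g` determine. -/
def deterministicProver (f : List (A × C) → A) (g : List (A × C) → Z) : ProverStrategy A C Z where
  W := Unit
  init := fun _ => 1
  init_norm := by simp
  step := fun h a => if a = f h then 1 else 0
  step_complete := fun h => by
    rw [Finset.sum_eq_single (f h)] <;> simp +contextual
  last := fun h z => if z = g h then 1 else 0
  last_complete := fun h => by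
    rw [Finset.sum_eq_single (g h)] <;> simp +contextual

lemma deterministicProver_last_mulVec (f : List (A × C) → A) (g : List (A × C) → Z)
    (h : List (A × C)) (ψ : (deterministicProver f g).W → ℂ) :
    (deterministicProver f g).last h (g h) *ᵥ ψ = ψ := by
  have : (deterministicProver f g).last h (g h) = 1 := if_pos rfl
  rw [this, Matrix.one_mulVec]

lemma deterministicProver_state_cons (f : List (A × C) → A) (g : List (A × C) → Z)
    (h : List (A × C)) (c : C) : (deterministicProver f g).state ((f h, c) :: h) =
      (deterministicProver f g).state h := by
  have : (deterministicProver f g).step h (f h) = 1 := if_pos rfl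
  rw [ProverStrategy.state, this, Matrix.one_mulVec]

/-- There are finitely many messages, so a deterministic prover can play a maximiser at every
history. -/
lemma exists_acceptProb_ge [Nonempty A] [Nonempty C] [Nonempty Z] {n : ℕ}
    (V : (Fin n → A × C) → Z → Prop) :
    ∃ B : ProverStrategy A C Z, gameValue (winning V) n [] ≤ B.acceptProb V := by
  classical
  have hC : (0 : ℝ) < Fintype.card C := by exact_mod_cast Fintype.card_pos
  -- After the next message and its challenge, `n - h.length - 1` rounds remain. Histories with `n`
  -- or more entries get some message that is never used.
  have hf : ∀ h : List (A × C), ∃ a,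
      gameValue (winning V) (n - h.length - 1 + 1) h =
      (∑ c, gameValue (winning V) (n - h.length - 1) ((a, c) :: h)) / Fintype.card C := fun h => by
    obtain ⟨a, ha⟩ := exists_eq_ciSup_of_finite (f := fun a =>
      (∑ c, gameValue (winning V) (n - h.length - 1) ((a, c) :: h)) / Fintype.card C)
    exact ⟨a, ha.symm⟩
  choose f hf using hf
  have hg : ∀ h : List (A × C), ∃ z, winning V h → histAccepts V h z := fun h => by
    by_cases hw : winning V h
    · exact ⟨hw.choose, fun _ => hw.choose_spec⟩
    · exact ⟨Classical.arbitrary Z, fun h => absurd h hw⟩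
  choose g hg using hg
  refine ⟨deterministicProver f g, ?_⟩
  have key : ∀ k h, k + h.length = n → Fintype.card C ^ k * gameValue (winning V) k h *
      nsq ((deterministicProver f g).state h) ≤ (deterministicProver f g).weight V k h := by
    intro k
    induction k with
    | zero =>
      intro h _
      rw [ProverStrategy.weight_zero, pow_zero, one_mul]
      unfold gameValue
      split_ifs with hw
      · refine le_trans ?_ (Finset.single_le_sum (fun z _ => ?_) (Finset.mem_univ (g h)))
        · rw [if_pos (hg h hw), one_mul, deterministicProver_last_mulVec]
        · split_ifs
          · exact nsq_nonneg _
          · exact le_rfl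
      · rw [zero_mul]
        refine Finset.sum_nonneg fun z _ => ?_
        split_ifs
        · exact nsq_nonneg _
        · exact le_rfl
    | succ k ih =>
      intro h hk
      rw [ProverStrategy.weight_succ]
      have hnn : ∀ a, 0 ≤ ∑ c, (deterministicProver f g).weight V k ((a, c) :: h) := fun a =>
        Finset.sum_nonneg fun c _ => le_trans (mul_nonneg (mul_nonneg (by positivity)
          (gameValue_nonneg _ _ _)) (nsq_nonneg _)) (ih ((a, c) :: h) (by simp; omega))
      refine le_trans ?_ (Finset.single_le_sum (fun a _ => hnn a) (Finset.mem_univ (f h)))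
      refine le_trans (le_of_eq ?_)
        (Finset.sum_le_sum fun c _ => ih ((f h, c) :: h) (by simp; omega))
      simp only [deterministicProver_state_cons]
      rw [← Finset.sum_mul, ← Finset.mul_sum]
      have h1 := hf h
      rw [show n - h.length - 1 = k by omega] at h1
      rw [h1, pow_succ]
      field_simp
  have := key n [] (by simp)
  rw [show nsq ((deterministicProver f g).state []) = 1 from
    (deterministicProver f g).init_norm, mul_one] at this
  rwa [ProverStrategy.acceptProb_eq_weight, one_div, inv_pow, le_inv_mul_iff₀ (by positivity)]

end Game

namespace PCIP

variable {n : ℕ} {X A C Z : Type} [Fintype A] [Fintype C] [Fintype Z] [Nonempty C]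
  (P : PCIP n X A C Z)

lemma bddAbove_acceptProb : BddAbove (Set.range fun p : {x : X // x ∉ P.lang} ×
    ProverStrategy A C Z => p.2.acceptProb (P.V p.1)) := by
  refine ⟨1, ?_⟩
  rintro _ ⟨p, rfl⟩
  exact (p.2.acceptProb_le _).trans (gameValue_le_one _ _ _)

lemma gameValue_le_soundnessError [Nonempty A] [Nonempty Z] {x : X} (hx : x ∉ P.lang) :
    gameValue (winning (P.V x)) n [] ≤ P.soundnessError := by
  obtain ⟨B, hB⟩ := exists_acceptProb_ge (P.V x)
  exact hB.trans (le_ciSup P.bddAbove_acceptProb (⟨x, hx⟩, B))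

/-- The real supremum of an empty family is 0, so some prover strategy exists; over an empty message
type its completeness relation would read `0 = 1`. -/
lemma nonempty_of_soundnessError_pos (h : 0 < P.soundnessError) : Nonempty A ∧ Nonempty Z := by
  have : Nonempty ({x : X // x ∉ P.lang} × ProverStrategy A C Z) := by
    by_contra hne
    rw [not_nonempty_iff] at hne
    rw [PCIP.soundnessError, Real.iSup_of_isEmpty] at h
    exact lt_irrefl _ h
  obtain ⟨-, B⟩ := this
  have hW : Nonempty B.W := by
    by_contra hne
    rw [not_nonempty_iff] at hne
    have := B.init_norm
    simp at this
  constructor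
  · by_contra hne
    rw [not_nonempty_iff] at hne
    have := B.step_complete []
    simp at this
  · by_contra hne
    rw [not_nonempty_iff] at hne
    have := B.last_complete []
    simp at this

end PCIP

/-! ### The upper bound for Fiat–Shamir -/

section FiatShamir

variable {n : ℕ} {X A C Z : Type}

/-- The `i`-th hash input for the output `(x, a)` and the challenges `c`. -/
def fsPoint (x : X) (a : Fin n → A) (c : Fin n → C) (i : Fin n) : FSDomain n X A C :=
  (i, if h : i.val = 0 then Sum.inl x else Sum.inr (c ⟨i.val - 1, by omega⟩), a i)

lemma fsChallenge_eq (H : FSDomain n X A C → C) (x : X) (a : Fin n → A) (i : Fin n) :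
    fsChallenge H x a i i.2 = H (fsPoint x a (fun i => fsChallenge H x a i i.2) i) := by
  obtain ⟨i, hi⟩ := i
  cases i with
  | zero => simp [fsChallenge, fsPoint]
  | succ i => simp [fsChallenge, fsPoint]

lemma fsPoint_congr {x : X} {a : Fin n → A} {c c' : Fin n → C} {i : Fin n}
    (h : ∀ i', i' < i → c i' = c' i') : fsPoint x a c i = fsPoint x a c' i := by
  unfold fsPoint
  split_ifs with h0
  · rfl
  · rw [h]
    exact Fin.lt_def.2 (by simp only; omega)

/-- Each hash input involves earlier challenges only, so consistency determines the challenges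
recursively. -/
lemma fsChallenge_unique {H : FSDomain n X A C → C} {x : X} {a : Fin n → A} {c : Fin n → C}
    (h : ∀ i, H (fsPoint x a c i) = c i) : (fun i : Fin n => fsChallenge H x a i i.2) = c := by
  have : ∀ (k : ℕ) (hk : k < n), fsChallenge H x a k hk = c ⟨k, hk⟩ := by
    intro k
    induction k using Nat.strong_induction_on with
    | _ k ih =>
      intro hk
      rw [fsChallenge_eq H x a ⟨k, hk⟩, ← h ⟨k, hk⟩]
      congr 1
      exact fsPoint_congr fun i' hi' => ih i' hi' i'.2
  exact funext fun i => this i i.2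

variable [DecidableEq (FSDomain n X A C)] [DecidableEq C] [Fintype X] [Fintype A] [Fintype C]

lemma reprog_fsPoint (H : FSDomain n X A C → C) (x : X) (a : Fin n → A) (γ c : Fin n → C)
    (i : Fin n) : reprog Prod.fst H Finset.univ (fsPoint x a γ) c (fsPoint x a γ i) = c i :=
  if_pos ⟨Finset.mem_univ _, rfl⟩

lemma fsChallenge_reprog (H : FSDomain n X A C → C) (x : X) (a : Fin n → A) (c : Fin n → C) :
    (fun i : Fin n => fsChallenge (reprog Prod.fst H Finset.univ (fsPoint x a c) c) x a i i.2) =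
      c := fsChallenge_unique fun i => reprog_fsPoint H x a c c i

lemma reprog_reprog {D : Type} [DecidableEq D] (idx : D → Fin n) (H : D → C) {γ : Fin n → D}
    (c c' : Fin n → C) (h : ∀ i, H (γ i) = c' i) :
    reprog idx (reprog idx H Finset.univ γ c) Finset.univ γ c' = H := by
  funext d
  unfold reprog
  by_cases hd : γ (idx d) = d
  · simp only [Finset.mem_univ, true_and, hd, if_true]
    rw [← h, hd]
  · simp [hd]

/-- A uniform oracle together with the Fiat-Shamir challenges is distributed as a uniform oracle,
reprogrammed to uniform challenges. -/
lemma sum_fsChallenge (x : X) (a : Fin n → A) (F : (FSDomain n X A C → C) → (Fin n → C) → ℝ) :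
    ∑ H, ∑ c, F (reprog Prod.fst H Finset.univ (fsPoint x a c) c) c =
      (Fintype.card C : ℝ) ^ n * ∑ H, F H fun i => fsChallenge H x a i i.2 := by
  -- The new challenges are exchanged with the old oracle values at the same points. This is
  -- injective: `c` is recovered as the Fiat–Shamir challenges of the new oracle, and then the old
  -- values restore `H`.
  let e : (FSDomain n X A C → C) × (Fin n → C) → (FSDomain n X A C → C) × (Fin n → C) := fun p =>
    (reprog Prod.fst p.1 Finset.univ (fsPoint x a p.2) p.2, fun i => p.1 (fsPoint x a p.2 i))
  have he : Function.Bijective e := by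
    rw [← Finite.injective_iff_bijective]
    rintro ⟨H, c⟩ ⟨H', c'⟩ h
    have h1 := congrArg Prod.fst h
    have h2 := congrArg Prod.snd h
    dsimp only [e] at h1 h2
    obtain rfl : c = c' := by rw [← fsChallenge_reprog H x a c, h1, fsChallenge_reprog]
    rw [← reprog_reprog Prod.fst H c (fun i => H (fsPoint x a c i)) (fun _ => rfl), h1, h2,
      reprog_reprog _ _ _ _ fun _ => rfl]
  rw [← Fintype.sum_prod_type (f := fun p : (FSDomain n X A C → C) × (Fin n → C) =>
    F (reprog Prod.fst p.1 Finset.univ (fsPoint x a p.2) p.2) p.2)]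
  calc _ = ∑ p : (FSDomain n X A C → C) × (Fin n → C),
        F p.1 fun i => fsChallenge p.1 x a i i.2 := by
        rw [← he.sum_comp fun p => F p.1 fun i => fsChallenge p.1 x a i i.2]
        refine Finset.sum_congr rfl fun p _ => ?_
        simp only [e, fsChallenge_reprog]
    _ = _ := by
        rw [Fintype.sum_prod_type, Finset.mul_sum]
        refine Finset.sum_congr rfl fun H _ => ?_
        simp

/-- The history of the messages in the first `j` points and the first `j` challenges. -/
def fsHist (j : ℕ) (γ : Fin n → FSDomain n X A C) (κ : Fin n → C) : List (A × C) :=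
  ((List.ofFn fun i => ((γ i).2.2, κ i)).take j).reverse

lemma fsHist_succ (j : Fin n) (γ : Fin n → FSDomain n X A C) (κ : Fin n → C)
    (d : FSDomain n X A C) (c : C) :
    fsHist (j + 1) (Function.update γ j d) (Function.update κ j c) =
      (d.2.2, c) :: fsHist j γ κ := by
  unfold fsHist
  rw [← List.take_concat_get' _ _ (by simp), List.reverse_append, List.reverse_singleton,
    List.singleton_append]
  congr 1
  · simp
  · congr 1
    refine List.ext_getElem (by simp) fun i h1 h2 => ?_
    have hi : i < j := by simp at h1; omega
    have hne : (⟨i, hi.trans j.2⟩ : Fin n) ≠ j := fun h => by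
      rw [Fin.ext_iff] at h; exact hi.ne h
    simp [Function.update_of_ne hne]

/-- The extraction bound for a game in which the choice of the instance belongs to the first move;
this handles adaptively chosen instances. -/
lemma sum_le_sum_fsValue [AddCommGroup C] [Fintype Z] [Nonempty A] [Nonempty Z] {W : Type}
    [Fintype W] (hn : 0 < n) (P : PCIP n X A C Z)
    (out : W × Bool × FSDomain n X A C × C → X × (Fin n → A) × Z)
    (H : FSDomain n X A C → C)
    [∀ (b : W × Bool × FSDomain n X A C × C) (c : Fin n → C), Decidable ((out b).1 ∉ P.lang ∧
      P.V (out b).1 (fun i => ((out b).2.1 i, c i)) (out b).2.2)]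
    (Ms : List (Matrix (W × Bool × FSDomain n X A C × C) (W × Bool × FSDomain n X A C × C) ℂ))
    (hMs : ∀ M ∈ Ms, Contraction M) (ψ : W × Bool × FSDomain n X A C × C → ℂ)
    (hε : 0 ≤ P.soundnessError) :
    ∑ b, ∑ c : Fin n → C, (if (out b).1 ∉ P.lang ∧
        P.V (out b).1 (fun i => ((out b).2.1 i, c i)) (out b).2.2 then
      ‖run (reprog Prod.fst H Finset.univ (fsPoint (out b).1 (out b).2.1 c) c) Ms ψ b‖ ^ 2
      else 0) ≤
      ((2 * Ms.length + 1 : ℝ) ^ n) ^ 2 *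
        (Fintype.card C ^ n * (P.soundnessError + 1 / Fintype.card C) * nsq ψ) := by
  classical
  -- Before the first move the soundness error bounds the value for every wrong instance; afterwards
  -- the instance is read off the first point, and malformed first points are worth nothing.
  let v : ℕ → (Fin n → FSDomain n X A C) → (Fin n → C) → ℝ := fun j γ κ =>
    if j = 0 then P.soundnessError else
      match (γ ⟨0, hn⟩).2.1 with
      | Sum.inl x => if x ∉ P.lang then
          gameValue (winning (P.V x)) (n - j) (fsHist j γ κ) else 0
      | Sum.inr _ => 0
  have hv : ∀ j γ κ, 0 ≤ v j γ κ := by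
    intro j γ κ
    simp only [v]
    by_cases hj : j = 0
    · rwa [if_pos hj]
    · rw [if_neg hj]
      rcases (γ ⟨0, hn⟩).2.1 with x | c
      · dsimp only
        split_ifs
        · exact le_rfl
        · exact gameValue_nonneg _ _ _
      · exact le_rfl
  have hstep : ∀ (j : Fin n) γ κ d, ∑ c', v (j + 1) (Function.update γ j d)
      (Function.update κ j c') ≤ Fintype.card C * v j γ κ := by
    intro j γ κ d
    simp only [v, Nat.add_eq_zero_iff, one_ne_zero, and_false, if_false, fsHist_succ]
    by_cases hj : j.val = 0
    · obtain rfl : j = ⟨0, hn⟩ := Fin.ext hj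
      rw [if_pos hj, Function.update_self]
      obtain ⟨i, x | c, a⟩ := d
      · dsimp only
        by_cases hx : x ∉ P.lang
        · simp only [if_pos hx]
          have h0 : fsHist 0 γ κ = [] := by simp [fsHist]
          rw [h0]
          refine (sum_gameValue_le _ _ _ _).trans (mul_le_mul_of_nonneg_left ?_ (by positivity))
          refine le_trans (le_of_eq ?_) (P.gameValue_le_soundnessError hx)
          congr 1
          omega
        · simp only [if_neg hx, Finset.sum_const_zero]
          positivity
      · simp only [Finset.sum_const_zero]
        positivity
    · have hne : (⟨0, hn⟩ : Fin n) ≠ j := fun h => hj (by rw [← h])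
      rw [if_neg hj, Function.update_of_ne hne]
      obtain ⟨i, x | c, a⟩ := γ ⟨0, hn⟩
      · dsimp only
        by_cases hx : x ∉ P.lang
        · simp only [if_pos hx]
          refine (sum_gameValue_le _ _ _ _).trans (le_of_eq ?_)
          congr 2
          omega
        · simp [if_neg hx]
      · simp
  have hend : ∀ (b : W × Bool × FSDomain n X A C × C) κ, ((out b).1 ∉ P.lang ∧
      P.V (out b).1 (fun i => ((out b).2.1 i, κ i)) (out b).2.2) →
      1 ≤ v n (fsPoint (out b).1 (out b).2.1 κ) κ := by
    intro b κ hok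
    have h0 : (fsPoint (out b).1 (out b).2.1 κ ⟨0, hn⟩).2.1 = Sum.inl (out b).1 := by
      simp [fsPoint]
    simp only [v]
    rw [if_neg hn.ne', h0]
    dsimp only
    rw [if_pos hok.1, Nat.sub_self]
    unfold gameValue
    rw [if_pos]
    refine ⟨(out b).2.2, _, ?_, hok.2⟩
    simp [fsHist, fsPoint]
  -- The default challenge 0 for points that contain an instance is never used, since `hprev`
  -- concerns indices from 1 on. Nothing has been extracted at the start, so the initial points and
  -- challenges are arbitrary.
  have := sum_sq_run_reprog_le_value Prod.fst
    (fun d : FSDomain n X A C => Sum.elim (fun _ => (0 : C)) id d.2.1) H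
    (fun b c => fsPoint (out b).1 (out b).2.1 c) (fun _ _ _ => rfl) ?_
    (fun _ _ _ _ h => fsPoint_congr h)
    (fun b c => (out b).1 ∉ P.lang ∧ P.V (out b).1 (fun i => ((out b).2.1 i, c i)) (out b).2.2)
    v hv hstep hend Ms hMs n 0 (zero_add n)
    (fun i => (i, Sum.inr 0, Classical.arbitrary A)) (fun _ => 0) ψ
  · rw [Finset.sum_filter, Fintype.sum_prod_type, Finset.sum_comm] at this
    have h0 : ∀ i, i ∉ below n 0 := fun i hi => by simpa using mem_below.1 hi
    simpa [h0, v] using this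
  · intro b c i i' h
    have : i.val ≠ 0 := by omega
    simp only [fsPoint, this, dif_neg, not_false_eq_true, Sum.elim_inr, id]
    congr 1
    ext
    simp only
    omega

/-- The factor `9 ^ n` comes from `2q + 1 ≤ 3q`, the factor 2 from replacing the guessing error `1 /
|C|` by the soundness error. -/
theorem fsSoundnessError_le {X A C Z : Type} [Fintype X] [Fintype A] [Fintype C] [Fintype Z]
    [AddCommGroup C] (P : PCIP n X A C Z) (hn : 1 ≤ n)
    (h : 1 ≤ (Fintype.card C : ℝ) * P.soundnessError) {q : ℕ} (hq : 1 ≤ q) :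
    P.fsSoundnessError q ≤ 2 * 9 ^ n * (q : ℝ) ^ (2 * n) * P.soundnessError := by
  classical
  have hC : (0 : ℝ) < Fintype.card C := by exact_mod_cast Fintype.card_pos
  have hε : 0 < P.soundnessError := by
    by_contra hneg
    nlinarith
  obtain ⟨_, _⟩ := P.nonempty_of_soundnessError_pos hε
  have hδ : 1 / (Fintype.card C : ℝ) ≤ P.soundnessError := by
    rwa [div_le_iff₀ hC, mul_comm]
  refine Real.iSup_le (fun B => ?_) (by positivity)
  unfold OracleAlgorithm.successProb
  rw [div_le_iff₀ (by exact_mod_cast Fintype.card_pos), Finset.sum_comm,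
    ← mul_le_mul_iff_right₀ (show (0 : ℝ) < Fintype.card C ^ n by positivity), Finset.mul_sum]
  have hb : ∀ b, (Fintype.card C : ℝ) ^ n * ∑ H : FSDomain n X A C → C,
      (if (B.out b).1 ∉ P.lang ∧ P.fsAccepts H (B.out b).1 (B.out b).2.1 (B.out b).2.2 then
        ‖B.finalState H b‖ ^ 2 else 0) = ∑ H, ∑ c : Fin n → C, (if (B.out b).1 ∉ P.lang ∧
        P.V (B.out b).1 (fun i => ((B.out b).2.1 i, c i)) (B.out b).2.2 then
      ‖run (reprog Prod.fst H Finset.univ (fsPoint (B.out b).1 (B.out b).2.1 c) c)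
        (List.ofFn B.step) B.init b‖ ^ 2 else 0) := fun b =>
    (sum_fsChallenge (B.out b).1 (B.out b).2.1 fun H c => if (B.out b).1 ∉ P.lang ∧
        P.V (B.out b).1 (fun i => ((B.out b).2.1 i, c i)) (B.out b).2.2 then
      ‖run H (List.ofFn B.step) B.init b‖ ^ 2 else 0).symm
  refine le_of_eq_of_le (Finset.sum_congr rfl fun b _ => Eq.trans ?_ (hb b)) ?_
  · congr!
  rw [Finset.sum_comm]
  calc _ ≤ ∑ _H : FSDomain n X A C → C, ((2 * q + 1 : ℝ) ^ n) ^ 2 *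
        (Fintype.card C ^ n * (P.soundnessError + 1 / Fintype.card C)) := by
        refine Finset.sum_le_sum fun H _ => ?_
        have := sum_le_sum_fsValue hn P B.out H (List.ofFn B.step) B.contraction_step B.init hε.le
        rwa [List.length_ofFn, show nsq B.init = 1 from B.init_norm, mul_one] at this
    _ ≤ ∑ _H : FSDomain n X A C → C, Fintype.card C ^ n *
        (2 * 9 ^ n * (q : ℝ) ^ (2 * n) * P.soundnessError) := by
        refine Finset.sum_le_sum fun H _ => ?_
        have hq' : (1 : ℝ) ≤ q := by exact_mod_cast hq
        have h1 : ((2 * q + 1 : ℝ) ^ n) ^ 2 ≤ 9 ^ n * (q : ℝ) ^ (2 * n) := by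
          rw [← pow_mul, mul_comm n 2, pow_mul, pow_mul, ← mul_pow]
          exact pow_le_pow_left₀ (by positivity) (by nlinarith) n
        calc _ ≤ (9 ^ n * (q : ℝ) ^ (2 * n)) *
              (Fintype.card C ^ n * (P.soundnessError + P.soundnessError)) := by gcongr
          _ = _ := by ring
    _ = _ := by
        rw [Finset.sum_const, Finset.card_univ, nsmul_eq_mul]
        ring

end FiatShamir

/-! ### Unitary dilations and enlarged work registers -/

section Dilation

variable {ι κ : Type*} [Fintype ι] [Fintype κ] [DecidableEq ι] [DecidableEq κ]

/-- The unitary on the direct sum that extends the partial isometry `S`. -/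
def dilation (S : Matrix κ ι ℂ) : Matrix (ι ⊕ κ) (ι ⊕ κ) ℂ :=
  Matrix.fromBlocks (1 - Sᴴ * S) Sᴴ S (1 - S * Sᴴ)

/-- The matrix is self-adjoint, and it squares to 1 because `Sᴴ * S` and `S * Sᴴ` are projections.
-/
lemma dilation_mem_unitaryGroup {S : Matrix κ ι ℂ} (hS : S * Sᴴ * S = S) :
    dilation S ∈ Matrix.unitaryGroup (ι ⊕ κ) ℂ := by
  have hS' : Sᴴ * S * Sᴴ = Sᴴ := by
    simpa [Matrix.conjTranspose_mul, Matrix.mul_assoc] using congrArg Matrix.conjTranspose hS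
  have hsa : (dilation S)ᴴ = dilation S := by
    simp [dilation, Matrix.fromBlocks_conjTranspose]
  rw [Matrix.mem_unitaryGroup_iff, Matrix.star_eq_conjTranspose, hsa]
  unfold dilation
  rw [Matrix.fromBlocks_multiply, ← Matrix.fromBlocks_one]
  have h1 : Sᴴ * S * (Sᴴ * S) = Sᴴ * S := by rw [← Matrix.mul_assoc, hS']
  have h2 : S * Sᴴ * (S * Sᴴ) = S * Sᴴ := by rw [← Matrix.mul_assoc, hS]
  congr 1
  · simp [Matrix.sub_mul, Matrix.mul_sub, h1]
  · simp [Matrix.sub_mul, Matrix.mul_sub, ← Matrix.mul_assoc, hS']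
  · simp [Matrix.sub_mul, Matrix.mul_sub, ← Matrix.mul_assoc, hS]
  · simp [Matrix.sub_mul, Matrix.mul_sub, h2]

end Dilation

section Embedding

variable {W W' E : Type} [Fintype W] [Fintype W'] [Fintype E] [DecidableEq W] [DecidableEq W']
  [DecidableEq E]

/-- The isometry that is induced by a map of the work registers. -/
def embMatrix (E : Type) [DecidableEq E] (j : W → W') : Matrix (W' × E) (W × E) ℂ :=
  fun p p' => if p = (j p'.1, p'.2) then 1 else 0

lemma embMatrix_mulVec_apply {j : W → W'} (hj : Function.Injective j) (ψ : W × E → ℂ) (w : W)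
    (e : E) : (embMatrix E j *ᵥ ψ) (j w, e) = ψ (w, e) := by
  rw [Matrix.mulVec, dotProduct, Finset.sum_eq_single (w, e)]
  · simp [embMatrix]
  · rintro ⟨w', e'⟩ - hne
    rw [embMatrix, if_neg, zero_mul]
    intro h
    rw [Prod.mk.injEq] at h
    exact hne (by rw [hj h.1, h.2])
  · simp

lemma embMatrix_mulVec_apply_of_notMem {j : W → W'} (ψ : W × E → ℂ) {w' : W'}
    (hw : w' ∉ Set.range j) (e : E) : (embMatrix E j *ᵥ ψ) (w', e) = 0 := by
  rw [Matrix.mulVec, dotProduct, Finset.sum_eq_zero]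
  rintro ⟨w, e'⟩ -
  rw [embMatrix, if_neg, zero_mul]
  intro h
  rw [Prod.mk.injEq] at h
  exact hw ⟨w, h.1.symm⟩

lemma embMatrix_isometry {j : W → W'} (hj : Function.Injective j) :
    (embMatrix E j)ᴴ * embMatrix E j = 1 := by
  ext p p'
  rw [Matrix.mul_apply, Finset.sum_eq_single (j p'.1, p'.2)]
  · rw [Matrix.conjTranspose_apply, Matrix.one_apply]
    unfold embMatrix
    rw [if_pos rfl, mul_one]
    by_cases h : p = p'
    · simp [h]
    · rw [if_neg h, if_neg, star_zero]
      intro h'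
      rw [Prod.mk.injEq] at h'
      exact h (Prod.ext (hj h'.1).symm h'.2.symm)
  · intro b _ hb
    unfold embMatrix
    rw [if_neg hb, mul_zero]
  · simp

/-- Extension of a matrix by the identity to a larger work register. -/
def extendMatrix (W' : Type) [DecidableEq W'] (M : Matrix (W × E) (W × E) ℂ) :
    Matrix ((W ⊕ W') × E) ((W ⊕ W') × E) ℂ :=
  (Matrix.fromBlocks M 0 0 (1 : Matrix (W' × E) (W' × E) ℂ)).submatrix
    (Equiv.sumProdDistrib W W' E) (Equiv.sumProdDistrib W W' E)

lemma extendMatrix_mul (M N : Matrix (W × E) (W × E) ℂ) :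
    extendMatrix W' (M * N) = extendMatrix W' M * extendMatrix W' N := by
  unfold extendMatrix
  rw [Matrix.submatrix_mul_equiv, Matrix.fromBlocks_multiply]
  simp

lemma extendMatrix_one : extendMatrix W' (1 : Matrix (W × E) (W × E) ℂ) = 1 := by
  unfold extendMatrix
  rw [Matrix.fromBlocks_one, Matrix.submatrix_one_equiv]

lemma extendMatrix_conjTranspose (M : Matrix (W × E) (W × E) ℂ) :
    (extendMatrix W' M)ᴴ = extendMatrix W' Mᴴ := by
  unfold extendMatrix
  rw [Matrix.conjTranspose_submatrix, Matrix.fromBlocks_conjTranspose]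
  simp

lemma extendMatrix_mulVec (M : Matrix (W × E) (W × E) ℂ) (ψ : W × E → ℂ) :
    extendMatrix W' M *ᵥ (Sum.elim ψ 0 ∘ Equiv.sumProdDistrib W W' E) =
      Sum.elim (M *ᵥ ψ) 0 ∘ Equiv.sumProdDistrib W W' E := by
  unfold extendMatrix
  rw [Matrix.submatrix_mulVec_equiv, Function.comp_assoc, Equiv.self_comp_symm,
    Function.comp_id, Matrix.fromBlocks_mulVec]
  simp

end Embedding

/-! ### From isometries between changing registers to oracle algorithms -/

section Reach

variable (D Y : Type) [Fintype D] [DecidableEq D] [Fintype Y] [DecidableEq Y] [AddCommGroup Y]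

/-- The families of states, depending on the oracle, that are reached by `q` queries and isometries
between arbitrary work registers. -/
inductive Reach : ℕ → (W : Type) → ((D → Y) → (W × Bool × D × Y → ℂ)) → Prop
  | init {W : Type} [Fintype W] [DecidableEq W] (ψ : W × Bool × D × Y → ℂ) (h : nsq ψ = 1) :
      Reach 0 W fun _ => ψ
  | query {q : ℕ} {W W' : Type} [Fintype W] [DecidableEq W] [Fintype W'] [DecidableEq W']
      {Ψ : (D → Y) → (W × Bool × D × Y → ℂ)} (h : Reach q W Ψ)
      (T : Matrix (W' × Bool × D × Y) (W × Bool × D × Y) ℂ) (hT : Tᴴ * T = 1) :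
      Reach (q + 1) W' fun H => T *ᵥ oracleQuery H (Ψ H)

variable {D Y}

/-- Isometries are free: they are absorbed by the initial state or by the isometry after the last
query. -/
lemma Reach.isometry {q : ℕ} {W W' : Type} [i : Fintype W] [d : DecidableEq W] [Fintype W']
    [DecidableEq W'] {Ψ : (D → Y) → (W × Bool × D × Y → ℂ)} (h : Reach D Y q W Ψ)
    (T : Matrix (W' × Bool × D × Y) (W × Bool × D × Y) ℂ) (hT : Tᴴ * T = 1) :
    Reach D Y q W' fun H => T *ᵥ Ψ H := by
  cases h with
  | @init _ i' d' ψ h =>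
    -- The constructor carries its own instances, which have to be identified with the given ones.
    obtain rfl := Subsingleton.elim i i'
    obtain rfl := Subsingleton.elim d d'
    exact Reach.init _ ((nsq_mulVec_of_isometry hT ψ).trans h)
  | @query q W₀ _ _ _ i' d' Ψ h T₀ hT₀ =>
    obtain rfl := Subsingleton.elim i i'
    obtain rfl := Subsingleton.elim d d'
    simp only [Matrix.mulVec_mulVec]
    refine Reach.query h (T * T₀) ?_
    rw [Matrix.conjTranspose_mul, Matrix.mul_assoc, ← Matrix.mul_assoc Tᴴ, hT, Matrix.one_mul, hT₀]

lemma oracleQuery_embMatrix {W W' : Type} [Fintype W] [Fintype W'] [DecidableEq W]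
    [DecidableEq W'] {j : W → W'} (hj : Function.Injective j) (H : D → Y)
    (ψ : W × Bool × D × Y → ℂ) : oracleQuery H (embMatrix (Bool × D × Y) j *ᵥ ψ) =
      embMatrix (Bool × D × Y) j *ᵥ oracleQuery H ψ := by
  funext ⟨w', e⟩
  by_cases hw : w' ∈ Set.range j
  · obtain ⟨w, rfl⟩ := hw
    rw [embMatrix_mulVec_apply hj]
    exact embMatrix_mulVec_apply hj _ _ _
  · rw [embMatrix_mulVec_apply_of_notMem _ hw]
    exact embMatrix_mulVec_apply_of_notMem _ hw _

lemma oracleQuery_inl {W W' : Type} (H : D → Y) (ψ : W × Bool × D × Y → ℂ) :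
    oracleQuery H (Sum.elim ψ 0 ∘ Equiv.sumProdDistrib W W' (Bool × D × Y)) =
      Sum.elim (oracleQuery H ψ) 0 ∘ Equiv.sumProdDistrib W W' (Bool × D × Y) := by
  funext p
  obtain ⟨w | w, e⟩ := p <;> rfl

variable {Out : Type}

/-- `B` with additional work space and a further query. -/
def OracleAlgorithm.snoc {q : ℕ} (B : OracleAlgorithm q D Y Out) {W' : Type} [Fintype W']
    [DecidableEq W'] (o : Out) (S : Matrix (W' × Bool × D × Y) (B.W × Bool × D × Y) ℂ)
    (hS : S * Sᴴ * S = S) : OracleAlgorithm (q + 1) D Y Out where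
  W := B.W ⊕ W'
  init := Sum.elim B.init 0 ∘ Equiv.sumProdDistrib B.W W' (Bool × D × Y)
  init_norm := by
    rw [← B.init_norm]
    simp [Fintype.sum_prod_type, Fintype.sum_sum_type]
  step := Fin.lastCases
    ((dilation S).submatrix (Equiv.sumProdDistrib B.W W' _) (Equiv.sumProdDistrib B.W W' _))
    fun i => extendMatrix W' (B.step i)
  step_spec := by
    intro i
    induction i using Fin.lastCases with
    | last =>
      rw [Fin.lastCases_last]
      refine ⟨_, ?_, 1, IsStarProjection.one _, (Matrix.mul_one _).symm⟩
      rw [Matrix.mem_unitaryGroup_iff, Matrix.star_eq_conjTranspose,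
        Matrix.conjTranspose_submatrix, Matrix.submatrix_mul_equiv, ← Matrix.star_eq_conjTranspose,
        Matrix.mem_unitaryGroup_iff.1 (dilation_mem_unitaryGroup hS), Matrix.submatrix_one_equiv]
    | cast i =>
      rw [Fin.lastCases_castSucc]
      obtain ⟨U, hU, R, hR, h⟩ := B.step_spec i
      refine ⟨extendMatrix W' U, ?_, extendMatrix W' R, ⟨?_, ?_⟩, ?_⟩
      · rw [Matrix.mem_unitaryGroup_iff, Matrix.star_eq_conjTranspose,
          extendMatrix_conjTranspose, ← extendMatrix_mul, ← Matrix.star_eq_conjTranspose,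
          Matrix.mem_unitaryGroup_iff.1 hU, extendMatrix_one]
      · rw [IsIdempotentElem, ← extendMatrix_mul, hR.isIdempotentElem]
      · rw [IsSelfAdjoint, Matrix.star_eq_conjTranspose, extendMatrix_conjTranspose,
          ← Matrix.star_eq_conjTranspose, hR.isSelfAdjoint]
      · rw [h, extendMatrix_mul]
  out := fun _ => o

/-- The state stays in the old summand until the last step, when the dilation moves the part on
which `S` is isometric to the new summand. -/
lemma OracleAlgorithm.finalState_snoc {q : ℕ} (B : OracleAlgorithm q D Y Out) {W' : Type}
    [Fintype W'] [DecidableEq W'] (o : Out)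
    (S : Matrix (W' × Bool × D × Y) (B.W × Bool × D × Y) ℂ) (hS : S * Sᴴ * S = S) (H : D → Y) :
    (B.snoc o S hS).finalState H =
      Sum.elim ((1 - Sᴴ * S) *ᵥ oracleQuery H (B.finalState H)) (S *ᵥ oracleQuery H
        (B.finalState H)) ∘ Equiv.sumProdDistrib B.W W' (Bool × D × Y) := by
  have h1 : ∀ (Ms : List (Matrix (B.W × Bool × D × Y) (B.W × Bool × D × Y) ℂ))
      (ψ : B.W × Bool × D × Y → ℂ), (Ms.map (extendMatrix W')).foldl
        (fun ψ M => M *ᵥ oracleQuery H ψ)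
          (Sum.elim ψ 0 ∘ Equiv.sumProdDistrib B.W W' (Bool × D × Y)) =
        Sum.elim (Ms.foldl (fun ψ M => M *ᵥ oracleQuery H ψ) ψ) 0 ∘
          Equiv.sumProdDistrib B.W W' (Bool × D × Y) := by
    intro Ms
    induction Ms with
    | nil => intro ψ; rfl
    | cons M Ms ih =>
      intro ψ
      rw [List.map_cons, List.foldl_cons, oracleQuery_inl, extendMatrix_mulVec, ih]
      rfl
  unfold OracleAlgorithm.finalState
  rw [List.ofFn_succ', List.concat_eq_append, List.foldl_append]
  have h2 : (List.ofFn fun i => (B.snoc o S hS).step (Fin.castSucc i)) =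
      (List.ofFn B.step).map (extendMatrix W') := by
    rw [List.map_ofFn]
    congr 1
    funext i
    simp [OracleAlgorithm.snoc]
  have h3 : (B.snoc o S hS).step (Fin.last q) = (dilation S).submatrix
      (Equiv.sumProdDistrib B.W W' _) (Equiv.sumProdDistrib B.W W' _) := by
    simp [OracleAlgorithm.snoc]
  rw [h2, h3]
  refine (congrArg (fun φ => List.foldl (fun ψ M => M *ᵥ oracleQuery H ψ) φ
    [(dilation S).submatrix (Equiv.sumProdDistrib B.W W' _) (Equiv.sumProdDistrib B.W W' _)])
    (h1 (List.ofFn B.step) B.init)).trans ?_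
  rw [List.foldl_cons, List.foldl_nil, oracleQuery_inl]
  refine (Matrix.submatrix_mulVec_equiv _ _ _ _).trans ?_
  rw [Function.comp_assoc, Equiv.self_comp_symm, Function.comp_id, dilation,
    Matrix.fromBlocks_mulVec]
  simp

/-- If `J` embeds the current register into that of the algorithm, then `T * Jᴴ` is a partial
isometry, and its dilation carries out `T`. The work register grows by a summand with every query.
-/
lemma Reach.exists_finalState {q : ℕ} {W : Type} {Ψ : (D → Y) → (W × Bool × D × Y → ℂ)}
    (h : Reach D Y q W Ψ) (o : Out) : ∀ [Fintype W] [DecidableEq W],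
    ∃ (B : OracleAlgorithm q D Y Out) (j : W → B.W), Function.Injective j ∧
      ∀ H, B.finalState H = embMatrix (Bool × D × Y) j *ᵥ Ψ H := by
  induction h with
  | @init W i' _ ψ h =>
    intro i _
    obtain rfl := Subsingleton.elim i i'
    refine ⟨⟨W, ψ, h, Fin.elim0, fun i => i.elim0, fun _ => o⟩, id, Function.injective_id,
      fun H => ?_⟩
    funext ⟨w, e⟩
    exact (embMatrix_mulVec_apply Function.injective_id ψ w e).symm
  | @query q W W' _ _ i' d' Ψ h T hT ih =>
    intro i d
    obtain rfl := Subsingleton.elim i i'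
    obtain rfl := Subsingleton.elim d d'
    obtain ⟨B, j, hj, hB⟩ := ih
    have hJ := embMatrix_isometry (E := Bool × D × Y) hj
    set J := embMatrix (Bool × D × Y) j
    have hS : (T * Jᴴ) * (T * Jᴴ)ᴴ * (T * Jᴴ) = T * Jᴴ := by
      rw [Matrix.conjTranspose_mul, Matrix.conjTranspose_conjTranspose]
      calc _ = T * (Jᴴ * J) * (Tᴴ * T) * Jᴴ := by simp only [Matrix.mul_assoc]
        _ = _ := by rw [hJ, hT, Matrix.mul_one, Matrix.mul_one]
    refine ⟨B.snoc o _ hS, Sum.inr, Sum.inr_injective, fun H => ?_⟩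
    rw [B.finalState_snoc, hB, oracleQuery_embMatrix hj]
    have h1 : (T * Jᴴ) *ᵥ (J *ᵥ oracleQuery H (Ψ H)) = T *ᵥ oracleQuery H (Ψ H) := by
      rw [Matrix.mulVec_mulVec, Matrix.mul_assoc, hJ, Matrix.mul_one]
    -- The state lies in the image of `J`, so nothing is left behind in the old summand.
    have h2 : (1 - (T * Jᴴ)ᴴ * (T * Jᴴ)) *ᵥ (J *ᵥ oracleQuery H (Ψ H)) = 0 := by
      rw [Matrix.sub_mulVec, Matrix.one_mulVec, ← Matrix.mulVec_mulVec, h1,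
        Matrix.conjTranspose_mul, Matrix.conjTranspose_conjTranspose, Matrix.mulVec_mulVec,
        Matrix.mul_assoc, hT, Matrix.mul_one, sub_self]
    rw [h1, h2]
    funext p
    obtain ⟨w | w, e⟩ := p
    · refine (embMatrix_mulVec_apply_of_notMem (j := (Sum.inr : W' → B.W ⊕ W')) _ ?_ e).symm
      rintro ⟨_, h⟩
      exact Sum.inr_ne_inl h
    · exact (embMatrix_mulVec_apply (j := (Sum.inr : W' → B.W ⊕ W')) Sum.inr_injective
        (T *ᵥ oracleQuery H (Ψ H)) w e).symm

/-- Outcomes outside the embedded register get an arbitrary output; for nonnegative `f` they may be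
dropped. -/
lemma Reach.exists_algorithm {q : ℕ} {W : Type} [Fintype W] [DecidableEq W]
    {Ψ : (D → Y) → (W × Bool × D × Y → ℂ)} (h : Reach D Y q W Ψ)
    (out : W × Bool × D × Y → Out) [Nonempty Out] :
    ∃ B : OracleAlgorithm q D Y Out, ∀ H (f : Out → ℝ), (∀ o, 0 ≤ f o) →
      ∑ b, ‖Ψ H b‖ ^ 2 * f (out b) ≤ ∑ b, ‖B.finalState H b‖ ^ 2 * f (B.out b) := by
  classical
  obtain ⟨B, j, hj, hB⟩ := h.exists_finalState (Classical.arbitrary Out)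
  refine ⟨{ B with
    out := fun b => if h : ∃ w, j w = b.1 then out (h.choose, b.2) else Classical.arbitrary Out },
    fun H f hf => ?_⟩
  have hinj : Function.Injective fun b : W × Bool × D × Y => (j b.1, b.2) := by
    rintro ⟨w, e⟩ ⟨w', e'⟩ h
    rw [Prod.mk.injEq] at h
    exact Prod.ext (hj h.1) h.2
  have hfin : ∀ b, B.finalState H (j b.1, b.2) = Ψ H b := fun b => by
    rw [hB, embMatrix_mulVec_apply hj]
  refine le_trans (le_of_eq ?_) (Finset.sum_le_sum_of_subset_of_nonneg
    (Finset.subset_univ (Finset.univ.map ⟨_, hinj⟩)) fun b _ _ => ?_)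
  · rw [Finset.sum_map]
    refine Finset.sum_congr rfl fun b _ => ?_
    have hex : ∃ w, j w = j b.1 := ⟨b.1, rfl⟩
    have h1 : ‖Ψ H b‖ = ‖B.finalState H (j b.1, b.2)‖ := by rw [hfin]
    rw [h1]
    congr 2
    simp only [Function.Embedding.coeFn_mk]
    rw [dif_pos hex, hj hex.choose_spec]
  · exact mul_nonneg (by positivity) (hf _)

end Reach

/-! ### Classical random processes with quantum subroutines -/

section Implementable

variable {D Y O : Type} [Fintype D] [DecidableEq D] [Fintype Y] [DecidableEq Y] [AddCommGroup Y]

/-- The random process with transition operator `T H`, on the classical values `O`, can be appended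
to any algorithm at the cost of `k` queries. -/
def Implementable (k : ℕ) (T : (D → Y) → (O → ℝ) → O → ℝ) : Prop :=
  ∀ (q : ℕ) (W : Type) [Fintype W] [DecidableEq W] (Ψ : (D → Y) → (W × Bool × D × Y → ℂ))
    (out : W × Bool × D × Y → O), Reach D Y q W Ψ →
    ∃ (W' : Type) (_ : Fintype W') (_ : DecidableEq W')
      (Ψ' : (D → Y) → (W' × Bool × D × Y → ℂ)) (out' : W' × Bool × D × Y → O),
      Reach D Y (q + k) W' Ψ' ∧ ∀ H f, ∑ b, ‖Ψ' H b‖ ^ 2 * f (out' b) =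
        ∑ b, ‖Ψ H b‖ ^ 2 * T H f (out b)

lemma Implementable.comp {k₁ k₂ : ℕ} {T₁ T₂ : (D → Y) → (O → ℝ) → O → ℝ}
    (h₁ : Implementable k₁ T₁) (h₂ : Implementable k₂ T₂) :
    Implementable (k₁ + k₂) fun H f => T₁ H (T₂ H f) := by
  intro q W _ _ Ψ out hR
  obtain ⟨W₁, _, _, Ψ₁, out₁, hR₁, hT₁⟩ := h₁ q W Ψ out hR
  obtain ⟨W₂, _, _, Ψ₂, out₂, hR₂, hT₂⟩ := h₂ _ W₁ Ψ₁ out₁ hR₁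
  refine ⟨W₂, inferInstance, inferInstance, Ψ₂, out₂, by rwa [← add_assoc], fun H f => ?_⟩
  rw [hT₂, hT₁]

/-- A controlled query, without work register. -/
def bareQuery (H : D → Y) (χ : Bool × D × Y → ℂ) : Bool × D × Y → ℂ :=
  fun e => χ (e.1, e.2.1, e.2.2 - if e.1 then H e.2.1 else 0)

/-- Queries alternating with the matrices of a list, without work register. -/
def bareRun (H : D → Y) (Us : List (Matrix (Bool × D × Y) (Bool × D × Y) ℂ))
    (χ : Bool × D × Y → ℂ) : Bool × D × Y → ℂ :=
  Us.foldl (fun χ U => U *ᵥ bareQuery H χ) χ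

/-- The block diagonal matrix with blocks `U r`. -/
def blockMatrix {R E : Type} [DecidableEq R] (U : R → Matrix E E ℂ) :
    Matrix (R × E) (R × E) ℂ := fun p p' => if p.1 = p'.1 then U p.1 p.2 p'.2 else 0

lemma blockMatrix_mulVec {R E : Type} [Fintype R] [Fintype E] [DecidableEq R]
    (U : R → Matrix E E ℂ) (ψ : R → ℂ) (χ : R → E → ℂ) :
    (blockMatrix U *ᵥ fun p => ψ p.1 * χ p.1 p.2) = fun p => ψ p.1 * (U p.1 *ᵥ χ p.1) p.2 := by
  funext ⟨r, e⟩
  simp only [Matrix.mulVec, dotProduct, blockMatrix, Fintype.sum_prod_type, ite_mul, zero_mul]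
  rw [Finset.sum_eq_single r]
  · simp only [if_true, Finset.mul_sum]
    exact Finset.sum_congr rfl fun e' _ => by ring
  · intro r' _ hr
    simp [hr.symm]
  · simp

lemma blockMatrix_isometry {R E : Type} [Fintype R] [Fintype E] [DecidableEq R] [DecidableEq E]
    {U : R → Matrix E E ℂ} (hU : ∀ r, (U r)ᴴ * U r = 1) :
    (blockMatrix U)ᴴ * blockMatrix U = 1 := by
  ext ⟨r, e⟩ ⟨r', e'⟩
  rw [Matrix.mul_apply, Fintype.sum_prod_type, Finset.sum_eq_single r]
  · by_cases h : r = r'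
    · subst h
      have := congrFun (congrFun (hU r) e) e'
      rw [Matrix.mul_apply] at this
      simp only [Matrix.conjTranspose_apply, blockMatrix, if_true] at this ⊢
      rw [this, Matrix.one_apply, Matrix.one_apply]
      simp
    · simp [blockMatrix, h]
  · intro s _ hs
    simp [blockMatrix, hs]
  · simp

/-- The isometry attaching the state `χ r` to the basis vector `r`. -/
def attachMatrix {R E : Type} [DecidableEq R] (χ : R → E → ℂ) : Matrix (R × E) R ℂ :=
  fun p r => if p.1 = r then χ r p.2 else 0

lemma attachMatrix_mulVec {R E : Type} [Fintype R] [DecidableEq R] (χ : R → E → ℂ) (ψ : R → ℂ) :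
    attachMatrix χ *ᵥ ψ = fun p => ψ p.1 * χ p.1 p.2 := by
  funext p
  simp [attachMatrix, Matrix.mulVec, dotProduct, mul_comm]

lemma attachMatrix_isometry {R E : Type} [Fintype R] [Fintype E] [DecidableEq R]
    {χ : R → E → ℂ} (hχ : ∀ r, nsq (χ r) = 1) : (attachMatrix χ)ᴴ * attachMatrix χ = 1 := by
  ext r r'
  rw [Matrix.mul_apply, Fintype.sum_prod_type, Finset.sum_eq_single r]
  · by_cases h : r = r'
    · subst h
      have := ofReal_nsq (χ r)
      rw [hχ, dotProduct, Complex.ofReal_one] at this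
      simp only [attachMatrix, Matrix.conjTranspose_apply, if_true, Matrix.one_apply_eq]
      exact this.symm
    · simp [attachMatrix, h]
  · intro s _ hs
    simp [attachMatrix, hs]
  · simp

/-- A quantum computation without work register, controlled by the classical value, followed by
a measurement. -/
lemma implementable_block (χ₀ : O → Bool × D × Y → ℂ) (hχ₀ : ∀ o, nsq (χ₀ o) = 1)
    (Us : List (O → Matrix (Bool × D × Y) (Bool × D × Y) ℂ))
    (hUs : ∀ U ∈ Us, ∀ o, (U o)ᴴ * U o = 1) (out : O → Bool × D × Y → O) :
    Implementable (D := D) (Y := Y) Us.length fun H f o =>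
      ∑ e, ‖bareRun H (Us.map fun U => U o) (χ₀ o) e‖ ^ 2 * f (out o e) := by
  intro q W _ _ Ψ out₀ hR
  -- All old registers become work space, and a fresh query register is attached. From now on they
  -- only control, so their squared amplitudes act as a probability distribution and the measurement
  -- is deferred.
  have h0 : Reach D Y q (W × Bool × D × Y) fun H p => Ψ H p.1 * χ₀ (out₀ p.1) p.2 := by
    have := hR.isometry _ (attachMatrix_isometry (χ := fun r => χ₀ (out₀ r)) fun r => hχ₀ _)
    simpa only [attachMatrix_mulVec] using this
  have h1 : ∀ (Us : List (O → Matrix (Bool × D × Y) (Bool × D × Y) ℂ)),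
      (∀ U ∈ Us, ∀ o, (U o)ᴴ * U o = 1) → ∀ (q : ℕ) (χ : (D → Y) → O → Bool × D × Y → ℂ),
      Reach D Y q (W × Bool × D × Y) (fun H p => Ψ H p.1 * χ H (out₀ p.1) p.2) →
      Reach D Y (q + Us.length) (W × Bool × D × Y) fun H p => Ψ H p.1 *
        bareRun H (Us.map fun U => U (out₀ p.1)) (χ H (out₀ p.1)) p.2 := by
    intro Us
    induction Us with
    | nil => intro _ q χ h; exact h
    | cons U Us ih =>
      intro hUs q χ h
      have h2 := Reach.query h (blockMatrix fun r => U (out₀ r))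
        (blockMatrix_isometry fun r => hUs U List.mem_cons_self _)
      have h3 : ∀ H, oracleQuery H (fun p : (W × Bool × D × Y) × Bool × D × Y =>
          Ψ H p.1 * χ H (out₀ p.1) p.2) =
          fun p => Ψ H p.1 * bareQuery H (χ H (out₀ p.1)) p.2 := fun H => rfl
      simp only [h3] at h2
      have h4 : ∀ H, (blockMatrix (fun r => U (out₀ r)) *ᵥ fun p =>
          Ψ H p.1 * bareQuery H (χ H (out₀ p.1)) p.2) = fun p =>
          Ψ H p.1 * (U (out₀ p.1) *ᵥ bareQuery H (χ H (out₀ p.1))) p.2 := fun H =>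
        blockMatrix_mulVec (fun r => U (out₀ r)) (Ψ H) fun r => bareQuery H (χ H (out₀ r))
      simp only [h4] at h2
      have h5 := ih (fun U hU => hUs U (List.mem_cons_of_mem _ hU)) (q + 1)
        (fun H o => U o *ᵥ bareQuery H (χ H o)) h2
      rw [List.length_cons, add_comm Us.length, ← add_assoc]
      exact h5
  refine ⟨W × Bool × D × Y, inferInstance, inferInstance, _, fun p => out (out₀ p.1) p.2,
    h1 Us hUs q (fun _ => χ₀) h0,
    fun H f => ?_⟩
  rw [Fintype.sum_prod_type]
  refine Finset.sum_congr rfl fun r _ => ?_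
  rw [Finset.mul_sum]
  refine Finset.sum_congr rfl fun e _ => ?_
  simp only [norm_mul, mul_pow]
  ring

end Implementable

/-! ### Grover's algorithm in the query register -/

section Lift

variable {D Y A : Type} [Fintype D] [DecidableEq D] [Fintype Y] [DecidableEq Y] [AddCommGroup Y]
  [Fintype A]

/-- The superposition of the query inputs `u a`, with contents `v a` of the output register and
amplitudes `f a`. -/
def liftState (u : A → D) (v : A → Y) (f : A → ℝ) : Bool × D × Y → ℂ :=
  fun e => ∑ a, if e = (true, u a, v a) then (f a : ℂ) else 0

lemma liftState_apply {u : A → D} (hu : Function.Injective u) (v : A → Y) (f : A → ℝ) (a : A) :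
    liftState u v f (true, u a, v a) = f a := by
  unfold liftState
  rw [Finset.sum_eq_single a]
  · simp
  · intro a' _ ha
    rw [if_neg]
    simp only [Prod.mk.injEq, not_and]
    intro _ h
    exact absurd (hu h).symm ha
  · simp

lemma sum_liftState {u : A → D} (hu : Function.Injective u) (v : A → Y) (f : A → ℝ)
    {M : Type} [AddCommMonoid M] (g : ℂ → Bool × D × Y → M) (hg : ∀ e, g 0 e = 0) :
    ∑ e, g (liftState u v f e) e = ∑ a, g (f a) (true, u a, v a) := by
  have hinj : Function.Injective fun a => (true, u a, v a) := fun a a' h => by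
    simp only [Prod.mk.injEq, true_and] at h
    exact hu h.1
  rw [← Finset.sum_subset (Finset.subset_univ (Finset.univ.map ⟨_, hinj⟩)), Finset.sum_map]
  · refine Finset.sum_congr rfl fun a _ => ?_
    simp only [Function.Embedding.coeFn_mk]
    rw [liftState_apply hu]
  · intro e _ he
    have : liftState u v f e = 0 := by
      unfold liftState
      refine Finset.sum_eq_zero fun a _ => if_neg ?_
      rintro rfl
      exact he (Finset.mem_map.2 ⟨a, Finset.mem_univ _, rfl⟩)
    rw [this, hg]

lemma bareQuery_liftState (H : D → Y) (u : A → D) (v : A → Y) (f : A → ℝ) :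
    bareQuery H (liftState u v f) = liftState u (fun a => v a + H (u a)) f := by
  funext ⟨b, d, y⟩
  unfold bareQuery liftState
  refine Finset.sum_congr rfl fun a _ => ?_
  congr 1
  simp only [Prod.mk.injEq, eq_iff_iff]
  constructor
  · rintro ⟨rfl, rfl, h⟩
    exact ⟨rfl, rfl, sub_eq_iff_eq_add.1 h⟩
  · rintro ⟨rfl, rfl, h⟩
    exact ⟨rfl, rfl, sub_eq_iff_eq_add.2 h⟩

/-- The phase flip on the set `S` of contents of the output register. -/
def phaseMatrix (D : Type) [DecidableEq D] (S : Finset Y) :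
    Matrix (Bool × D × Y) (Bool × D × Y) ℂ :=
  Matrix.diagonal fun e => if e.2.2 ∈ S then -1 else 1

lemma phaseMatrix_isometry (S : Finset Y) : (phaseMatrix D S)ᴴ * phaseMatrix D S = 1 := by
  unfold phaseMatrix
  rw [Matrix.diagonal_conjTranspose, Matrix.diagonal_mul_diagonal, ← Matrix.diagonal_one]
  congr 1
  funext e
  simp only [Pi.star_apply]
  split_ifs <;> simp

lemma phaseMatrix_mulVec (S : Finset Y) (u : A → D) (v : A → Y) (f : A → ℝ) :
    phaseMatrix D S *ᵥ liftState u v f =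
      liftState u v fun a => (if v a ∈ S then -1 else 1) * f a := by
  funext e
  rw [phaseMatrix, Matrix.mulVec_diagonal]
  unfold liftState
  rw [Finset.mul_sum]
  refine Finset.sum_congr rfl fun a _ => ?_
  by_cases h : e = (true, u a, v a)
  · subst h
    simp only [if_true]
    split_ifs <;> simp
  · simp [h]

/-- The reflection about the vector `χ`. -/
def reflectionMatrix {E : Type} [DecidableEq E] (χ : E → ℂ) : Matrix E E ℂ :=
  2 • Matrix.vecMulVec χ (star χ) - 1

lemma reflectionMatrix_isometry {E : Type} [Fintype E] [DecidableEq E] {χ : E → ℂ}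
    (h : nsq χ = 1) : (reflectionMatrix χ)ᴴ * reflectionMatrix χ = 1 := by
  have h1 : star χ ⬝ᵥ χ = 1 := by rw [← ofReal_nsq, h, Complex.ofReal_one]
  have h2 : (Matrix.vecMulVec χ (star χ))ᴴ = Matrix.vecMulVec χ (star χ) := by
    rw [Matrix.conjTranspose_vecMulVec, star_star]
  have h3 : Matrix.vecMulVec χ (star χ) * Matrix.vecMulVec χ (star χ) =
      Matrix.vecMulVec χ (star χ) := by
    rw [Matrix.vecMulVec_mul_vecMulVec, h1, one_smul]
  unfold reflectionMatrix
  rw [Matrix.conjTranspose_sub, Matrix.conjTranspose_one, Matrix.conjTranspose_smul, h2]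
  simp only [Matrix.sub_mul, Matrix.mul_sub, Matrix.mul_one, Matrix.one_mul, star_ofNat,
    Matrix.smul_mul, Matrix.mul_smul, h3]
  module

end Lift

section Grover

variable {D Y A O : Type} [Fintype D] [DecidableEq D] [Fintype Y] [DecidableEq Y] [AddCommGroup Y]
  [Fintype A]

lemma nsq_liftState {u : A → D} (hu : Function.Injective u) (v : A → Y) (f : A → ℝ) :
    nsq (liftState u v f) = ∑ a, f a ^ 2 := by
  unfold nsq
  rw [sum_liftState hu v f (fun z _ => ‖z‖ ^ 2) (by simp)]
  simp

lemma reflectionMatrix_mulVec_liftState {u : A → D} (hu : Function.Injective u) (v : A → Y)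
    (χ f : A → ℝ) : reflectionMatrix (liftState u v χ) *ᵥ liftState u v f =
      liftState u v fun a => 2 * (∑ b, χ b * f b) * χ a - f a := by
  have h1 : star (liftState u v χ) ⬝ᵥ liftState u v f = ((∑ b, χ b * f b : ℝ) : ℂ) := by
    unfold dotProduct
    rw [sum_liftState hu v f (fun z e => star (liftState u v χ) e * z) (by simp)]
    push_cast
    refine Finset.sum_congr rfl fun a _ => ?_
    rw [Pi.star_apply, liftState_apply hu]
    simp
  unfold reflectionMatrix
  rw [Matrix.sub_mulVec, Matrix.one_mulVec, Matrix.smul_mulVec, Matrix.vecMulVec_mulVec, h1]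
  set c := ∑ b, χ b * f b
  funext e
  have h2 : liftState u v (fun a => 2 * c * χ a - f a) e =
      2 * (c * liftState u v χ e) - liftState u v f e := by
    simp only [liftState, Finset.mul_sum]
    rw [← Finset.sum_sub_distrib]
    refine Finset.sum_congr rfl fun a _ => ?_
    split_ifs
    · push_cast
      ring
    · simp
  rw [h2]
  rw [Pi.sub_apply, two_smul, Pi.add_apply, Pi.smul_apply, MulOpposite.smul_eq_mul_unop,
    MulOpposite.unop_op]
  ring

/-- The sign flip on the inputs marked by `S` followed by the reflection about the uniform
superposition. -/
def groverStep (S : Finset Y) (h : A → Y) (f : A → ℝ) : A → ℝ := fun a =>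
  2 * (∑ b, (if h b ∈ S then -1 else 1) * f b) / Fintype.card A - (if h a ∈ S then -1 else 1) * f a

/-- The amplitudes after `j` Grover iterations. -/
def grover (S : Finset Y) (h : A → Y) (j : ℕ) : A → ℝ :=
  (groverStep S h)^[j] fun _ => 1 / √(Fintype.card A)

/-- The matrices used in one Grover iteration. -/
def groverMatrices (S : Finset Y) (u : A → D) : List (Matrix (Bool × D × Y) (Bool × D × Y) ℂ) :=
  [phaseMatrix D S, reflectionMatrix (liftState u 0 fun _ => 1 / √(Fintype.card A))]

lemma bareRun_append (H : D → Y) (Us Us' : List (Matrix (Bool × D × Y) (Bool × D × Y) ℂ))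
    (χ : Bool × D × Y → ℂ) : bareRun H (Us ++ Us') χ = bareRun H Us' (bareRun H Us χ) := by
  simp [bareRun]

/-- The first query writes the hash value that the phase flip reads; the second query erases it
because `y + y = 0`. Hence two queries per iteration. -/
lemma bareRun_groverMatrices (hY : ∀ y : Y, y + y = 0) (H : D → Y) (S : Finset Y) {u : A → D}
    (hu : Function.Injective u) (f : A → ℝ) :
    bareRun H (groverMatrices S u) (liftState u 0 f) =
      liftState u 0 (groverStep S (fun a => H (u a)) f) := by
  have h0 : (fun a => (0 : A → Y) a + H (u a)) = fun a => H (u a) := by simp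
  have h1 : (fun a => H (u a) + H (u a)) = 0 := funext fun a => hY _
  simp only [bareRun, groverMatrices, List.foldl_cons, List.foldl_nil]
  rw [bareQuery_liftState, h0, phaseMatrix_mulVec, bareQuery_liftState, h1,
    reflectionMatrix_mulVec_liftState hu]
  congr 1
  funext a
  unfold groverStep
  rw [← Finset.mul_sum]
  have h2 : (1 / √(Fintype.card A : ℝ)) * (1 / √(Fintype.card A)) = 1 / Fintype.card A := by
    rw [div_mul_div_comm, one_mul, Real.mul_self_sqrt (Nat.cast_nonneg _)]
  rw [mul_div_assoc, div_eq_mul_one_div _ (Fintype.card A : ℝ), ← h2]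
  ring

lemma bareRun_grover (hY : ∀ y : Y, y + y = 0) (H : D → Y) (S : Finset Y) {u : A → D}
    (hu : Function.Injective u) (f : A → ℝ) (j : ℕ) :
    bareRun H (List.replicate j (groverMatrices S u)).flatten (liftState u 0 f) =
      liftState u 0 ((groverStep S fun a => H (u a))^[j] f) := by
  induction j generalizing f with
  | zero => rfl
  | succ j ih =>
    rw [List.replicate_succ, List.flatten_cons, bareRun_append, bareRun_groverMatrices hY H S hu,
      ih, Function.iterate_succ_apply]

/-- `j` Grover iterations followed by a measurement take `2 j` queries. -/
lemma implementable_grover [Nonempty A] (hY : ∀ y : Y, y + y = 0) (S : Finset Y) (u : O → A → D)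
    (hu : ∀ o, Function.Injective (u o)) (upd : O → A → O) (j : ℕ) :
    Implementable (D := D) (Y := Y) (2 * j) fun H f o =>
      ∑ a, grover S (fun a => H (u o a)) j a ^ 2 * f (upd o a) := by
  classical
  have hN : 0 < (Fintype.card A : ℝ) := Nat.cast_pos.2 Fintype.card_pos
  have hunif : ∀ o, nsq (liftState (Y := Y) (u o) 0 fun _ => 1 / √(Fintype.card A)) = 1 := by
    intro o
    rw [nsq_liftState (hu o)]
    simp only [div_pow, one_pow, Real.sq_sqrt hN.le, Finset.sum_const, Finset.card_univ,
      nsmul_eq_mul]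
    exact mul_one_div_cancel hN.ne'
  have h1 := implementable_block (D := D) (Y := Y)
    (fun o => liftState (u o) 0 fun _ => 1 / √(Fintype.card A)) hunif
    (List.replicate j [fun _ => phaseMatrix D S,
      fun o => reflectionMatrix (liftState (u o) 0 fun _ => 1 / √(Fintype.card A))]).flatten
    (by
      intro U hU o
      obtain ⟨l, hl, hU⟩ := List.mem_flatten.1 hU
      rw [List.eq_of_mem_replicate hl] at hU
      simp only [List.mem_cons, List.not_mem_nil, or_false] at hU
      obtain rfl | rfl := hU
      · exact phaseMatrix_isometry S
      · exact reflectionMatrix_isometry (hunif o))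
    -- The measured query input determines `a`, as `u o` is injective; inputs outside its range have
    -- amplitude 0.
    (fun o e => if h : ∃ a, u o a = e.2.1 then upd o h.choose else o)
  have h2 : (List.replicate j [fun _ => phaseMatrix D S,
      fun o => reflectionMatrix (liftState (Y := Y) (u o) 0
        fun _ => 1 / √(Fintype.card A))]).flatten.length = 2 * j := by
    simp [mul_comm]
  rw [h2] at h1
  convert h1 using 4 with H f o
  have h3 : (List.map (fun U => U o) (List.replicate j [fun _ => phaseMatrix D S,
      fun o => reflectionMatrix (liftState (Y := Y) (u o) 0
        fun _ => 1 / √(Fintype.card A))]).flatten) =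
      (List.replicate j (groverMatrices S (u o))).flatten := by
    simp [List.map_flatten, groverMatrices]
  rw [h3, bareRun_grover hY H S (hu o)]
  rw [sum_liftState (hu o) 0 _ (fun z e => ‖z‖ ^ 2 *
    f (if h : ∃ a, u o a = e.2.1 then upd o h.choose else o)) (by simp)]
  refine Finset.sum_congr rfl fun a _ => ?_
  have h4 : ∃ a', u o a' = u o a := ⟨a, rfl⟩
  rw [dif_pos h4, hu o h4.choose_spec]
  simp [grover]

/-- A classical query. -/
lemma implementable_lookup (pt : O → D) (upd : O → Y → O) :
    Implementable (D := D) (Y := Y) 1 fun H f o => f (upd o (H (pt o))) := by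
  have hu : ∀ o, Function.Injective fun _ : Unit => pt o :=
    fun o => Function.injective_of_subsingleton _
  have h1 := implementable_block (D := D) (Y := Y)
    (fun o => liftState (fun _ : Unit => pt o) 0 fun _ => 1)
    (fun o => by rw [nsq_liftState (hu o)]; simp)
    [fun _ => 1] (by simp) (fun o e => upd o e.2.2)
  refine Eq.mp ?_ h1
  congr 1
  funext H f o
  have h2 : bareRun H (List.map (fun U : O → _ => U o) [fun _ => 1])
      (liftState (fun _ : Unit => pt o) 0 fun _ => 1) =
      bareQuery H (liftState (fun _ : Unit => pt o) 0 fun _ => 1) := Matrix.one_mulVec _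
  rw [h2, bareQuery_liftState,
    sum_liftState (hu o) _ _ (fun z e => ‖z‖ ^ 2 * f (upd o e.2.2)) (by simp)]
  simp

end Grover

/-! ### The success probability of Grover's algorithm for few marked inputs -/

section GroverAmplitude

variable {Y A : Type} [Fintype A] [DecidableEq Y]

/-- The amplitudes, up to normalisation, of the marked and of the unmarked inputs after `j` Grover
iterations, if the fraction `τ` of the inputs is marked. -/
def groverAmplitude (τ : ℝ) : ℕ → ℝ × ℝ
  | 0 => (1, 1)
  | j + 1 =>
    let s := (1 - τ) * (groverAmplitude τ j).2 - τ * (groverAmplitude τ j).1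
    (2 * s + (groverAmplitude τ j).1, 2 * s - (groverAmplitude τ j).2)

lemma groverAmplitude_norm (τ : ℝ) (j : ℕ) :
    τ * (groverAmplitude τ j).1 ^ 2 + (1 - τ) * (groverAmplitude τ j).2 ^ 2 = 1 := by
  induction j with
  | zero => simp [groverAmplitude]
  | succ j ih =>
    simp only [groverAmplitude]
    linear_combination ih

/-- The iteration preserves the plane of amplitude vectors that are constant on the marked and on
the unmarked inputs. -/
lemma grover_eq [Nonempty A] (S : Finset Y) (h : A → Y) (j : ℕ) (a : A) :
    let τ := ((Finset.univ.filter fun a => h a ∈ S).card : ℝ) / Fintype.card A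
    grover S h j a = (if h a ∈ S then (groverAmplitude τ j).1 else (groverAmplitude τ j).2) /
      √(Fintype.card A) := by
  intro τ
  have hN : (0 : ℝ) < Fintype.card A := Nat.cast_pos.2 Fintype.card_pos
  induction j generalizing a with
  | zero => simp [grover, groverAmplitude]
  | succ j ih =>
    have h1 : grover S h (j + 1) = groverStep S h (grover S h j) := by
      unfold grover
      rw [Function.iterate_succ_apply']
    have h2 : ∀ x y : ℝ, ∑ b, (if h b ∈ S then x else y) =
        Fintype.card A * (τ * x + (1 - τ) * y) := by
      intro x y
      have h3 : (Fintype.card A : ℝ) = (Finset.univ.filter fun a => h a ∈ S).card +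
          (Finset.univ.filter fun a => h a ∉ S).card := by
        rw [← Nat.cast_add, Finset.card_filter_add_card_filter_not, Finset.card_univ]
      have h4 : τ * Fintype.card A = (Finset.univ.filter fun a => h a ∈ S).card :=
        div_mul_cancel₀ _ hN.ne'
      rw [Finset.sum_ite, Finset.sum_const, Finset.sum_const, nsmul_eq_mul, nsmul_eq_mul]
      have h5 : ((Finset.univ.filter fun a => h a ∉ S).card : ℝ) = (1 - τ) * Fintype.card A := by
        linarith
      rw [h5, ← h4]
      ring
    rw [h1]
    unfold groverStep
    have h3 : ∀ b, (if h b ∈ S then (-1 : ℝ) else 1) * grover S h j b =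
        (if h b ∈ S then -(groverAmplitude τ j).1 / √(Fintype.card A) else
          (groverAmplitude τ j).2 / √(Fintype.card A)) := by
      intro b
      rw [ih]
      split_ifs <;> ring
    simp only [h3]
    rw [h2]
    simp only [groverAmplitude]
    split_ifs <;> field_simp <;> ring

/-- The probability that the measurement after `j` Grover iterations finds a marked input. -/
lemma sum_grover_sq_ite [Nonempty A] (S : Finset Y) (h : A → Y) (j : ℕ) (x y : ℝ) :
    let τ := ((Finset.univ.filter fun a => h a ∈ S).card : ℝ) / Fintype.card A
    ∑ a, grover S h j a ^ 2 * (if h a ∈ S then x else y) =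
      τ * (groverAmplitude τ j).1 ^ 2 * x + (1 - τ * (groverAmplitude τ j).1 ^ 2) * y := by
  intro τ
  have hN : (0 : ℝ) < Fintype.card A := Nat.cast_pos.2 Fintype.card_pos
  have h3 : (Fintype.card A : ℝ) = (Finset.univ.filter fun a => h a ∈ S).card +
      (Finset.univ.filter fun a => h a ∉ S).card := by
    rw [← Nat.cast_add, Finset.card_filter_add_card_filter_not, Finset.card_univ]
  have h4 : τ * Fintype.card A = (Finset.univ.filter fun a => h a ∈ S).card :=
    div_mul_cancel₀ _ hN.ne'
  have h5 : ((Finset.univ.filter fun a => h a ∉ S).card : ℝ) = (1 - τ) * Fintype.card A := by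
    linarith
  have h6 : ∀ a, grover S h j a ^ 2 * (if h a ∈ S then x else y) =
      if h a ∈ S then (groverAmplitude τ j).1 ^ 2 / Fintype.card A * x else
        (groverAmplitude τ j).2 ^ 2 / Fintype.card A * y := by
    intro a
    rw [grover_eq, div_pow, Real.sq_sqrt hN.le]
    split_ifs <;> rfl
  simp only [h6]
  rw [Finset.sum_ite, Finset.sum_const, Finset.sum_const, nsmul_eq_mul, nsmul_eq_mul, h5, ← h4]
  have h7 := groverAmplitude_norm τ j
  field_simp
  linear_combination y * h7

/-- For `τ = 0` the recursion is `(x, y) ↦ (x + 2y, y)`, which yields `(2j + 1, 1)`; the deviation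
is of first order in `τ`. The constant depends on `j` only. -/
lemma exists_groverAmplitude_bound (j : ℕ) : ∃ K : ℝ, 0 ≤ K ∧ ∀ τ : ℝ, 0 ≤ τ → τ ≤ 1 →
    |(groverAmplitude τ j).1 - (2 * j + 1)| ≤ K * τ ∧ |(groverAmplitude τ j).2 - 1| ≤ K * τ := by
  induction j with
  | zero => exact ⟨0, le_rfl, fun τ _ _ => by simp [groverAmplitude]⟩
  | succ j ih =>
    obtain ⟨K, hK, h⟩ := ih
    refine ⟨3 * K + 2 * (2 * K + 2 * j + 2), by positivity, fun τ h0 h1 => ?_⟩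
    obtain ⟨h2, h3⟩ := h τ h0 h1
    have h4 : K * τ ≤ K := mul_le_of_le_one_right hK h1
    rw [abs_le] at h2 h3
    have h5 : τ * ((groverAmplitude τ j).1 + (groverAmplitude τ j).2) ≤
        τ * (2 * K + 2 * j + 2) := mul_le_mul_of_nonneg_left (by linarith) h0
    have h6 : τ * -(2 * K + 2 * j + 2) ≤
        τ * ((groverAmplitude τ j).1 + (groverAmplitude τ j).2) :=
      mul_le_mul_of_nonneg_left (by have := (Nat.cast_nonneg j : (0 : ℝ) ≤ j); linarith) h0
    simp only [groverAmplitude]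
    push_cast
    constructor <;> rw [abs_le] <;> constructor <;> linarith

lemma exists_grover_success_bound (j : ℕ) : ∃ K : ℝ, 0 ≤ K ∧ ∀ τ : ℝ, 0 ≤ τ → τ ≤ 1 →
    |τ * (groverAmplitude τ j).1 ^ 2 - (2 * j + 1) ^ 2 * τ| ≤ K * τ ^ 2 := by
  obtain ⟨K, hK, h⟩ := exists_groverAmplitude_bound j
  refine ⟨K * (K + 2 * (2 * j + 1)), by positivity, fun τ h0 h1 => ?_⟩
  obtain ⟨h2, -⟩ := h τ h0 h1
  set μ := (groverAmplitude τ j).1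
  have h3 : τ * μ ^ 2 - (2 * j + 1) ^ 2 * τ =
      τ * ((μ - (2 * j + 1)) * ((μ - (2 * j + 1)) + 2 * (2 * j + 1))) := by ring
  rw [h3, abs_mul, abs_mul, abs_of_nonneg h0]
  have h4 : |μ - (2 * j + 1) + 2 * (2 * j + 1)| ≤ K + 2 * (2 * j + 1) := by
    refine (abs_add_le _ _).trans (add_le_add (h2.trans (mul_le_of_le_one_right hK h1)) ?_)
    rw [abs_of_nonneg (by positivity)]
  calc _ ≤ τ * (K * τ * (K + 2 * (2 * j + 1))) := by gcongr
    _ = _ := by ring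

end GroverAmplitude

/-! ### Expectations over a random function -/

section Expectation

variable {D Y A : Type} [Fintype D] [DecidableEq D] [Fintype Y] [DecidableEq Y]

/-- The expectation over a uniformly random function. -/
def expect (F : (D → Y) → ℝ) : ℝ := (∑ H, F H) / Fintype.card (D → Y)

lemma expect_add (F G : (D → Y) → ℝ) : expect (fun H => F H + G H) = expect F + expect G := by
  simp only [expect, Finset.sum_add_distrib, add_div]

lemma expect_sub (F G : (D → Y) → ℝ) : expect (fun H => F H - G H) = expect F - expect G := by
  simp only [expect, Finset.sum_sub_distrib, sub_div]

lemma expect_mul_left (c : ℝ) (F : (D → Y) → ℝ) : expect (fun H => c * F H) = c * expect F := by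
  simp only [expect, ← Finset.mul_sum, mul_div_assoc]

lemma expect_mul_right (c : ℝ) (F : (D → Y) → ℝ) : expect (fun H => F H * c) = expect F * c := by
  simp only [expect, ← Finset.sum_mul, div_mul_eq_mul_div]

lemma expect_sum {ι : Type*} (s : Finset ι) (F : ι → (D → Y) → ℝ) :
    expect (fun H => ∑ i ∈ s, F i H) = ∑ i ∈ s, expect (F i) := by
  simp only [expect]
  rw [Finset.sum_comm, Finset.sum_div]

lemma expect_mono {F G : (D → Y) → ℝ} (h : ∀ H, F H ≤ G H) : expect F ≤ expect G :=
  div_le_div_of_nonneg_right (Finset.sum_le_sum fun H _ => h H) (Nat.cast_nonneg _)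

lemma expect_const [Nonempty Y] (c : ℝ) : expect (fun _ : D → Y => c) = c := by
  have : (Fintype.card (D → Y) : ℝ) ≠ 0 := Nat.cast_ne_zero.2 Fintype.card_ne_zero
  simp only [expect, Finset.sum_const, Finset.card_univ, nsmul_eq_mul]
  exact mul_div_cancel_left₀ _ this

/-- The values on a set of inputs may be drawn independently. -/
lemma expect_resample [Nonempty Y] (P : D → Prop) [DecidablePred P] (F : (D → Y) → ℝ) :
    expect F = expect fun H' => expect fun H => F fun d => if P d then H' d else H d := by
  have hne : (Fintype.card (D → Y) : ℝ) ≠ 0 := Nat.cast_ne_zero.2 Fintype.card_ne_zero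
  let e : (D → Y) × (D → Y) → (D → Y) × (D → Y) := fun x =>
    (fun d => if P d then x.1 d else x.2 d, fun d => if P d then x.2 d else x.1 d)
  have he : Function.Involutive e := by
    rintro ⟨a, b⟩
    refine Prod.ext ?_ ?_ <;> funext d <;> by_cases h : P d <;> simp [e, h]
  have h1 : ∑ x : (D → Y) × (D → Y), F (e x).1 = ∑ x : (D → Y) × (D → Y), F x.1 :=
    he.bijective.sum_comp fun x => F x.1
  rw [Fintype.sum_prod_type, Fintype.sum_prod_type] at h1
  simp only [Finset.sum_const, Finset.card_univ, nsmul_eq_mul, ← Finset.mul_sum] at h1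
  simp only [expect]
  rw [← Finset.sum_div]
  have h2 : ∑ x, ∑ y, F (e (x, y)).1 =
    ∑ x : D → Y, ∑ y : D → Y, F fun d => if P d then x d else y d := rfl
  rw [← h2, h1, mul_div_cancel_left₀ _ hne]

lemma expect_apply [Nonempty Y] (d : D) (f : Y → ℝ) :
    expect (fun H : D → Y => f (H d)) = (∑ y, f y) / Fintype.card Y := by
  have h1 : ∑ H : D → Y, f (H d) = Fintype.card ({d' // d' ≠ d} → Y) * ∑ y, f y := by
    rw [← (Equiv.funSplitAt d Y).symm.sum_comp, Fintype.sum_prod_type, Finset.mul_sum]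
    refine Finset.sum_congr rfl fun y _ => ?_
    simp [Equiv.funSplitAt, Equiv.piSplitAt]
  have h2 : (Fintype.card (D → Y) : ℝ) =
      Fintype.card ({d' // d' ≠ d} → Y) * Fintype.card Y := by
    rw [← Nat.cast_mul, Fintype.card_congr (Equiv.funSplitAt d Y), Fintype.card_prod, mul_comm]
  have h3 : (Fintype.card ({d' // d' ≠ d} → Y) : ℝ) ≠ 0 := Nat.cast_ne_zero.2 Fintype.card_ne_zero
  rw [expect, h1, h2, mul_div_mul_left _ _ h3]

lemma expect_mem [Nonempty Y] (d : D) (S : Finset Y) :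
    expect (fun H : D → Y => if H d ∈ S then (1 : ℝ) else 0) = S.card / Fintype.card Y := by
  rw [expect_apply d fun y => if y ∈ S then (1 : ℝ) else 0]
  simp

lemma expect_mem_mul_mem [Nonempty Y] {d d' : D} (h : d ≠ d') (S : Finset Y) :
    expect (fun H : D → Y => (if H d ∈ S then (1 : ℝ) else 0) * if H d' ∈ S then (1 : ℝ) else 0) =
      (S.card / Fintype.card Y) ^ 2 := by
  rw [expect_resample (· = d)]
  simp only [if_true, h.symm, if_false, expect_mul_left, expect_mem, expect_mul_right]
  ring

variable [Fintype A] [Nonempty A] [Nonempty Y]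

/-- The fraction of marked inputs. -/
def markedFraction (S : Finset Y) (h : A → Y) : ℝ :=
  ((Finset.univ.filter fun a => h a ∈ S).card : ℝ) / Fintype.card A

lemma markedFraction_eq (S : Finset Y) (h : A → Y) :
    markedFraction S h = (∑ a, if h a ∈ S then (1 : ℝ) else 0) / Fintype.card A := by
  simp [markedFraction]

lemma markedFraction_nonneg (S : Finset Y) (h : A → Y) : 0 ≤ markedFraction S h := by
  unfold markedFraction
  positivity

lemma markedFraction_le_one (S : Finset Y) (h : A → Y) : markedFraction S h ≤ 1 := by
  unfold markedFraction
  rw [div_le_one (Nat.cast_pos.2 Fintype.card_pos)]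
  exact_mod_cast Finset.card_le_univ _

lemma expect_markedFraction (S : Finset Y) (u : A → D) :
    expect (fun H : D → Y => markedFraction S fun a => H (u a)) = S.card / Fintype.card Y := by
  have hN : (Fintype.card A : ℝ) ≠ 0 := Nat.cast_ne_zero.2 Fintype.card_ne_zero
  simp only [markedFraction_eq, div_eq_mul_inv _ (Fintype.card A : ℝ)]
  rw [expect_mul_right, expect_sum]
  simp only [expect_mem, Finset.sum_const, Finset.card_univ, nsmul_eq_mul]
  field_simp

/-- Values at distinct inputs are independent; the diagonal pairs contribute the term divided by
`|A|`. -/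
lemma expect_markedFraction_sq_le (S : Finset Y) {u : A → D} (hu : Function.Injective u) :
    expect (fun H : D → Y => (markedFraction S fun a => H (u a)) ^ 2) ≤
      (S.card / Fintype.card Y) ^ 2 + S.card / Fintype.card Y / Fintype.card A := by
  classical
  have hN : (0 : ℝ) < Fintype.card A := Nat.cast_pos.2 Fintype.card_pos
  set p : ℝ := S.card / Fintype.card Y
  have hp : 0 ≤ p := by positivity
  simp only [markedFraction_eq, div_pow, div_eq_mul_inv _ ((Fintype.card A : ℝ) ^ 2)]
  rw [expect_mul_right]
  simp only [sq (∑ a, _), Finset.sum_mul_sum]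
  rw [expect_sum]
  have h1 : ∀ a : A, expect (fun H : D → Y => ∑ b, (if H (u a) ∈ S then (1 : ℝ) else 0) *
      if H (u b) ∈ S then (1 : ℝ) else 0) ≤ p + Fintype.card A * p ^ 2 := by
    intro a
    rw [expect_sum, ← Finset.add_sum_erase _ _ (Finset.mem_univ a)]
    refine add_le_add (le_of_eq ?_) ?_
    · refine Eq.trans ?_ (expect_mem (u a) S)
      congr 1
      funext H
      split_ifs <;> simp
    · refine (Finset.sum_le_card_nsmul _ _ (p ^ 2) fun b hb => le_of_eq ?_).trans ?_
      · exact expect_mem_mul_mem (fun h => (Finset.ne_of_mem_erase hb) (hu h).symm) S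
      · rw [nsmul_eq_mul]
        gcongr
        exact Finset.card_le_univ _
  refine (mul_le_mul_of_nonneg_right (Finset.sum_le_sum fun a _ => h1 a) (by positivity)).trans
    (le_of_eq ?_)
  rw [Finset.sum_const, Finset.card_univ, nsmul_eq_mul]
  field_simp
  ring

/-- The probability that `j` Grover iterations find a marked input. -/
def groverSuccess (S : Finset Y) (j : ℕ) (h : A → Y) : ℝ :=
  markedFraction S h * (groverAmplitude (markedFraction S h) j).1 ^ 2

lemma sum_grover_sq (S : Finset Y) (h : A → Y) (j : ℕ) (x y : ℝ) :
    ∑ a, grover S h j a ^ 2 * (if h a ∈ S then x else y) =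
      groverSuccess S j h * x + (1 - groverSuccess S j h) * y :=
  sum_grover_sq_ite S h j x y

lemma groverSuccess_nonneg (S : Finset Y) (j : ℕ) (h : A → Y) : 0 ≤ groverSuccess S j h :=
  mul_nonneg (markedFraction_nonneg S h) (sq_nonneg _)

lemma groverSuccess_le_one (S : Finset Y) (j : ℕ) (h : A → Y) : groverSuccess S j h ≤ 1 := by
  rw [← groverAmplitude_norm (markedFraction S h) j]
  exact le_add_of_nonneg_right
    (mul_nonneg (sub_nonneg.2 (markedFraction_le_one S h)) (sq_nonneg _))

/-- A constant in the second order term of the success probability of `j` Grover iterations. -/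
def groverError (j : ℕ) : ℝ := (exists_grover_success_bound j).choose

lemma groverError_nonneg (j : ℕ) : 0 ≤ groverError j :=
  (exists_grover_success_bound j).choose_spec.1

/-- The second order error is controlled by the second moment of the marked fraction. With about `1
/ p` candidates it is of order `p ^ 2`, negligible against the main term. -/
lemma abs_expect_groverSuccess_sub_le (S : Finset Y) {u : A → D} (hu : Function.Injective u)
    (j : ℕ) : |expect (fun H : D → Y => groverSuccess S j fun a => H (u a)) -
      (2 * j + 1) ^ 2 * (S.card / Fintype.card Y)| ≤ groverError j *
        ((S.card / Fintype.card Y) ^ 2 + S.card / Fintype.card Y / Fintype.card A) := by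
  have h0 : ∀ H : D → Y, |groverSuccess S j (fun a => H (u a)) -
      (2 * j + 1) ^ 2 * markedFraction S fun a => H (u a)| ≤
      groverError j * (markedFraction S fun a => H (u a)) ^ 2 := fun H =>
    (exists_grover_success_bound j).choose_spec.2 _ (markedFraction_nonneg _ _)
      (markedFraction_le_one _ _)
  rw [← expect_markedFraction S u, ← expect_mul_left, ← expect_sub, expect_markedFraction]
  have h1 := mul_le_mul_of_nonneg_left (expect_markedFraction_sq_le S hu) (groverError_nonneg j)
  rw [← expect_mul_left] at h1
  refine le_trans (abs_le.2 ⟨?_, ?_⟩) h1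
  · rw [neg_eq_neg_one_mul, ← expect_mul_left]
    exact expect_mono fun H => by linarith [(abs_le.1 (h0 H)).1]
  · exact expect_mono fun H => (abs_le.1 (h0 H)).2

end Expectation

/-! ### The expected value of the attack -/

section Attack

variable {n M : ℕ} [NeZero n] {X A B C : Type} [Fintype X] [Fintype A] [Fintype B] [Fintype C]
  [DecidableEq X] [DecidableEq A] [DecidableEq B] [DecidableEq C]

/-- The round after which `r` further challenges are needed. -/
def roundOfRank (n : ℕ) [NeZero n] (r : ℕ) : Fin n := (Fin.ofNat n r).rev

lemma rev_roundOfRank_le (r : ℕ) : ((roundOfRank n r).rev : ℕ) ≤ r := by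
  simp only [roundOfRank, Fin.rev_rev, Fin.ofNat]
  exact Nat.mod_le _ _

lemma rev_roundOfRank {r : ℕ} (hr : r < n) : ((roundOfRank n r).rev : ℕ) = r := by
  simp only [roundOfRank, Fin.rev_rev, Fin.ofNat]
  exact Nat.mod_eq_of_lt hr

lemma roundOfRank_rev (k : Fin n) : roundOfRank n (k.rev : ℕ) = k := by
  rw [Fin.ext_iff, ← Fin.rev_rev (roundOfRank n _), Fin.val_rev, rev_roundOfRank k.rev.isLt,
    Fin.val_rev]
  omega

/-- Whether the last `r` challenges, starting from the previous challenge `s`, are in `S`. -/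
def chainValue (S : Finset C) (H : FSDomain n X A C → C) (a : Fin n → A) : ℕ → X ⊕ C → ℝ
  | 0, _ => 1
  | r + 1, s =>
    let c := H (roundOfRank n r, s, a (roundOfRank n r))
    (if c ∈ S then 1 else 0) * chainValue S H a r (Sum.inr c)

lemma chainValue_nonneg (S : Finset C) (H : FSDomain n X A C → C) (a : Fin n → A) (r : ℕ)
    (s : X ⊕ C) : 0 ≤ chainValue S H a r s := by
  induction r generalizing s with
  | zero => exact zero_le_one
  | succ r ih =>
    refine mul_nonneg ?_ (ih _)
    split_ifs <;> norm_num

lemma chainValue_congr (S : Finset C) {H H' : FSDomain n X A C → C} {a a' : Fin n → A} {r : ℕ}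
    (hH : ∀ d, (d.1.rev : ℕ) < r → H d = H' d) (ha : ∀ k, (k.rev : ℕ) < r → a k = a' k)
    (s : X ⊕ C) : chainValue S H a r s = chainValue S H' a' r s := by
  induction r generalizing s with
  | zero => rfl
  | succ r ih =>
    have h1 := Nat.lt_succ_of_le (rev_roundOfRank_le (n := n) r)
    simp only [chainValue]
    rw [ha _ h1, hH _ h1,
      ih (fun d hd => hH d (Nat.lt_succ_of_lt hd)) fun k hk => ha k (Nat.lt_succ_of_lt hk)]

/-- Different rounds use different hash inputs, so the current round may be resampled independently
of the later ones. -/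
lemma expect_chainValue (S : Finset C) [Nonempty C] (a : Fin n → A) {r : ℕ} (hr : r ≤ n)
    (s : X ⊕ C) : expect (fun H => chainValue S H a r s) =
      ((S.card : ℝ) / Fintype.card C) ^ r := by
  induction r generalizing s with
  | zero => simp only [chainValue, pow_zero, expect_const]
  | succ r ih =>
    rw [expect_resample fun d => (d.1.rev : ℕ) = r]
    simp only [chainValue]
    have h1 : ∀ (H' H : FSDomain n X A C → C) (t : X ⊕ C),
        chainValue S (fun d => if (d.1.rev : ℕ) = r then H' d else H d) a r t =
          chainValue S H a r t := fun H' H t =>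
      chainValue_congr S (fun d hd => if_neg hd.ne) (fun _ _ => rfl) t
    simp only [h1, rev_roundOfRank (Nat.lt_of_succ_le hr), if_true]
    simp only [expect_mul_left, ih (Nat.le_of_succ_le hr), expect_mul_right, expect_mem]
    ring

/-- The inputs searched by the block with number `ℓ`. -/
def blockPoint (M ℓ r : ℕ) (s : X ⊕ C) (b : B) : FSDomain n X (Fin (M + 1) × B) C :=
  (roundOfRank n r, s, Fin.ofNat (M + 1) ℓ, b)

lemma blockPoint_injective (ℓ r : ℕ) (s : X ⊕ C) :
    Function.Injective (blockPoint (n := n) (B := B) M ℓ r s) := by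
  intro b b' h
  simp only [blockPoint, Prod.mk.injEq, true_and] at h
  exact h

/-- A lower bound for the success probability of the attack which tries to find a good message for
the current round in blocks, given by the numbers of Grover iterations, then once more by `j₀`
Grover iterations, and then guesses. -/
def attackValue (S : Finset C) (H : FSDomain n X (Fin (M + 1) × B) C → C)
    (a₀ : Fin n → Fin (M + 1) × B) (j₀ : ℕ) : List ℕ → ℕ → X ⊕ C → ℝ
  | [], 0, _ => 1
  | [], r + 1, s => ∑ b, grover S (fun b => H (blockPoint M 0 r s b)) j₀ b ^ 2 *
      if H (blockPoint M 0 r s b) ∈ S then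
        chainValue S H a₀ r (Sum.inr (H (blockPoint M 0 r s b))) else 0
  | _ :: _, 0, _ => 1
  | j :: js, r + 1, s => ∑ b, grover S (fun b => H (blockPoint M (js.length + 1) r s b)) j b ^ 2 *
      if H (blockPoint M (js.length + 1) r s b) ∈ S then
        attackValue S H a₀ j₀ js r (Sum.inr (H (blockPoint M (js.length + 1) r s b)))
      else attackValue S H a₀ j₀ js (r + 1) s

lemma attackValue_zero (S : Finset C) (H : FSDomain n X (Fin (M + 1) × B) C → C)
    (a₀ : Fin n → Fin (M + 1) × B) (j₀ : ℕ) (js : List ℕ) (s : X ⊕ C) :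
    attackValue S H a₀ j₀ js 0 s = 1 := by
  cases js <;> rfl

/-- The labels of the searches decrease along the schedule, so the rest of the attack never looks at
the inputs of an earlier search. This provides the independence for `attackBound_le_expect`. -/
lemma attackValue_congr (S : Finset C) {H H' : FSDomain n X (Fin (M + 1) × B) C → C}
    (a₀ : Fin n → Fin (M + 1) × B) (j₀ : ℕ) (js : List ℕ) (r : ℕ) (s : X ⊕ C)
    (h : ∀ d, (d.1.rev : ℕ) < r → ((d.1.rev : ℕ) + 1 = r → (d.2.2.1 : ℕ) ≤ js.length) →
      H d = H' d) : attackValue S H a₀ j₀ js r s = attackValue S H' a₀ j₀ js r s := by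
  induction js generalizing r s with
  | nil =>
    cases r with
    | zero => rfl
    | succ r =>
      have h1 : ∀ b, H (blockPoint M 0 r s b) = H' (blockPoint M 0 r s b) := fun b =>
        h _ (Nat.lt_succ_of_le (rev_roundOfRank_le r)) fun _ => by simp [blockPoint]
      have h2 : ∀ t, chainValue S H a₀ r t = chainValue S H' a₀ r t :=
        chainValue_congr S (fun d hd => h d (Nat.lt_succ_of_lt hd) fun h' => by omega)
          fun _ _ => rfl
      simp only [attackValue, h1, h2]
  | cons j js ih =>
    cases r with
    | zero => rfl
    | succ r =>
      have h1 : ∀ b, H (blockPoint M (js.length + 1) r s b) =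
          H' (blockPoint M (js.length + 1) r s b) := fun b =>
        h _ (Nat.lt_succ_of_le (rev_roundOfRank_le r)) fun _ => Nat.mod_le _ _
      have h2 : ∀ t, attackValue S H a₀ j₀ js r t = attackValue S H' a₀ j₀ js r t := fun t =>
        ih r t fun d hd _ => h d (Nat.lt_succ_of_lt hd) fun h' => by omega
      have h3 : attackValue S H a₀ j₀ js (r + 1) s = attackValue S H' a₀ j₀ js (r + 1) s :=
        ih (r + 1) s fun d hd hd' => h d hd fun h' => (hd' h').trans (Nat.le_succ _)
      simp only [attackValue, h1, h2, h3]

/-- The expectation of `attackValue` in terms of bounds for the expected success probability of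
Grover's algorithm. -/
def attackBound (lo hi : ℕ → ℝ) (p : ℝ) (j₀ : ℕ) : List ℕ → ℕ → ℝ
  | [], 0 => 1
  | [], r + 1 => lo j₀ * p ^ r
  | _ :: _, 0 => 1
  | j :: js, r + 1 =>
    lo j * attackBound lo hi p j₀ js r + (1 - hi j) * attackBound lo hi p j₀ js (r + 1)

lemma attackBound_nonneg {lo hi : ℕ → ℝ} (hlo : ∀ j, 0 ≤ lo j) (hhi : ∀ j, hi j ≤ 1) {p : ℝ}
    (hp : 0 ≤ p) (j₀ : ℕ) (js : List ℕ) (r : ℕ) : 0 ≤ attackBound lo hi p j₀ js r := by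
  induction js generalizing r with
  | nil =>
    cases r with
    | zero => exact zero_le_one
    | succ r => exact mul_nonneg (hlo _) (pow_nonneg hp _)
  | cons j js ih =>
    cases r with
    | zero => exact zero_le_one
    | succ r =>
      exact add_nonneg (mul_nonneg (hlo _) (ih _)) (mul_nonneg (sub_nonneg.2 (hhi _)) (ih _))

/-- The inputs of the first search are resampled as `H'`. For fixed `H'`, the continuation is
averaged over an independent oracle, and its bound depends only on whether the search succeeded. -/
lemma attackBound_le_expect [Nonempty B] [Nonempty C] (S : Finset C) {lo hi : ℕ → ℝ}
    (hlo : ∀ j, 0 ≤ lo j) (hhi : ∀ j, hi j ≤ 1)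
    (hG : ∀ j (u : B → FSDomain n X (Fin (M + 1) × B) C), Function.Injective u →
      lo j ≤ expect (fun H : _ → C => groverSuccess S j fun b => H (u b)) ∧
        expect (fun H : _ → C => groverSuccess S j fun b => H (u b)) ≤ hi j)
    (a₀ : Fin n → Fin (M + 1) × B) (j₀ : ℕ) (js : List ℕ) (hjs : js.length ≤ M) (r : ℕ)
    (hr : r ≤ n) (s : X ⊕ C) :
    attackBound lo hi (S.card / Fintype.card C) j₀ js r ≤
      expect fun H => attackValue S H a₀ j₀ js r s := by
  have hp : (0 : ℝ) ≤ S.card / Fintype.card C := by positivity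
  induction js generalizing r s with
  | nil =>
    cases r with
    | zero => simp only [attackValue, attackBound, expect_const, le_refl]
    | succ r =>
      rw [expect_resample fun d => (d.1.rev : ℕ) = r]
      simp only [attackValue, attackBound]
      have h1 : ∀ (H' H : FSDomain n X (Fin (M + 1) × B) C → C) (t : X ⊕ C),
          chainValue S (fun d => if (d.1.rev : ℕ) = r then H' d else H d) a₀ r t =
            chainValue S H a₀ r t := fun H' H t =>
        chainValue_congr S (fun d hd => if_neg hd.ne) (fun _ _ => rfl) t
      have h2 : ∀ b : B, ((blockPoint (n := n) M 0 r s b).1.rev : ℕ) = r := fun b =>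
        rev_roundOfRank (Nat.lt_of_succ_le hr)
      simp only [h1, h2, if_true]
      refine (mul_le_mul_of_nonneg_right (hG j₀ _ (blockPoint_injective 0 r s)).1
        (pow_nonneg hp r)).trans ?_
      rw [← expect_mul_right]
      refine expect_mono fun H' => le_of_eq ?_
      rw [expect_sum]
      have h3 : ∀ b, expect (fun H : FSDomain n X (Fin (M + 1) × B) C → C =>
          grover S (fun b => H' (blockPoint M 0 r s b)) j₀ b ^ 2 *
            if H' (blockPoint M 0 r s b) ∈ S then
              chainValue S H a₀ r (Sum.inr (H' (blockPoint M 0 r s b))) else 0) =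
          grover S (fun b => H' (blockPoint M 0 r s b)) j₀ b ^ 2 *
            if H' (blockPoint M 0 r s b) ∈ S then ((S.card : ℝ) / Fintype.card C) ^ r else 0 := by
        intro b
        rw [expect_mul_left]
        congr 1
        split_ifs
        · exact expect_chainValue S a₀ (Nat.le_of_succ_le hr) _
        · exact expect_const _
      rw [Finset.sum_congr rfl fun b _ => h3 b,
        sum_grover_sq S fun b => H' (blockPoint M 0 r s b)]
      ring
  | cons j js ih =>
    have hjs' : js.length + 1 ≤ M := hjs
    cases r with
    | zero => simp only [attackValue, attackBound, expect_const, le_refl]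
    | succ r =>
      obtain ⟨ℓ, hℓ⟩ : ∃ ℓ, ℓ = js.length + 1 := ⟨_, rfl⟩
      rw [expect_resample fun d => (d.1.rev : ℕ) = r ∧ (d.2.2.1 : ℕ) = ℓ]
      simp only [attackValue, attackBound, ← hℓ]
      have h1 : ∀ (H' H : FSDomain n X (Fin (M + 1) × B) C → C) (t : X ⊕ C), attackValue S
          (fun d => if (d.1.rev : ℕ) = r ∧ (d.2.2.1 : ℕ) = ℓ then H' d else H d) a₀ j₀ js r t =
            attackValue S H a₀ j₀ js r t := fun H' H t =>
        attackValue_congr S a₀ j₀ js r t fun d hd _ => if_neg fun h => hd.ne h.1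
      have h1' : ∀ (H' H : FSDomain n X (Fin (M + 1) × B) C → C) (t : X ⊕ C), attackValue S
          (fun d => if (d.1.rev : ℕ) = r ∧ (d.2.2.1 : ℕ) = ℓ then H' d else H d) a₀ j₀ js
            (r + 1) t = attackValue S H a₀ j₀ js (r + 1) t := fun H' H t =>
        attackValue_congr S a₀ j₀ js (r + 1) t fun d hd hd' => if_neg fun h => by
          have := hd' (by rw [h.1])
          omega
      have h2 : ∀ b : B, ((blockPoint (n := n) M ℓ r s b).1.rev : ℕ) = r ∧
          ((blockPoint (n := n) M ℓ r s b).2.2.1 : ℕ) = ℓ := fun b =>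
        ⟨rev_roundOfRank (Nat.lt_of_succ_le hr), Nat.mod_eq_of_lt (by omega)⟩
      simp only [h1, h1', h2, and_self, if_true]
      set x := attackBound lo hi (S.card / Fintype.card C) j₀ js r
      set y := attackBound lo hi (S.card / Fintype.card C) j₀ js (r + 1)
      have hx : 0 ≤ x := attackBound_nonneg hlo hhi hp _ _ _
      have hy : 0 ≤ y := attackBound_nonneg hlo hhi hp _ _ _
      obtain ⟨h3, h4⟩ := hG j (blockPoint M ℓ r s) (blockPoint_injective ℓ r s)
      set e := expect (fun H : FSDomain n X (Fin (M + 1) × B) C → C =>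
        groverSuccess S j fun b => H (blockPoint M ℓ r s b)) with he
      -- Success is bounded below by `lo` and failure by `1 - hi`, since it is not known which of
      -- `x`, `y` is larger; both are nonnegative.
      calc lo j * x + (1 - hi j) * y ≤ e * x + (1 - e) * y := by gcongr
        _ = expect fun H' : FSDomain n X (Fin (M + 1) × B) C → C =>
            ∑ b, grover S (fun b => H' (blockPoint M ℓ r s b)) j b ^ 2 *
              if H' (blockPoint M ℓ r s b) ∈ S then x else y := by
          have : ∀ H' : FSDomain n X (Fin (M + 1) × B) C → C,
              ∑ b, grover S (fun b => H' (blockPoint M ℓ r s b)) j b ^ 2 *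
                (if H' (blockPoint M ℓ r s b) ∈ S then x else y) =
              groverSuccess S j (fun b => H' (blockPoint M ℓ r s b)) * (x - y) + y := fun H' => by
            rw [sum_grover_sq S fun b => H' (blockPoint M ℓ r s b)]
            ring
          simp only [this, expect_add, expect_mul_right, expect_const]
          ring
        _ ≤ _ := by
          refine expect_mono fun H' => ?_
          rw [expect_sum]
          refine Finset.sum_le_sum fun b _ => ?_
          rw [expect_mul_left]
          refine mul_le_mul_of_nonneg_left ?_ (sq_nonneg _)
          split_ifs
          · exact ih (by omega) r (by omega) _
          · exact ih (by omega) (r + 1) hr _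

end Attack

/-! ### The attack as a random process and as an oracle algorithm -/

section AttackProcess

variable {n M : ℕ} {X B C : Type} [Fintype X] [Fintype B] [Fintype C]
  [DecidableEq X] [DecidableEq B] [DecidableEq C]

/-- The classical memory of the attack: the number of challenges still needed, the messages found,
the previous challenge (or the instance), and the candidate for the current message. -/
structure AttackState (n : ℕ) (X A C : Type) where
  rank : ℕ
  msgs : Fin n → A
  prev : X ⊕ C
  cand : A

variable (M) in
/-- Storing the result of the search number `ℓ`. -/
def AttackState.search (ℓ : ℕ) (o : AttackState n X (Fin (M + 1) × B) C) (b : B) :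
    AttackState n X (Fin (M + 1) × B) C := { o with cand := (Fin.ofNat (M + 1) ℓ, b) }

variable [NeZero n]

/-- The hash input belonging to the candidate. -/
def AttackState.point {A : Type} (o : AttackState n X A C) : FSDomain n X A C :=
  (roundOfRank n (o.rank - 1), o.prev, o.cand)

/-- Accepting the candidate if its challenge `c` is good. -/
def AttackState.advance {A : Type} (S : Finset C) (o : AttackState n X A C) (c : C) :
    AttackState n X A C :=
  if o.rank ≠ 0 ∧ c ∈ S then
    { o with
      rank := o.rank - 1
      msgs := Function.update o.msgs (roundOfRank n (o.rank - 1)) o.cand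
      prev := Sum.inr c }
  else o

/-- Accepting the candidate without looking up its challenge. -/
def AttackState.commit {A : Type} (o : AttackState n X A C) : AttackState n X A C :=
  if o.rank ≠ 0 then
    { o with msgs := Function.update o.msgs (roundOfRank n (o.rank - 1)) o.cand }
  else o

/-- The attack as a random process. -/
def attackProcess (S : Finset C) (j₀ : ℕ) : List ℕ → (FSDomain n X (Fin (M + 1) × B) C → C) →
    (AttackState n X (Fin (M + 1) × B) C → ℝ) → AttackState n X (Fin (M + 1) × B) C → ℝ
  | [], H, f, o => ∑ b, grover S (fun b => H (blockPoint M 0 (o.rank - 1) o.prev b)) j₀ b ^ 2 *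
      f (o.search M 0 b).commit
  | j :: js, H, f, o =>
    ∑ b, grover S (fun b => H (blockPoint M (js.length + 1) (o.rank - 1) o.prev b)) j b ^ 2 *
      attackProcess S j₀ js H f ((o.search M (js.length + 1) b).advance S
        (H (o.search M (js.length + 1) b).point))

lemma implementable_attackProcess [AddCommGroup C] [Nonempty B] (hC : ∀ c : C, c + c = 0)
    (S : Finset C) (j₀ : ℕ) (js : List ℕ) :
    Implementable (D := FSDomain n X (Fin (M + 1) × B) C) (Y := C)
      ((js.map fun j => 2 * j + 1).sum + 2 * j₀) (fun H f o =>
        attackProcess S j₀ js H f o) := by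
  induction js with
  | nil =>
    rw [List.map_nil, List.sum_nil, zero_add]
    exact implementable_grover hC S
      (fun (o : AttackState n X (Fin (M + 1) × B) C) b => blockPoint M 0 (o.rank - 1) o.prev b)
      (fun o => blockPoint_injective (n := n) _ _ _) (fun o b => (o.search M 0 b).commit) j₀
  | cons j js ih =>
    have h1 := implementable_grover hC S (fun (o : AttackState n X (Fin (M + 1) × B) C) b =>
      blockPoint M (js.length + 1) (o.rank - 1) o.prev b)
      (fun o => blockPoint_injective (n := n) _ _ _)
      (fun o b => o.search M (js.length + 1) b) j
    have h2 := implementable_lookup (D := FSDomain n X (Fin (M + 1) × B) C) (Y := C)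
      (fun o : AttackState n X (Fin (M + 1) × B) C => o.point) fun o c => o.advance S c
    have h3 := (h1.comp h2).comp ih
    rwa [List.map_cons, List.sum_cons, add_assoc]

/-- The messages stored agree with `a₀` where no choice was made, and the challenges obtained so far
are good. -/
def AttackState.Valid (S : Finset C) (H : FSDomain n X (Fin (M + 1) × B) C → C) (x : X)
    (a₀ : Fin n → Fin (M + 1) × B) (o : AttackState n X (Fin (M + 1) × B) C) : Prop :=
  o.rank ≤ n ∧ (∀ k : Fin n, (k.rev : ℕ) < o.rank → o.msgs k = a₀ k) ∧
    ∀ a : Fin n → Fin (M + 1) × B, (∀ k : Fin n, o.rank ≤ k.rev → a k = o.msgs k) →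
      chainValue S H a o.rank o.prev ≤ chainValue S H a n (Sum.inl x)

lemma AttackState.Valid.advance {S : Finset C} {H : FSDomain n X (Fin (M + 1) × B) C → C} {x : X}
    {a₀ : Fin n → Fin (M + 1) × B} {o : AttackState n X (Fin (M + 1) × B) C}
    (h : o.Valid S H x a₀) : (o.advance S (H o.point)).Valid S H x a₀ := by
  unfold AttackState.advance
  split_ifs with hc
  · obtain ⟨rank, msgs, prev, cand⟩ := o
    obtain ⟨hr, hc⟩ := hc
    obtain ⟨r, rfl⟩ := Nat.exists_eq_succ_of_ne_zero hr
    obtain ⟨h1, h2, h3⟩ := h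
    simp only [Nat.succ_eq_add_one, AttackState.point, Nat.add_sub_cancel] at h1 h2 h3 hc ⊢
    have hrn : r < n := h1
    refine ⟨hrn.le, fun k hk => ?_, fun a ha => ?_⟩
    · simp only at hk ⊢
      rw [Function.update_of_ne, h2 k (Nat.lt_succ_of_lt hk)]
      rintro rfl
      exact hk.ne (rev_roundOfRank hrn)
    · simp only at ha ⊢
      have h4 : a (roundOfRank n r) = cand := by
        rw [ha _ (rev_roundOfRank hrn).ge, Function.update_self]
      refine le_trans (le_of_eq ?_) (h3 a fun k hk => ?_)
      · simp only [chainValue]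
        rw [h4, if_pos hc, one_mul]
      · rw [ha k (Nat.le_of_succ_le hk), Function.update_of_ne]
        rintro rfl
        exact absurd (rev_roundOfRank hrn) (by omega)
  · exact h

lemma AttackState.Valid.search {S : Finset C} {H : FSDomain n X (Fin (M + 1) × B) C → C} {x : X}
    {a₀ : Fin n → Fin (M + 1) × B} {o : AttackState n X (Fin (M + 1) × B) C}
    (h : o.Valid S H x a₀) (ℓ : ℕ) (b : B) : (o.search M ℓ b).Valid S H x a₀ := h

lemma sum_grover_sq_eq_one [Nonempty B] (S : Finset C) (h : B → C) (j : ℕ) :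
    ∑ b, grover S h j b ^ 2 = 1 := by
  have : Nonempty C := ⟨h (Classical.arbitrary B)⟩
  have := sum_grover_sq S h j 1 1
  simp only [ite_self, mul_one] at this
  rw [this]
  ring

/-- By `Valid`, the final chain succeeds whenever the outstanding part of it does. The last search
fixes the message of the current round unchecked, and the rounds after it keep their messages from
`a₀`. -/
lemma attackValue_le_attackProcess [Nonempty B] {S : Finset C}
    {H : FSDomain n X (Fin (M + 1) × B) C → C} {x : X} {a₀ : Fin n → Fin (M + 1) × B} (j₀ : ℕ)
    (js : List ℕ) (o : AttackState n X (Fin (M + 1) × B) C) (h : o.Valid S H x a₀) :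
    attackValue S H a₀ j₀ js o.rank o.prev ≤
      attackProcess S j₀ js H (fun o => chainValue S H o.msgs n (Sum.inl x)) o := by
  induction js generalizing o with
  | nil =>
    obtain ⟨rank, msgs, prev, cand⟩ := o
    obtain ⟨h1, h2, h3⟩ := h
    simp only [attackProcess, AttackState.search, AttackState.commit] at h1 h2 h3 ⊢
    cases rank with
    | zero =>
      have h4 := h3 msgs fun _ _ => rfl
      simp only [chainValue] at h4
      simp only [attackValue, ne_eq, not_true_eq_false, if_false]
      rw [← Finset.sum_mul, sum_grover_sq_eq_one, one_mul]
      exact h4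
    | succ r =>
      have hrn : r < n := h1
      simp only [attackValue, Nat.add_sub_cancel, ne_eq, Nat.succ_ne_zero, not_false_eq_true,
        if_true]
      refine Finset.sum_le_sum fun b _ => mul_le_mul_of_nonneg_left ?_ (sq_nonneg _)
      set a := Function.update msgs (roundOfRank n r) (Fin.ofNat (M + 1) 0, b)
      have h4 : chainValue S H a₀ r (Sum.inr (H (blockPoint M 0 r prev b))) =
          chainValue S H a r (Sum.inr (H (blockPoint M 0 r prev b))) := by
        refine chainValue_congr S (fun _ _ => rfl) (fun k hk => ?_) _
        rw [← h2 k (Nat.lt_succ_of_lt hk)]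
        refine (Function.update_of_ne ?_ _ _).symm
        rintro rfl
        exact hk.ne (rev_roundOfRank hrn)
      refine le_trans (le_of_eq ?_) (h3 a fun k hk => Function.update_of_ne ?_ _ _)
      · simp only [chainValue]
        rw [h4, show a (roundOfRank n r) = _ from Function.update_self _ _ _]
        simp only [blockPoint, ite_mul, one_mul, zero_mul]
        rfl
      · rintro rfl
        exact absurd (rev_roundOfRank hrn) (by omega)
  | cons j js ih =>
    simp only [attackProcess]
    have h0 : ∀ b, ((o.search M (js.length + 1) b).advance S
        (H (o.search M (js.length + 1) b).point)).Valid S H x a₀ :=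
      fun b => (h.search _ b).advance
    obtain ⟨rank, msgs, prev, cand⟩ := o
    cases rank with
    | zero =>
      -- With no challenge outstanding the search still takes place, because the number of queries
      -- is fixed in advance, but the memory no longer advances.
      rw [attackValue_zero, ← sum_grover_sq_eq_one S
        (fun b => H (blockPoint M (js.length + 1) (0 - 1) prev b)) j]
      refine Finset.sum_le_sum fun b _ => le_mul_of_one_le_right (sq_nonneg _) ?_
      refine le_trans (le_of_eq ?_) (ih _ (h0 b))
      simp only [AttackState.search, AttackState.advance, ne_eq, not_true_eq_false, false_and,
        if_false, attackValue_zero]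
    | succ r =>
      simp only [attackValue, Nat.add_sub_cancel]
      refine Finset.sum_le_sum fun b _ => mul_le_mul_of_nonneg_left ?_ (sq_nonneg _)
      refine le_trans (le_of_eq ?_) (ih _ (h0 b))
      simp only [AttackState.search, AttackState.advance, AttackState.point, ne_eq,
        Nat.succ_ne_zero, not_false_eq_true, true_and, Nat.add_sub_cancel]
      by_cases hc : H (blockPoint M (js.length + 1) r prev b) ∈ S
      · rw [if_pos hc]
        unfold blockPoint at hc ⊢
        rw [if_pos hc]
      · rw [if_neg hc]
        unfold blockPoint at hc
        rw [if_neg hc]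

/-- The attack against Fiat–Shamir, as an oracle algorithm. -/
lemma exists_oracleAlgorithm_attack [AddCommGroup C] [Nonempty B] {Z : Type} [Nonempty Z]
    (hC : ∀ c : C, c + c = 0) (S : Finset C) (x : X) (a₀ : Fin n → Fin (M + 1) × B) (j₀ : ℕ)
    (js : List ℕ) :
    ∃ alg : OracleAlgorithm ((js.map fun j => 2 * j + 1).sum + 2 * j₀)
      (FSDomain n X (Fin (M + 1) × B) C) C (X × (Fin n → Fin (M + 1) × B) × Z),
      ∀ (H) (f : X × (Fin n → Fin (M + 1) × B) × Z → ℝ), (∀ o, 0 ≤ f o) →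
        (∀ a z, chainValue S H a n (Sum.inl x) ≤ f (x, a, z)) →
        attackValue S H a₀ j₀ js n (Sum.inl x) ≤
          ∑ b, ‖alg.finalState H b‖ ^ 2 * f (alg.out b) := by
  let o₀ : AttackState n X (Fin (M + 1) × B) C := ⟨n, a₀, Sum.inl x, a₀ 0⟩
  let z : Z := Classical.arbitrary Z
  let e₀ : Unit × Bool × FSDomain n X (Fin (M + 1) × B) C × C :=
    ((), false, (0, Sum.inl x, a₀ 0), 0)
  let ψ : Unit × Bool × FSDomain n X (Fin (M + 1) × B) C × C → ℂ :=
    open Classical in fun b => if b = e₀ then 1 else 0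
  have hψ' : ∀ F : _ → ℝ, ∑ b, ‖ψ b‖ ^ 2 * F b = F e₀ := by
    intro F
    rw [Finset.sum_eq_single e₀]
    · simp [ψ]
    · intro b _ hb
      simp [ψ, hb]
    · simp
  have hψ : ∑ b, ‖ψ b‖ ^ 2 = 1 := by simpa using hψ' fun _ => 1
  obtain ⟨W, _, _, Ψ, out, hR, hT⟩ := implementable_attackProcess (n := n) (M := M) hC S j₀ js 0
    Unit (fun _ => ψ) (fun _ => o₀) (Reach.init ψ hψ)
  rw [zero_add] at hR
  have : Nonempty (X × (Fin n → Fin (M + 1) × B) × Z) := ⟨(x, a₀, z)⟩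
  obtain ⟨alg, halg⟩ := hR.exists_algorithm fun b => (x, (out b).msgs, z)
  refine ⟨alg, fun H f hf hle => le_trans ?_ (halg H f hf)⟩
  have h1 := attackValue_le_attackProcess (H := H) (S := S) (x := x) (a₀ := a₀) j₀ js o₀
    ⟨le_rfl, fun _ _ => rfl, fun _ _ => le_rfl⟩
  refine h1.trans ?_
  have h2 := hT H fun o => chainValue S H o.msgs n (Sum.inl x)
  rw [hψ'] at h2
  refine le_trans h2.ge ?_
  exact Finset.sum_le_sum fun b _ => mul_le_mul_of_nonneg_left (hle _ _) (sq_nonneg _)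

end AttackProcess

/-! ### The protocol under attack -/

section SubsetProtocol

variable {n : ℕ} {A C : Type} [Fintype A] [Fintype C]

/-- The messages have no influence, so every supremum is over a constant and each round contributes
the density of `S`. -/
lemma gameValue_eq_of_forall_mem [Nonempty A] [Nonempty C] {S : Finset C}
    {acc : List (A × C) → Prop}
    (hacc : ∀ h : List (A × C), h.length = n → (acc h ↔ ∀ e ∈ h, e.2 ∈ S)) (k : ℕ)
    (h : List (A × C)) (hk : k + h.length = n) [Decidable (∀ e ∈ h, e.2 ∈ S)] :
    gameValue acc k h =
      if ∀ e ∈ h, e.2 ∈ S then ((S.card : ℝ) / Fintype.card C) ^ k else 0 := by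
  classical
  induction k generalizing h with
  | zero =>
    rw [gameValue, pow_zero]
    simp only [hacc h (by omega)]
  | succ k ih =>
    rw [gameValue]
    have h1 : ∀ a, (∑ c, gameValue acc k ((a, c) :: h)) / Fintype.card C =
        if ∀ e ∈ h, e.2 ∈ S then ((S.card : ℝ) / Fintype.card C) ^ (k + 1) else 0 := by
      intro a
      have h2 : ∀ c, gameValue acc k ((a, c) :: h) = if c ∈ S then
          (if ∀ e ∈ h, e.2 ∈ S then ((S.card : ℝ) / Fintype.card C) ^ k else 0) else 0 := by
        intro c
        rw [ih ((a, c) :: h) (by rw [List.length_cons]; omega)]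
        simp only [List.forall_mem_cons, ite_and]
      simp only [h2, Finset.sum_ite_mem, Finset.univ_inter, Finset.sum_const, nsmul_eq_mul]
      split_ifs
      · rw [pow_succ]
        ring
      · simp
    simp only [h1, ciSup_const]

/-- The protocol in which the verifier accepts a wrong instance iff all challenges are in `S`. -/
def subsetProtocol (n : ℕ) (A : Type) [Fintype A] [Nonempty A] [Nonempty C] (S : Finset C) :
    PCIP n Bool A C Unit where
  lang := {true}
  prover := fun x => (exists_acceptProb_ge (A := A) (Z := Unit)
    fun (t : Fin n → A × C) _ => x = true ∨ ∀ i, (t i).2 ∈ S).choose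
  V := fun x t _ => x = true ∨ ∀ i, (t i).2 ∈ S

variable [Nonempty A] [Nonempty C]

lemma winning_forall_mem_iff (S : Finset C) (V : (Fin n → A × C) → Unit → Prop)
    (hV : ∀ t, V t () ↔ ∀ i, (t i).2 ∈ S) (h : List (A × C)) (hl : h.length = n) :
    winning V h ↔ ∀ e ∈ h, e.2 ∈ S := by
  constructor
  · rintro ⟨z, t, rfl, ht⟩ e he
    rw [List.mem_reverse, List.mem_ofFn] at he
    obtain ⟨i, rfl⟩ := he
    exact (hV t).1 ht i
  · intro hh
    have h1 : (List.ofFn fun i : Fin n => h.reverse[i]'(by simp [hl])) = h.reverse :=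
      List.ext_getElem (by simp [hl]) (by simp)
    refine ⟨(), _, by rw [h1, List.reverse_reverse], (hV _).2 fun i => hh _ ?_⟩
    exact List.mem_reverse.1 (List.getElem_mem _)

lemma gameValue_subsetProtocol_false (S : Finset C) :
    gameValue (winning ((subsetProtocol n A S).V false)) n [] =
      ((S.card : ℝ) / Fintype.card C) ^ n := by
  classical
  rw [gameValue_eq_of_forall_mem (n := n) (S := S)
    (winning_forall_mem_iff S _ fun t => by simp [subsetProtocol]) n [] (by simp)]
  simp

/-- Accepting always amounts to the full set of challenges, whose density is 1. -/
lemma gameValue_subsetProtocol_true (S : Finset C) :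
    gameValue (winning ((subsetProtocol n A S).V true)) n [] = 1 := by
  classical
  rw [gameValue_eq_of_forall_mem (n := n) (S := Finset.univ)
    (winning_forall_mem_iff _ _ fun t => by simp [subsetProtocol]) n [] (by simp)]
  simp

lemma subsetProtocol_complete (S : Finset C) : (subsetProtocol n A S).Complete := by
  intro x hx
  obtain rfl : x = true := hx
  refine le_antisymm ((ProverStrategy.acceptProb_le _ _).trans (gameValue_le_one _ _ _)) ?_
  exact (gameValue_subsetProtocol_true (A := A) S).symm.le.trans
    (exists_acceptProb_ge (A := A) (Z := Unit)
      fun (t : Fin n → A × C) _ => true = true ∨ ∀ i, (t i).2 ∈ S).choose_spec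

lemma soundnessError_subsetProtocol (S : Finset C) :
    (subsetProtocol n A S).soundnessError = ((S.card : ℝ) / Fintype.card C) ^ n := by
  refine le_antisymm ?_ ?_
  · refine Real.iSup_le (fun ⟨⟨x, hx⟩, B⟩ => ?_) (by positivity)
    have hx' : x = false := by simpa [subsetProtocol] using hx
    subst hx'
    exact (B.acceptProb_le _).trans (gameValue_subsetProtocol_false S).le
  · rw [← gameValue_subsetProtocol_false (n := n) (A := A)]
    exact PCIP.gameValue_le_soundnessError _ (x := false) (by simp [subsetProtocol])

end SubsetProtocol

/-! ### The attack bounds the Fiat–Shamir soundness error from below -/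

section Attack

/-- The middle entry of the hash inputs. -/
def fsPrev {n : ℕ} {X A C : Type} (H : FSDomain n X A C → C) (x : X) (a : Fin n → A) :
    (k : ℕ) → k < n → X ⊕ C
  | 0, _ => Sum.inl x
  | k + 1, hk => Sum.inr (fsChallenge H x a k (Nat.lt_of_succ_lt hk))

lemma fsChallenge_eq_fsPrev {n : ℕ} {X A C : Type} (H : FSDomain n X A C → C) (x : X)
    (a : Fin n → A) (k : ℕ) (hk : k < n) :
    fsChallenge H x a k hk = H (⟨k, hk⟩, fsPrev H x a k hk, a ⟨k, hk⟩) := by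
  cases k <;> rfl

variable {n M : ℕ} [NeZero n] {X A B C : Type} [Fintype X] [Fintype A] [Fintype B] [Fintype C]
  [DecidableEq X] [DecidableEq A] [DecidableEq B] [DecidableEq C]

lemma chainValue_le_one (S : Finset C) (H : FSDomain n X A C → C) (a : Fin n → A) (r : ℕ)
    (s : X ⊕ C) : chainValue S H a r s ≤ 1 := by
  induction r generalizing s with
  | zero => exact le_rfl
  | succ r ih =>
    refine mul_le_one₀ ?_ (chainValue_nonneg _ _ _ _ _) (ih _)
    split_ifs <;> norm_num

/-- Translates between the two ways of counting, by the `r` challenges outstanding and by the `k`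
rounds completed; `s` has to be the middle entry of the next hash input. -/
lemma fsChallenge_mem_of_chainValue_ne_zero (S : Finset C) (H : FSDomain n X A C → C) (x : X)
    (a : Fin n → A) (r k : ℕ) (hk : k + r = n) (s : X ⊕ C)
    (hs : ∀ h : k < n, s = fsPrev H x a k h) (h : chainValue S H a r s ≠ 0) (i : Fin n)
    (hi : k ≤ i) : fsChallenge H x a i i.2 ∈ S := by
  induction r generalizing k s with
  | zero => omega
  | succ r ih =>
    have hkn : k < n := by omega
    have h1 : roundOfRank n r = ⟨k, hkn⟩ := by
      rw [← roundOfRank_rev (⟨k, hkn⟩ : Fin n)]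
      congr 1
      rw [Fin.val_rev]
      simp only
      omega
    have h2 : H (roundOfRank n r, s, a (roundOfRank n r)) = fsChallenge H x a k hkn := by
      rw [fsChallenge_eq_fsPrev, h1, hs hkn]
    simp only [chainValue, h2, ne_eq, mul_eq_zero, not_or, ite_eq_right_iff, one_ne_zero,
      imp_false, not_not] at h
    rcases hi.eq_or_lt with hi | hi
    · have : i = ⟨k, hkn⟩ := Fin.ext hi.symm
      subst this
      exact h.1
    · exact ih (k + 1) (by omega) _ (fun _ => rfl) h.2 hi

lemma expect_attackValue_le_fsSoundnessError [AddCommGroup C] [Nonempty B]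
    (hC : ∀ c : C, c + c = 0) (S : Finset C) (a₀ : Fin n → Fin (M + 1) × B) (j₀ : ℕ)
    (js : List ℕ) :
    expect (fun H => attackValue S H a₀ j₀ js n (Sum.inl false)) ≤
      (subsetProtocol n (Fin (M + 1) × B) S).fsSoundnessError
        ((js.map fun j => 2 * j + 1).sum + 2 * j₀) := by
  classical
  obtain ⟨alg, halg⟩ := exists_oracleAlgorithm_attack (Z := Unit) hC S false a₀ j₀ js
  set P := subsetProtocol n (Fin (M + 1) × B) S
  have h1 : expect (fun H => attackValue S H a₀ j₀ js n (Sum.inl false)) ≤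
      alg.successProb fun H o => o.1 ∉ P.lang ∧ P.fsAccepts H o.1 o.2.1 o.2.2 := by
    unfold expect OracleAlgorithm.successProb
    refine div_le_div_of_nonneg_right (Finset.sum_le_sum fun H _ => ?_) (Nat.cast_nonneg _)
    refine (halg H (fun o => if o.1 ∉ P.lang ∧ P.fsAccepts H o.1 o.2.1 o.2.2 then 1 else 0)
      (fun o => by positivity) fun a z => ?_).trans (le_of_eq ?_)
    · by_cases h : chainValue S H a n (Sum.inl false) = 0
      · rw [h]
        positivity
      · rw [if_pos]
        · exact chainValue_le_one _ _ _ _ _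
        · refine ⟨by simp [P, subsetProtocol], Or.inr fun i => ?_⟩
          exact fsChallenge_mem_of_chainValue_ne_zero S H false a n 0 (zero_add n) _
            (fun _ => rfl) h i (Nat.zero_le _)
    · refine Finset.sum_congr rfl fun b _ => ?_
      split_ifs <;> simp
  refine h1.trans ?_
  unfold PCIP.fsSoundnessError
  have hb : BddAbove (Set.range fun alg : OracleAlgorithm ((js.map fun j => 2 * j + 1).sum + 2 * j₀)
      (FSDomain n Bool (Fin (M + 1) × B) C) C (Bool × (Fin n → Fin (M + 1) × B) × Unit) =>
      alg.successProb fun H o => o.1 ∉ P.lang ∧ P.fsAccepts H o.1 o.2.1 o.2.2) := by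
    refine ⟨1, ?_⟩
    rintro _ ⟨alg, rfl⟩
    exact alg.successProb_le_one _
  have := le_ciSup hb alg
  convert this
  rfl

end Attack

/-! ### Letting the density of good challenges tend to zero -/

section Limit

open Filter Topology

/-- The limit of the ratio of the success probability of the attack and the soundness error, as
the soundness error tends to `0`. -/
def attackLimit (j₀ : ℕ) : List ℕ → ℕ → ℝ
  | [], 0 => 1
  | [], _ + 1 => (2 * j₀ + 1) ^ 2
  | _ :: _, 0 => 1
  | j :: js, r + 1 => (2 * j + 1) ^ 2 * attackLimit j₀ js r + attackLimit j₀ js (r + 1)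

/-- Divide the recursion by `p ^ (r + 1)`: a success uses up one factor `p`, and the failure
probability tends to 1. -/
lemma tendsto_attackBound {p : ℕ → ℝ} (hp : ∀ m, p m ≠ 0) {lo hi : ℕ → ℕ → ℝ}
    (hlo : ∀ j, Tendsto (fun m => lo m j / p m) atTop (𝓝 ((2 * j + 1) ^ 2)))
    (hhi : ∀ j, Tendsto (fun m => hi m j) atTop (𝓝 0)) (j₀ : ℕ) (js : List ℕ) (r : ℕ) :
    Tendsto (fun m => attackBound (lo m) (hi m) (p m) j₀ js r / p m ^ r) atTop
      (𝓝 (attackLimit j₀ js r)) := by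
  induction js generalizing r with
  | nil =>
    cases r with
    | zero => simp [attackBound, attackLimit]
    | succ r =>
      refine (hlo j₀).congr fun m => ?_
      rw [attackBound, pow_succ]
      have := hp m
      field_simp
  | cons j js ih =>
    cases r with
    | zero => simp [attackBound, attackLimit]
    | succ r =>
      have h1 := ((hlo j).mul (ih r)).add (((hhi j).const_sub 1).mul (ih (r + 1)))
      rw [sub_zero, one_mul] at h1
      refine h1.congr fun m => ?_
      rw [attackBound, pow_succ]
      have := hp m
      field_simp

/-- The lower bound in `attackBound`, for a fraction `p` of good challenges and `1 / p`
candidates. -/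
def groverLower (p : ℝ) (j : ℕ) : ℝ := max ((2 * j + 1) ^ 2 * p - groverError j * (2 * p ^ 2)) 0

/-- The upper bound in `attackBound`, for a fraction `p` of good challenges and `1 / p`
candidates. -/
def groverUpper (p : ℝ) (j : ℕ) : ℝ := min ((2 * j + 1) ^ 2 * p + groverError j * (2 * p ^ 2)) 1

lemma tendsto_groverLower {p : ℕ → ℝ} (hp : ∀ m, 0 < p m) (hp0 : Tendsto p atTop (𝓝 0)) (j : ℕ) :
    Tendsto (fun m => groverLower (p m) j / p m) atTop (𝓝 ((2 * j + 1) ^ 2)) := by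
  have h1 : Tendsto (fun m => max ((2 * j + 1) ^ 2 - groverError j * (2 * p m)) 0) atTop
      (𝓝 (max ((2 * j + 1) ^ 2 - groverError j * (2 * 0)) 0)) :=
    ((((hp0.const_mul 2).const_mul _).const_sub _).max tendsto_const_nhds)
  rw [mul_zero, mul_zero, sub_zero, max_eq_left (by positivity)] at h1
  refine h1.congr fun m => ?_
  rw [groverLower, ← max_div_div_right (hp m).le, zero_div]
  congr 1
  have := (hp m).ne'
  field_simp

lemma tendsto_groverUpper {p : ℕ → ℝ} (hp0 : Tendsto p atTop (𝓝 0)) (j : ℕ) :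
    Tendsto (fun m => groverUpper (p m) j) atTop (𝓝 0) := by
  have h1 : Tendsto (fun m => groverUpper (p m) j) atTop
      (𝓝 (min ((2 * j + 1) ^ 2 * 0 + groverError j * (2 * 0 ^ 2)) 1)) :=
    (((hp0.const_mul _).add (((hp0.pow 2).const_mul 2).const_mul _)).min tendsto_const_nhds)
  simpa using h1

lemma ZMod.pi_add_self (l : ℕ) (c : Fin l → ZMod 2) : c + c = 0 :=
  funext fun i => CharTwo.add_self_eq_zero (c i)

/-- Protocols whose Fiat–Shamir transformation loses almost the limit value of any attack. -/
lemma exists_subsetProtocol {n : ℕ} [NeZero n] (M m : ℕ) :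
    ∃ S : Finset (Fin (n * m) → ZMod 2), (S.card : ℝ) / Fintype.card (Fin (n * m) → ZMod 2) =
      (1 / 2) ^ m ∧ ∀ (j₀ : ℕ) (js : List ℕ), js.length ≤ M →
      attackBound (groverLower ((1 / 2) ^ m)) (groverUpper ((1 / 2) ^ m)) ((1 / 2) ^ m) j₀ js n ≤
      (subsetProtocol n (Fin (M + 1) × Fin (2 ^ m)) S).fsSoundnessError
        ((js.map fun j => 2 * j + 1).sum + 2 * j₀) := by
  have hcard : Fintype.card (Fin (n * m) → ZMod 2) = 2 ^ (n * m) := by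
    simp [ZMod.card]
  have hnm : m ≤ n * m := Nat.le_mul_of_pos_left m (NeZero.pos n)
  -- Challenges have `n * m` bits, so that `|C|` is exactly the inverse of the soundness error `2 ^
  -- (-n * m)`.
  obtain ⟨S, -, hS⟩ := Finset.exists_subset_card_eq
    (s := (Finset.univ : Finset (Fin (n * m) → ZMod 2))) (n := 2 ^ (n * m - m))
    (by rw [Finset.card_univ, hcard]; exact Nat.pow_le_pow_right two_pos (Nat.sub_le _ _))
  have hp : (S.card : ℝ) / Fintype.card (Fin (n * m) → ZMod 2) = (1 / 2) ^ m := by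
    rw [hS, hcard]
    push_cast
    rw [one_div, inv_pow, div_eq_iff (by positivity), eq_comm,
      inv_mul_eq_iff_eq_mul₀ (by positivity), ← pow_add, Nat.add_sub_cancel' hnm]
  refine ⟨S, hp, fun j₀ js hjs => ?_⟩
  refine le_trans ?_ (expect_attackValue_le_fsSoundnessError (M := M) (ZMod.pi_add_self _) S
    (fun _ => (0, ⟨0, by positivity⟩)) j₀ js)
  have h := attackBound_le_expect (n := n) (M := M) (X := Bool) (B := Fin (2 ^ m)) S
    (lo := groverLower ((1 / 2) ^ m)) (hi := groverUpper ((1 / 2) ^ m)) (fun _ => le_max_right _ _)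
    (fun _ => min_le_right _ _) (fun j u hu => ?_) (fun _ => (0, ⟨0, by positivity⟩)) j₀ js hjs n
    le_rfl (Sum.inl false)
  · rwa [hp] at h
  · have h1 := abs_expect_groverSuccess_sub_le S hu j
    rw [hp, Fintype.card_fin] at h1
    -- The `2 ^ m` candidates match the density, so the second moment bound is `2 * p ^ 2`, as in
    -- `groverLower` and `groverUpper`.
    have h2 : ((1 / 2 : ℝ) ^ m) ^ 2 + (1 / 2) ^ m / ((2 ^ m : ℕ) : ℝ) = 2 * ((1 / 2) ^ m) ^ 2 := by
      push_cast
      rw [one_div, inv_pow]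
      field_simp
      norm_num
    rw [h2] at h1
    obtain ⟨h3, h4⟩ := abs_le.1 h1
    constructor
    · refine max_le (by linarith) ?_
      rw [← expect_const (D := FSDomain n Bool (Fin (M + 1) × Fin (2 ^ m)) (Fin (n * m) → ZMod 2))
        (Y := Fin (n * m) → ZMod 2) 0]
      exact expect_mono fun H => groverSuccess_nonneg _ _ _
    · refine le_min (by linarith) ?_
      rw [← expect_const (D := FSDomain n Bool (Fin (M + 1) × Fin (2 ^ m)) (Fin (n * m) → ZMod 2))
        (Y := Fin (n * m) → ZMod 2) 1]
      exact expect_mono fun H => groverSuccess_le_one _ _ _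

/-- If the limit values of the attacks exceed `(q / n) ^ (2 * n)`, then the security loss
`(q / n) ^ (2 * n)` occurs for arbitrarily small soundness errors. -/
lemma exists_pcip_of_attackLimit {n : ℕ} [NeZero n]
    (hlim : ∀ q : ℕ, 1 ≤ q → ∃ (j₀ : ℕ) (js : List ℕ),
      (js.map fun j => 2 * j + 1).sum + 2 * j₀ = q ∧ js.length ≤ q ∧
        ((q : ℝ) / n) ^ (2 * n) < attackLimit j₀ js n) (Q : ℕ) {δ : ℝ} (hδ : 0 < δ) :
    ∃ (l : ℕ) (A : Type) (_ : Fintype A) (P : PCIP n Bool A (Fin l → ZMod 2) Unit),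
      P.lang.Nonempty ∧ P.Complete ∧ 0 < P.soundnessError ∧ P.soundnessError ≤ δ ∧
      1 / P.soundnessError ≤ (Fintype.card (Fin l → ZMod 2) : ℝ) ∧
      ∀ q : ℕ, 1 ≤ q → q ≤ Q →
        ((q : ℝ) / n) ^ (2 * n) * P.soundnessError ≤ P.fsSoundnessError q := by
  choose! j₀ js hsum hlen hlt using hlim
  have hp : ∀ m : ℕ, (0 : ℝ) < (1 / 2) ^ m := fun m => by positivity
  have hp0 : Tendsto (fun m : ℕ => (1 / 2 : ℝ) ^ m) atTop (𝓝 0) :=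
    tendsto_pow_atTop_nhds_zero_of_lt_one (by norm_num) (by norm_num)
  -- The limit exceeds the target strictly, so the ratio does so eventually, and simultaneously for
  -- the finitely many `q ≤ Q`.
  have h1 : ∀ q ∈ Finset.Icc 1 Q, ∀ᶠ m in atTop, ((q : ℝ) / n) ^ (2 * n) <
      attackBound (groverLower ((1 / 2) ^ m)) (groverUpper ((1 / 2) ^ m)) ((1 / 2) ^ m) (j₀ q)
        (js q) n / ((1 / 2) ^ m) ^ n := fun q hq =>
    (tendsto_attackBound (fun m => (hp m).ne') (tendsto_groverLower hp hp0)
      (tendsto_groverUpper hp0) (j₀ q) (js q) n).eventually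
      (lt_mem_nhds (hlt q (Finset.mem_Icc.1 hq).1))
  have h2 : ∀ᶠ m in atTop, ((1 / 2 : ℝ) ^ m) ^ n ≤ δ := by
    have := (hp0.pow n).eventually_lt_const (u := δ) (by rwa [zero_pow (NeZero.ne n)])
    exact this.mono fun m hm => hm.le
  obtain ⟨m, h1, h2⟩ := (((Finset.eventually_all _).2 h1).and h2).exists
  -- A schedule has at most `q ≤ Q` checked searches; they use the labels from 1 to `Q`, and the
  -- final search uses 0.
  obtain ⟨S, hS, hSB⟩ := exists_subsetProtocol (n := n) Q m
  have hε : (subsetProtocol n (Fin (Q + 1) × Fin (2 ^ m)) S).soundnessError =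
      ((1 / 2) ^ m) ^ n := by
    rw [soundnessError_subsetProtocol, hS]
  refine ⟨n * m, Fin (Q + 1) × Fin (2 ^ m), inferInstance, subsetProtocol n _ S, ⟨true, rfl⟩,
    subsetProtocol_complete S, ?_, ?_, ?_, fun q hq hqQ => ?_⟩
  · rw [hε]
    positivity
  · rwa [hε]
  · rw [hε, ← pow_mul, mul_comm m n]
    simp [ZMod.card]
  · rw [hε]
    have h3 := h1 q (Finset.mem_Icc.2 ⟨hq, hqQ⟩)
    rw [lt_div_iff₀ (by positivity)] at h3
    refine h3.le.trans ?_
    have := hSB (j₀ q) (js q) ((hlen q hq).trans hqQ)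
    rwa [hsum q hq] at this

end Limit

/-! ### Distributing the queries over the searches -/

section Schedule

lemma one_le_attackLimit (j₀ : ℕ) (js : List ℕ) (r : ℕ) : 1 ≤ attackLimit j₀ js r := by
  induction js generalizing r with
  | nil =>
    cases r with
    | zero => exact le_rfl
    | succ r =>
      rw [attackLimit]
      have : (0 : ℝ) ≤ j₀ := Nat.cast_nonneg _
      nlinarith
  | cons j js ih =>
    cases r with
    | zero => exact le_rfl
    | succ r =>
      exact le_add_of_nonneg_of_le (mul_nonneg (sq_nonneg _) (zero_le_one.trans (ih r)))
        (ih (r + 1))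

lemma attackLimit_le_succ (j₀ : ℕ) (js : List ℕ) (r : ℕ) :
    attackLimit j₀ js r ≤ attackLimit j₀ js (r + 1) := by
  induction js generalizing r with
  | nil =>
    cases r with
    | zero => exact one_le_attackLimit j₀ [] 1
    | succ r => exact le_rfl
  | cons j js ih =>
    cases r with
    | zero => exact one_le_attackLimit j₀ (j :: js) 1
    | succ r => exact add_le_add (mul_le_mul_of_nonneg_left (ih r) (sq_nonneg _)) (ih (r + 1))

/-- By `attackLimit_le_succ`, the failure branch, which has one more round outstanding, is worth at
least as much as the success branch without its weight; so each search gains a factor `(2j + 1)^2 +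
1`. -/
lemma prod_mul_le_attackLimit (j₀ : ℕ) (js : List ℕ) (r : ℕ) :
    (js.map fun j : ℕ => ((2 * j + 1) ^ 2 + 1 : ℝ)).prod * attackLimit j₀ [] r ≤
      attackLimit j₀ js (js.length + r) := by
  induction js with
  | nil => simp
  | cons j js ih =>
    rw [List.map_cons, List.prod_cons, List.length_cons, add_right_comm, attackLimit]
    calc _ = ((2 * j + 1 : ℝ) ^ 2 + 1) *
          ((js.map fun j : ℕ => ((2 * j + 1) ^ 2 + 1 : ℝ)).prod * attackLimit j₀ [] r) := by ring
      _ ≤ ((2 * j + 1 : ℝ) ^ 2 + 1) * attackLimit j₀ js (js.length + r) := by gcongr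
      _ ≤ (2 * j + 1 : ℝ) ^ 2 * attackLimit j₀ js (js.length + r) +
          attackLimit j₀ js (js.length + r + 1) := by
        linarith [attackLimit_le_succ j₀ js (js.length + r)]

lemma length_le_sum_two_mul_add_one (js : List ℕ) :
    js.length ≤ (js.map fun j => 2 * j + 1).sum := by
  induction js with
  | nil => simp
  | cons j js ih =>
    rw [List.map_cons, List.sum_cons, List.length_cons]
    omega

/-- The tangent of the logarithm at `μ` bounds weighted powers of the mean. -/
lemma div_pow_le_of_mean {μ x y : ℝ} (hμ : 0 < μ) {N₁ N₂ n : ℕ} (hn : n = N₁ + N₂) (hn0 : n ≠ 0)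
    (hx : 0 ≤ x) (hy : 0 ≤ y) :
    ((N₁ * x + N₂ * y) / n) ^ (2 * n) ≤
      (μ ^ 2 * Real.exp (2 * (x - μ) / μ)) ^ N₁ * (μ ^ 2 * Real.exp (2 * (y - μ) / μ)) ^ N₂ := by
  have hn' : (n : ℝ) ≠ 0 := Nat.cast_ne_zero.2 hn0
  set z := (N₁ * x + N₂ * y) / n
  have hz : 0 ≤ z := by positivity
  have h2 : (n : ℝ) * z = N₁ * x + N₂ * y := mul_div_cancel₀ _ hn'
  clear_value z
  have h1 : z ≤ μ * Real.exp (z / μ - 1) := by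
    have := Real.add_one_le_exp (z / μ - 1)
    rw [sub_add_cancel, div_le_iff₀ hμ] at this
    linarith
  refine (pow_le_pow_left₀ hz h1 _).trans (le_of_eq ?_)
  have h3 : (n : ℝ) = N₁ + N₂ := by rw [hn, Nat.cast_add]
  rw [mul_pow, mul_pow, mul_pow, ← pow_mul, ← pow_mul, ← Real.exp_nat_mul, ← Real.exp_nat_mul,
    ← Real.exp_nat_mul, mul_mul_mul_comm, ← pow_add, ← Real.exp_add, ← mul_add, ← hn]
  congr 2
  push_cast
  field_simp
  linear_combination h2 - μ * h3

/-- Multiply by `exp x ≥ 1 + x + x²/2`: the product of the two quadratics is `1 + x⁴/4`. -/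
lemma exp_neg_lt {x : ℝ} (hx : 0 < x) : Real.exp (-x) < 1 - x + x ^ 2 / 2 := by
  have h1 := Real.quadratic_le_exp_of_nonneg hx.le
  rw [Real.exp_neg, inv_lt_iff_one_lt_mul₀ (Real.exp_pos x)]
  have h2 : 0 < 1 - x + x ^ 2 / 2 := by nlinarith [sq_nonneg (x - 1)]
  nlinarith [pow_pos hx 4, mul_le_mul_of_nonneg_left h1 h2.le]

/-- The optimal value of the tangent point, if the odd number is smaller than the even one. -/
lemma tangent_bounds_of_lt {e : ℝ} (he : 2 ≤ e) :
    e ^ 2 * Real.exp (2 * ((e - 1) - e) / e) < (e - 1) ^ 2 + 1 ∧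
      (e ^ 2 * Real.exp (2 * (e - e) / e)) ^ 2 < ((e - 1) ^ 2 + 1) * ((e + 1) ^ 2 + 1) ∧
      e ^ 2 * Real.exp (2 * (e - e) / e) < (e + 1) ^ 2 := by
  have he0 : 0 < e := by linarith
  simp only [sub_self, mul_zero, zero_div, Real.exp_zero, mul_one]
  refine ⟨?_, by nlinarith, by nlinarith⟩
  have h1 : 2 * ((e - 1) - e) / e = -(2 / e) := by ring
  rw [h1]
  -- The quadratic bound gives exactly `e² - 2e + 2 = (e - 1)² + 1`.
  calc _ < e ^ 2 * (1 - 2 / e + (2 / e) ^ 2 / 2) := by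
        gcongr
        exact exp_neg_lt (by positivity)
    _ = _ := by
        field_simp
        ring

/-- A good value of the tangent point, if the odd number is larger than the even one. -/
lemma tangent_bounds_of_gt {e : ℝ} (he : 2 ≤ e) :
    (e + 1 / e) ^ 2 * Real.exp (2 * ((e + 1) - (e + 1 / e)) / (e + 1 / e)) < (e + 1) ^ 2 + 1 ∧
      ((e + 1 / e) ^ 2 * Real.exp (2 * (e - (e + 1 / e)) / (e + 1 / e))) ^ 2 <
        ((e - 1) ^ 2 + 1) * ((e + 1) ^ 2 + 1) ∧
      (e + 1 / e) ^ 2 * Real.exp (2 * (e - (e + 1 / e)) / (e + 1 / e)) < (e + 1) ^ 2 := by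
  have he0 : 0 < e := by linarith
  have hw : 0 < e ^ 2 + 1 := by positivity
  have hμ : e + 1 / e = (e ^ 2 + 1) / e := by field_simp
  refine ⟨?_, ?_, ?_⟩
  · have h1 : 2 * ((e + 1) - (e + 1 / e)) / (e + 1 / e) = 2 * (e - 1) / (e ^ 2 + 1) := by
      rw [hμ]
      field_simp
      ring
    have hx0 : 0 ≤ 2 * (e - 1) / (e ^ 2 + 1) := div_nonneg (by linarith) hw.le
    have hx1 : 2 * (e - 1) / (e ^ 2 + 1) ≤ 1 := by
      rw [div_le_one hw]
      nlinarith [sq_nonneg (e - 1)]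
    -- An upper bound for `exp` at an argument in `[0, 1]` is needed; three Taylor terms and the
    -- remainder make it a polynomial inequality in `e`.
    have h2 := Real.exp_bound' hx0 hx1 (n := 3) (by norm_num)
    simp only [Finset.sum_range_succ, Finset.sum_range_zero, Nat.factorial] at h2
    norm_num at h2
    rw [h1, hμ]
    set x := 2 * (e - 1) / (e ^ 2 + 1) with hx
    have hxw : x * (e ^ 2 + 1) = 2 * (e - 1) := div_mul_cancel₀ _ hw.ne'
    refine (mul_le_mul_of_nonneg_left h2 (by positivity)).trans_lt ?_
    rw [div_pow, div_mul_eq_mul_div, div_lt_iff₀ (by positivity)]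
    rw [← mul_lt_mul_iff_left₀ hw]
    have h3 : (e ^ 2 + 1) ^ 2 * (1 + x + x ^ 2 / 2 + x ^ 3 * 4 / 18) * (e ^ 2 + 1) =
        (e ^ 2 + 1) ^ 3 + (x * (e ^ 2 + 1)) * (e ^ 2 + 1) ^ 2 +
          (x * (e ^ 2 + 1)) ^ 2 * (e ^ 2 + 1) / 2 + (x * (e ^ 2 + 1)) ^ 3 * 4 / 18 := by ring
    rw [hxw] at h3
    refine lt_of_eq_of_lt (Eq.trans ?_ h3) ?_
    · ring
    · nlinarith [pow_pos he0 3, mul_pos he0 he0]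
  · have h1 : 2 * (e - (e + 1 / e)) / (e + 1 / e) = -(2 / (e ^ 2 + 1)) := by
      rw [hμ]
      field_simp
      ring
    have h2 : Real.exp (-(2 / (e ^ 2 + 1))) ^ 2 = (Real.exp (4 / (e ^ 2 + 1)))⁻¹ := by
      rw [← Real.exp_nat_mul, ← Real.exp_neg]
      congr 1
      push_cast
      ring
    rw [h1, mul_pow, h2, hμ, mul_inv_lt_iff₀ (Real.exp_pos _)]
    have h3 := Real.quadratic_le_exp_of_nonneg (show 0 ≤ 4 / (e ^ 2 + 1) by positivity)
    have h4 : (0 : ℝ) < ((e - 1) ^ 2 + 1) * ((e + 1) ^ 2 + 1) := by positivity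
    refine lt_of_lt_of_le ?_ (mul_le_mul_of_nonneg_left h3 h4.le)
    have h5 : ((e - 1) ^ 2 + 1) * ((e + 1) ^ 2 + 1) = (e ^ 2) ^ 2 + 4 := by ring
    have h6 : (((e ^ 2 + 1) / e) ^ 2) ^ 2 = (e ^ 2 + 1) ^ 4 / (e ^ 2) ^ 2 := by
      rw [← pow_mul, div_pow]
      ring
    rw [h5, h6]
    have hs : 4 ≤ e ^ 2 := by nlinarith
    generalize e ^ 2 = s at hs hw ⊢
    rw [div_lt_iff₀ (by positivity)]
    have h7 : (s ^ 2 + 4) * (1 + 4 / (s + 1) + (4 / (s + 1)) ^ 2 / 2) * s ^ 2 =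
        (s ^ 2 + 4) * (s ^ 2 + 6 * s + 13) * s ^ 2 / (s + 1) ^ 2 := by
      field_simp
      ring
    rw [h7, lt_div_iff₀ (by positivity)]
    have : 0 < s := by linarith
    nlinarith [pow_pos this 2, pow_pos this 3, pow_pos this 4]
  · have h1 : 2 * (e - (e + 1 / e)) / (e + 1 / e) ≤ 0 := by
      refine div_nonpos_of_nonpos_of_nonneg ?_ (by positivity)
      have : 0 < 1 / e := by positivity
      linarith
    have h2 : 1 / e < 1 := by
      rw [div_lt_one he0]
      linarith
    calc _ ≤ (e + 1 / e) ^ 2 * 1 := by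
          gcongr
          exact Real.exp_le_one_iff.2 h1
      _ < _ := by
          rw [mul_one]
          gcongr

lemma mul_pow_lt_mul_pow {x₁ x₂ x₃ y₁ y₂ y₃ : ℝ} (h₁ : 0 < x₁) (h₂ : 0 < x₂) (h₃ : 0 < x₃)
    (h₁' : x₁ < y₁) (h₂' : x₂ < y₂) (h₃' : x₃ < y₃) {a b c : ℕ} (h : a ≠ 0 ∨ b ≠ 0 ∨ c ≠ 0) :
    x₁ ^ a * x₂ ^ b * x₃ ^ c < y₁ ^ a * y₂ ^ b * y₃ ^ c := by
  have k₁ := h₁.trans h₁'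
  have k₂ := h₂.trans h₂'
  have k₃ := h₃.trans h₃'
  rcases h with h | h | h
  · calc _ < y₁ ^ a * x₂ ^ b * x₃ ^ c := by gcongr
      _ ≤ _ := by gcongr
  · calc _ < x₁ ^ a * y₂ ^ b * x₃ ^ c := by gcongr
      _ ≤ _ := by gcongr
  · calc _ < x₁ ^ a * x₂ ^ b * y₃ ^ c := by gcongr
      _ ≤ _ := by gcongr

/-- A schedule of `N` blocks with `2 * u + 1` queries, `a` pairs of blocks with `2 * v + 1` and
`2 * v + 3` queries, and possibly a final block with `2 * v + 2` queries. -/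
lemma div_pow_lt_attackLimit {n q N a i u v : ℕ} (hn0 : n ≠ 0) (hn : n = N + 2 * a + i) (hi : i ≤ 1)
    (hq : q = N * (2 * u + 1) + (2 * a + i) * (2 * v + 2)) (huv : u = v ∨ u = v + 1) :
    ∃ (j₀ : ℕ) (js : List ℕ), (js.map fun j => 2 * j + 1).sum + 2 * j₀ = q ∧ js.length ≤ q ∧
      ((q : ℝ) / n) ^ (2 * n) < attackLimit j₀ js n := by
  -- A block with an even number of queries has no room for its check, so such blocks are paired as
  -- one query less and one more. A leftover one becomes the unchecked final search, with `j₀ = v +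
  -- 1`; without it, `j₀ = 0`.
  let js := List.replicate N u ++ List.replicate a v ++ List.replicate a (v + 1)
  have hsum : (js.map fun j => 2 * j + 1).sum + 2 * (i * (v + 1)) = q := by
    simp only [js, List.map_append, List.map_replicate, List.sum_append, List.sum_replicate,
      smul_eq_mul, hq]
    ring
  have hlen : js.length + i = n := by
    simp only [js, List.length_append, List.length_replicate, hn]
    ring
  refine ⟨i * (v + 1), js, hsum, ?_, ?_⟩
  · have := length_le_sum_two_mul_add_one js
    omega
  have h1 := prod_mul_le_attackLimit (i * (v + 1)) js i
  rw [hlen] at h1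
  refine lt_of_lt_of_le ?_ h1
  set e : ℝ := 2 * v + 2 with he
  have he2 : 2 ≤ e := by
    have : (0 : ℝ) ≤ v := Nat.cast_nonneg _
    linarith
  have h2 : attackLimit (i * (v + 1)) [] i = ((e + 1) ^ 2) ^ i := by
    interval_cases i
    · simp [attackLimit]
    · simp only [attackLimit, he]
      push_cast
      ring
  have h3 : (js.map fun j : ℕ => ((2 * j + 1) ^ 2 + 1 : ℝ)).prod =
      ((2 * u + 1) ^ 2 + 1) ^ N * (((e - 1) ^ 2 + 1) * ((e + 1) ^ 2 + 1)) ^ a := by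
    simp only [js, List.map_append, List.map_replicate, List.prod_append, List.prod_replicate, he,
      mul_pow]
    push_cast
    ring
  rw [h2, h3]
  have h4 : (q : ℝ) = N * (2 * u + 1) + (2 * a + i : ℕ) * e := by
    rw [hq, he]
    push_cast
    ring
  have key : ∀ μ : ℝ, 0 < μ → μ ^ 2 * Real.exp (2 * ((2 * u + 1) - μ) / μ) < (2 * u + 1) ^ 2 + 1 →
      (μ ^ 2 * Real.exp (2 * (e - μ) / μ)) ^ 2 < ((e - 1) ^ 2 + 1) * ((e + 1) ^ 2 + 1) →
      μ ^ 2 * Real.exp (2 * (e - μ) / μ) < (e + 1) ^ 2 → ((q : ℝ) / n) ^ (2 * n) <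
        ((2 * u + 1) ^ 2 + 1) ^ N * (((e - 1) ^ 2 + 1) * ((e + 1) ^ 2 + 1)) ^ a *
          ((e + 1) ^ 2) ^ i := by
    intro μ hμ k1 k2 k3
    rw [h4]
    refine (div_pow_le_of_mean hμ (by omega) hn0 (by positivity) (by linarith)).trans_lt ?_
    -- The `2a + i` even blocks are grouped into `a` pairs and `i` single ones, to be compared
    -- factor by factor.
    rw [pow_add, pow_mul, ← mul_assoc]
    exact mul_pow_lt_mul_pow (by positivity) (by positivity) (by positivity) k1 k2 k3 (by omega)
  rcases huv with rfl | rfl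
  · obtain ⟨k1, k2, k3⟩ := tangent_bounds_of_lt he2
    have : (2 * u + 1 : ℝ) = e - 1 := by rw [he]; ring
    exact key e (by linarith) (by rwa [this]) k2 k3
  · obtain ⟨k1, k2, k3⟩ := tangent_bounds_of_gt he2
    have : (2 * (v + 1 : ℕ) + 1 : ℝ) = e + 1 := by rw [he]; push_cast; ring
    exact key (e + 1 / e) (by positivity) (by rwa [this]) k2 k3

lemma exists_schedule {n : ℕ} (hn : n ≠ 0) (q : ℕ) : ∃ (j₀ : ℕ) (js : List ℕ),
    (js.map fun j => 2 * j + 1).sum + 2 * j₀ = q ∧ js.length ≤ q ∧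
      ((q : ℝ) / n) ^ (2 * n) < attackLimit j₀ js n := by
  have hn' : (0 : ℝ) < n := Nat.cast_pos.2 (Nat.pos_of_ne_zero hn)
  rcases lt_or_ge q n with h | h
  -- For `q < n` the target is below 1, and any schedule with `q` queries will do, here `q` searches
  -- without Grover iterations.
  · refine ⟨0, List.replicate q 0, by simp, by simp, lt_of_lt_of_le ?_ (one_le_attackLimit _ _ _)⟩
    refine pow_lt_one₀ (by positivity) ?_ (by omega)
    rw [div_lt_one hn']
    exact_mod_cast h
  have hs : q % n < n := Nat.mod_lt _ (Nat.pos_of_ne_zero hn)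
  have hdiv := Nat.div_add_mod q n
  have hκ : 1 ≤ q / n := (Nat.one_le_div_iff (Nat.pos_of_ne_zero hn)).2 h
  generalize q / n = κ at hdiv hκ
  generalize q % n = s at hs hdiv
  obtain ⟨d, rfl⟩ : ∃ d, n = d + s := ⟨n - s, by omega⟩
  -- The mean `q / n` lies between the integers `κ` and `κ + 1`: of the `n` blocks, `s` get `κ + 1`
  -- queries and `d` get `κ`. The parity of `κ` decides which of the two sizes is paired.
  rcases Nat.even_or_odd' κ with ⟨v, rfl | rfl⟩
  · obtain ⟨w, rfl⟩ : ∃ w, v = w + 1 := ⟨v - 1, by omega⟩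
    refine div_pow_lt_attackLimit (N := s) (a := d / 2) (i := d % 2) (u := w + 1) (v := w) hn
      (by omega) (by omega) ?_ (Or.inr rfl)
    rw [Nat.div_add_mod, ← hdiv]
    ring
  · refine div_pow_lt_attackLimit (N := d) (a := s / 2) (i := s % 2) (u := v) (v := v) hn
      (by omega) (by omega) ?_ (Or.inl rfl)
    rw [Nat.div_add_mod, ← hdiv]
    ring

end Schedule

end

theorem mainTheorem9 (n : ℕ) (hn : 1 ≤ n) :
    ∃ c₂ : ℝ, 0 < c₂ ∧
      (∀ (X A C Z : Type) [Fintype X] [Fintype A] [Fintype C] [Fintype Z] [AddCommGroup C]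
        (P : PCIP n X A C Z), 1 ≤ (Fintype.card C : ℝ) * P.soundnessError →
        ∀ q : ℕ, 1 ≤ q →
          P.fsSoundnessError q ≤ c₂ * (q : ℝ) ^ (2 * n) * P.soundnessError) ∧
      (∀ (Q : ℕ) (δ : ℝ), 0 < δ →
        ∃ (l : ℕ) (X A Z : Type) (_ : Fintype X) (_ : Fintype A) (_ : Fintype Z)
          (P : PCIP n X A (Fin l → ZMod 2) Z),
          P.lang.Nonempty ∧ P.Complete ∧
          0 < P.soundnessError ∧ P.soundnessError ≤ δ ∧
          1 / P.soundnessError ≤ (Fintype.card (Fin l → ZMod 2) : ℝ) ∧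
          ∀ q : ℕ, 1 ≤ q → q ≤ Q →
            ((n : ℝ) ^ (2 * n))⁻¹ * (q : ℝ) ^ (2 * n) * P.soundnessError ≤
                P.fsSoundnessError q ∧
              P.fsSoundnessError q ≤ c₂ * (q : ℝ) ^ (2 * n) * P.soundnessError) := by
  have hn0 : n ≠ 0 := Nat.one_le_iff_ne_zero.1 hn
  have : NeZero n := ⟨hn0⟩
  refine ⟨2 * 9 ^ n, by positivity, fun X A C Z _ _ _ _ _ P h q hq => fsSoundnessError_le P hn h hq,
    fun Q δ hδ => ?_⟩
  obtain ⟨l, A, _, P, hL, hcomp, hpos, hle, hC, hlow⟩ :=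
    exists_pcip_of_attackLimit (fun q _ => exists_schedule hn0 q) Q hδ
  refine ⟨l, Bool, A, Unit, inferInstance, inferInstance, inferInstance, P, hL, hcomp, hpos, hle,
    hC, fun q hq hqQ => ⟨?_, fsSoundnessError_le P hn ?_ hq⟩⟩
  · refine le_trans (le_of_eq ?_) (hlow q hq hqQ)
    rw [div_pow, div_eq_inv_mul]
  · rwa [div_le_iff₀ hpos] at hC
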